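/- Let $d>0$ and let $\Gamma=(\Gamma_1,\Gamma_2):\mathbb R\to\mathbb R^2$ be a $C^3$ embedding (a $C^3$-diffeomorphism of $\mathbb R$ onto $\Gamma(\mathbb R)$) parametrized by arc length, $\dot\Gamma_1(s)^2+\dot\Gamma_2(s)^2=1$. Let $N(s)=(-\dot\Gamma_2(s),\dot\Gamma_1(s))$ be its unit normal and $\gamma(s)=-\dot\Gamma(s)\cdot\dot N(s)$ its signed curvature. Assume that there are $\gamma_-,\gamma_+>0$ with $-\gamma_-\le\gamma(s)\le\gamma_+<1/d$ for all $s\in\mathbb R$, that $\dot\gamma$ is bounded, and that the strip $\Omega=\{\Gamma(s)+uN(s): s\in\mathbb R,\ u\in(0,d)\}$ does not intersect itself, i.e. the map $(s,u)\mapsto\Gamma(s)+uN(s)$ is injective on $\mathbb R\times(0,d)$. Let $L_\Omega^{DN}$ be the self-adjoint operator in the complex Hilbert space $L^2\bigl(\mathbb R\times(0,d),(1-u\gamma(s))\,ds\,du\bigr)$ associated with the quadratic form $$q_0(f,g)=\int_{\mathbb R}ds\int_0^d du\,\Bigl(\frac{1}{1-u\gamma(s)}\,\overline{\frac{\partial f}{\partial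 s}}\,\frac{\partial g}{\partial s}+(1-u\gamma(s))\,\overline{\frac{\partial f}{\partial u}}\,\frac{\partial g}{\partial u}\Bigr)$$ with domain $Q(q_0)=\{f\in H^1(\mathbb R\times(0,d)) : f(s,0)=0 \text{ for a.e. } s\in\mathbb R\}$, where $f(\cdot,0)$ is the trace of $f$ on $\mathbb R\times\{0\}$. That is, $f\in D(L_\Omega^{DN})$ and $L_\Omega^{DN}f=h$ if and only if $f\in Q(q_0)$ and $q_0(g,f)=\langle g,h\rangle$ for all $g\in Q(q_0)$. (It is the Laplacian $-\Delta$ of the strip in the curvilinear coordinates $(s,u)$, with the Dirichlet condition on the side $u=0$ and the Neumann condition on the side $u=d$.) Suppose that there is $s_0>0$ such that $\gamma(s)=0$ for $|s|\ge s_0$, that $\int_{-s_0}^{s_0}\gamma(s)\,ds=0$, and that $\|\gamma\|_{L^2(\mathbb R)}>0$. Then $$\inf\sigma(L_\Omega^{DN})<\frac{\pi^2}{4d^2},$$ and $L_\Omega^{DN}$ has at least one discrete eigenvalue $\mu$ (an isolated point of the spectrum that is an eigenvalue of finite multiplicity) with $0<\mu<\frac{\pi^2}{4d^2}$. -/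

import Mathlib

open MeasureTheory Set
open scoped ENNReal ContDiff ComplexConjugate

/-! ### Planar curves -/

/-- The unit normal `N = (-Γ₂', Γ₁')` of a unit speed planar curve. -/
noncomputable def curveNormal (Γ : ℝ → EuclideanSpace ℝ (Fin 2)) (s : ℝ) :
    EuclideanSpace ℝ (Fin 2) :=
  !₂[-(deriv Γ s 1), deriv Γ s 0]

/-- The signed curvature `γ = -Γ' · N'` of a unit speed planar curve. -/
noncomputable def signedCurvature (Γ : ℝ → EuclideanSpace ℝ (Fin 2)) (s : ℝ) : ℝ :=
  -(inner ℝ (deriv Γ s) (deriv (curveNormal Γ) s))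

/-- A curved planar strip of width `d` built along a `C³` curve `Γ`, parametrized by arc length. -/
structure CurvedStrip where
  /-- the width of the strip -/
  d : ℝ
  d_pos : 0 < d
  /-- the reference curve -/
  Γ : ℝ → EuclideanSpace ℝ (Fin 2)
  contDiff_Γ : ContDiff ℝ 3 Γ
  isEmbedding_Γ : Topology.IsEmbedding Γ
  unit_speed : ∀ s, deriv Γ s 0 ^ 2 + deriv Γ s 1 ^ 2 = 1
  curvature_bounds : ∃ γm γp : ℝ, 0 < γm ∧ 0 < γp ∧ γp < 1 / d ∧
    ∀ s, -γm ≤ signedCurvature Γ s ∧ signedCurvature Γ s ≤ γp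
  curvature_deriv_bounded : ∃ C : ℝ, ∀ s, |deriv (signedCurvature Γ) s| ≤ C
  /-- the strip does not intersect itself -/
  not_selfintersecting :
    InjOn (fun p : ℝ × ℝ => Γ p.1 + p.2 • curveNormal Γ p.1) (univ ×ˢ Ioo 0 d)

/-! ### Sobolev functions on open subsets of the plane -/

/-- Real test functions on `U`, i.e. elements of `C_c^∞(U)`, extended by zero. -/
def IsTestFunction (U : Set (ℝ × ℝ)) (φ : ℝ × ℝ → ℝ) : Prop :=
  ContDiff ℝ ∞ φ ∧ HasCompactSupport φ ∧ tsupport φ ⊆ U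

/-- `g` is a square integrable weak derivative of `f` on `U` in the direction `v`. -/
def HasL2WeakDeriv (U : Set (ℝ × ℝ)) (v : ℝ × ℝ) (f g : ℝ × ℝ → ℂ) : Prop :=
  MemLp g 2 (volume.restrict U) ∧
    ∀ φ : ℝ × ℝ → ℝ, IsTestFunction U φ →
      ∫ p in U, fderiv ℝ φ p v • f p = -∫ p in U, φ p • g p

/-- `f` belongs to the Sobolev space `H¹(U)`. -/
def MemH1 (U : Set (ℝ × ℝ)) (f : ℝ × ℝ → ℂ) : Prop :=
  MemLp f 2 (volume.restrict U) ∧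
    (∃ g, HasL2WeakDeriv U (1, 0) f g) ∧ (∃ g, HasL2WeakDeriv U (0, 1) f g)

open Classical in
/-- The weak derivative of `f` on `U` in the direction `v` (a representative of it);
zero if there is none in `L²(U)`. -/
noncomputable def weakDeriv (U : Set (ℝ × ℝ)) (v : ℝ × ℝ) (f : ℝ × ℝ → ℂ) : ℝ × ℝ → ℂ :=
  if h : ∃ g, HasL2WeakDeriv U v f g then h.choose else 0

/-- The straight strip `ℝ × (0, d)`. -/
def straightStrip (d : ℝ) : Set (ℝ × ℝ) := univ ×ˢ Ioo 0 d

/-- `τ` is the trace on `ℝ × {0}` of the function `f ∈ H¹(ℝ × (0, d))`: Green's formula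
`∫ φ ∂f/∂u = -∫ f ∂φ/∂u - ∫ φ(s, 0) τ(s) ds` holds for all smooth compactly supported functions
`φ` that vanish near `u ≥ d`, but not necessarily on `ℝ × {0}`. -/
def IsTraceAtZero (d : ℝ) (f : ℝ × ℝ → ℂ) (τ : ℝ → ℂ) : Prop :=
  MemLp τ 2 volume ∧
    ∀ φ : ℝ × ℝ → ℝ, IsTestFunction {p | p.2 < d} φ →
      ∫ p in straightStrip d, φ p • weakDeriv (straightStrip d) (0, 1) f p =
        -(∫ p in straightStrip d, fderiv ℝ φ p (0, 1) • f p) - ∫ s, φ (s, 0) • τ s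

/-! ### Basic facts on weak derivatives -/

theorem isOpen_straightStrip (d : ℝ) : IsOpen (straightStrip d) :=
  isOpen_univ.prod isOpen_Ioo

theorem weakDeriv_spec {U : Set (ℝ × ℝ)} {v : ℝ × ℝ} {f : ℝ × ℝ → ℂ}
    (h : ∃ g, HasL2WeakDeriv U v f g) : HasL2WeakDeriv U v f (weakDeriv U v f) := by
  unfold weakDeriv
  rw [dif_pos h]
  exact h.choose_spec

theorem integrable_continuous_smul {ν : Measure (ℝ × ℝ)} [IsFiniteMeasureOnCompacts ν]
    {φ : ℝ × ℝ → ℝ} (hφ : Continuous φ) (hc : HasCompactSupport φ) {g : ℝ × ℝ → ℂ}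
    (hg : MemLp g 2 ν) : Integrable (fun p => φ p • g p) ν :=
  memLp_one_iff_integrable.1 (MemLp.smul (p := 2) (q := 2) (r := 1) hg (hφ.memLp_of_hasCompactSupport hc))

theorem IsTestFunction.continuous_fderiv_apply {U : Set (ℝ × ℝ)} {φ : ℝ × ℝ → ℝ}
    (h : IsTestFunction U φ) (v : ℝ × ℝ) : Continuous (fun p => fderiv ℝ φ p v) :=
  (h.1.continuous_fderiv (by simp)).clm_apply continuous_const

theorem IsTestFunction.hasCompactSupport_fderiv_apply {U : Set (ℝ × ℝ)} {φ : ℝ × ℝ → ℝ}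
    (h : IsTestFunction U φ) (v : ℝ × ℝ) : HasCompactSupport (fun p => fderiv ℝ φ p v) :=
  h.2.1.fderiv_apply ℝ v

theorem HasL2WeakDeriv.ae_unique {U : Set (ℝ × ℝ)} (hU : IsOpen U) {v : ℝ × ℝ}
    {f g₁ g₂ : ℝ × ℝ → ℂ} (h₁ : HasL2WeakDeriv U v f g₁) (h₂ : HasL2WeakDeriv U v f g₂) :
    g₁ =ᵐ[volume.restrict U] g₂ := by
  have hl : LocallyIntegrableOn (fun p => g₁ p - g₂ p) U volume :=
    locallyIntegrableOn_of_locallyIntegrable_restrict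
      ((h₁.1.sub h₂.1).locallyIntegrable (by norm_num))
  have key := hU.ae_eq_zero_of_integral_contDiff_smul_eq_zero hl (fun φ h1 h2 h3 => by
    have e : ∫ p in U, φ p • (g₁ p - g₂ p) = 0 := by
      simp only [smul_sub]
      rw [integral_sub (integrable_continuous_smul h1.continuous h2 h₁.1)
        (integrable_continuous_smul h1.continuous h2 h₂.1)]
      have a := h₁.2 φ ⟨h1, h2, h3⟩
      have b := h₂.2 φ ⟨h1, h2, h3⟩
      rw [a] at b
      rw [neg_inj.mp b, sub_self]
    rw [← e]
    refine (setIntegral_eq_integral_of_forall_compl_eq_zero fun p hp => ?_).symm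
    rw [image_eq_zero_of_notMem_tsupport (fun h => hp (h3 h)), zero_smul])
  rw [Filter.EventuallyEq, ae_restrict_iff' hU.measurableSet]
  filter_upwards [key] with p hp hpU
  exact sub_eq_zero.mp (hp hpU)

theorem HasL2WeakDeriv.congr {U : Set (ℝ × ℝ)} {v : ℝ × ℝ} {f f' g : ℝ × ℝ → ℂ}
    (h : HasL2WeakDeriv U v f g) (hf : f' =ᵐ[volume.restrict U] f) :
    HasL2WeakDeriv U v f' g := by
  refine ⟨h.1, fun φ hφ => ?_⟩
  rw [← h.2 φ hφ]
  refine integral_congr_ae ?_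
  filter_upwards [hf] with p hp
  rw [hp]

theorem HasL2WeakDeriv.add {U : Set (ℝ × ℝ)} {v : ℝ × ℝ} {f f' g g' : ℝ × ℝ → ℂ}
    (hf : MemLp f 2 (volume.restrict U)) (hf' : MemLp f' 2 (volume.restrict U))
    (h : HasL2WeakDeriv U v f g) (h' : HasL2WeakDeriv U v f' g') :
    HasL2WeakDeriv U v (f + f') (g + g') := by
  refine ⟨h.1.add h'.1, fun φ hφ => ?_⟩
  have c1 := hφ.continuous_fderiv_apply v
  have c2 := hφ.hasCompactSupport_fderiv_apply v
  simp only [Pi.add_apply, smul_add]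
  rw [integral_add (integrable_continuous_smul c1 c2 hf) (integrable_continuous_smul c1 c2 hf'),
    integral_add (integrable_continuous_smul hφ.1.continuous hφ.2.1 h.1)
      (integrable_continuous_smul hφ.1.continuous hφ.2.1 h'.1), h.2 φ hφ, h'.2 φ hφ]
  ring

theorem HasL2WeakDeriv.const_smul {U : Set (ℝ × ℝ)} {v : ℝ × ℝ} {f g : ℝ × ℝ → ℂ} (c : ℂ)
    (h : HasL2WeakDeriv U v f g) : HasL2WeakDeriv U v (c • f) (c • g) := by
  refine ⟨h.1.const_smul c, fun φ hφ => ?_⟩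
  simp only [Pi.smul_apply]
  simp_rw [smul_comm _ c]
  rw [integral_smul, integral_smul, h.2 φ hφ, smul_neg]

/-- Compactly supported smooth functions have their classical derivatives as weak derivatives,
even with respect to test functions that do not vanish on the boundary. -/
theorem setIntegral_fderiv_smul_of_tsupport_subset {U : Set (ℝ × ℝ)} {ψ φ : ℝ × ℝ → ℝ}
    (hψ : IsTestFunction U ψ) (hφ : ContDiff ℝ ∞ φ) (v : ℝ × ℝ) :
    ∫ p in U, fderiv ℝ φ p v • ((ψ p : ℝ) : ℂ) =
      -∫ p in U, φ p • ((fderiv ℝ ψ p v : ℝ) : ℂ) := by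
  have hz : ∀ p, p ∉ U → ψ p = 0 := fun p hp =>
    image_eq_zero_of_notMem_tsupport fun h => hp (hψ.2.2 h)
  have hz' : ∀ p, p ∉ U → fderiv ℝ ψ p v = 0 := fun p hp => by
    have : fderiv ℝ ψ p = 0 := image_eq_zero_of_notMem_tsupport
      fun h => hp (hψ.2.2 (tsupport_fderiv_subset ℝ h))
    rw [this]; rfl
  have e1 : ∀ p, fderiv ℝ φ p v • ((ψ p : ℝ) : ℂ) = ((ψ p * fderiv ℝ φ p v : ℝ) : ℂ) := fun p => by
    rw [Complex.real_smul]; push_cast; ring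
  have e2 : ∀ p, φ p • ((fderiv ℝ ψ p v : ℝ) : ℂ) = ((fderiv ℝ ψ p v * φ p : ℝ) : ℂ) := fun p => by
    rw [Complex.real_smul]; push_cast; ring
  simp_rw [e1, e2]
  rw [integral_complex_ofReal, integral_complex_ofReal,
    setIntegral_eq_integral_of_forall_compl_eq_zero (fun p hp => by rw [hz p hp, zero_mul]),
    setIntegral_eq_integral_of_forall_compl_eq_zero (fun p hp => by rw [hz' p hp, zero_mul])]
  have cφ : Continuous fun p => fderiv ℝ φ p v :=
    (hφ.continuous_fderiv (by simp)).clm_apply continuous_const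
  rw [integral_mul_fderiv_eq_neg_fderiv_mul_of_integrable]
  · push_cast; rfl
  · exact ((hψ.continuous_fderiv_apply v).mul hφ.continuous).integrable_of_hasCompactSupport
      (hψ.hasCompactSupport_fderiv_apply v).mul_right
  · exact (hψ.1.continuous.mul cφ).integrable_of_hasCompactSupport hψ.2.1.mul_right
  · exact (hψ.1.continuous.mul hφ.continuous).integrable_of_hasCompactSupport hψ.2.1.mul_right
  · exact fun p _ => (hψ.1.differentiable (by simp)) p
  · exact fun p _ => (hφ.differentiable (by simp)) p

theorem IsTestFunction.memLp_ofReal {U : Set (ℝ × ℝ)} {ψ : ℝ × ℝ → ℝ}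
    (hψ : IsTestFunction U ψ) (ν : Measure (ℝ × ℝ)) [IsFiniteMeasureOnCompacts ν] :
    MemLp (fun p => ((ψ p : ℝ) : ℂ)) 2 ν :=
  (hψ.1.continuous.memLp_of_hasCompactSupport hψ.2.1).ofReal

theorem IsTestFunction.hasL2WeakDeriv {U : Set (ℝ × ℝ)} {ψ : ℝ × ℝ → ℝ}
    (hψ : IsTestFunction U ψ) (v : ℝ × ℝ) :
    HasL2WeakDeriv U v (fun p => ((ψ p : ℝ) : ℂ)) (fun p => ((fderiv ℝ ψ p v : ℝ) : ℂ)) :=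
  ⟨((hψ.continuous_fderiv_apply v).memLp_of_hasCompactSupport
      (hψ.hasCompactSupport_fderiv_apply v)).ofReal,
    fun _ hφ => setIntegral_fderiv_smul_of_tsupport_subset hψ hφ.1 v⟩

/-! ### The Hilbert space, the quadratic form and the operator -/

namespace CurvedStrip

/-- The signed curvature `γ` of the reference curve. -/
noncomputable def γ (W : CurvedStrip) : ℝ → ℝ := signedCurvature W.Γ

/-- The density `1 - u γ(s)` at the point `p = (s, u)`. -/
noncomputable def density (W : CurvedStrip) (p : ℝ × ℝ) : ℝ := 1 - p.2 * W.γ p.1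

/-- The measure `(1 - u γ(s)) ds du` on `ℝ × (0, d)`. -/
noncomputable def weightedMeasure (W : CurvedStrip) : Measure (ℝ × ℝ) :=
  (volume.restrict (straightStrip W.d)).withDensity fun p => ENNReal.ofReal (W.density p)

/-- The Hilbert space `L²(ℝ × (0, d), (1 - u γ(s)) ds du)`. -/
abbrev HilbertSpace (W : CurvedStrip) : Type := Lp ℂ 2 W.weightedMeasure

/-- The sesquilinear form
`q₀(f, g) = ∫∫ (1 - uγ)⁻¹ conj(∂f/∂s) ∂g/∂s + (1 - uγ) conj(∂f/∂u) ∂g/∂u`. -/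
noncomputable def q₀ (W : CurvedStrip) (f g : ℝ × ℝ → ℂ) : ℂ :=
  ∫ p in straightStrip W.d,
    ((1 / W.density p : ℝ) * conj (weakDeriv (straightStrip W.d) (1, 0) f p) *
        weakDeriv (straightStrip W.d) (1, 0) g p +
      (W.density p : ℝ) * conj (weakDeriv (straightStrip W.d) (0, 1) f p) *
        weakDeriv (straightStrip W.d) (0, 1) g p)

/-- The condition defining the form domain: `f ∈ H¹(ℝ × (0, d))` and the trace of `f` satisfies
`f(s, 0) = 0` for almost every `s`. -/
def MemFormDomain (W : CurvedStrip) (f : ℝ × ℝ → ℂ) : Prop :=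
  MemH1 (straightStrip W.d) f ∧ ∃ τ : ℝ → ℂ, IsTraceAtZero W.d f τ ∧ ∀ᵐ s, τ s = 0

theorem continuous_γ (W : CurvedStrip) : Continuous W.γ := by
  have h1 : ContDiff ℝ 2 (deriv W.Γ) := by
    have := W.contDiff_Γ
    rw [show (3 : WithTop ℕ∞) = 2 + 1 by norm_num, contDiff_succ_iff_deriv] at this
    exact this.2.2
  have h2 : ContDiff ℝ 2 (curveNormal W.Γ) := by
    rw [contDiff_euclidean] at h1 ⊢
    intro i
    fin_cases i
    · simpa [curveNormal] using (h1 1).neg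
    · simpa [curveNormal] using h1 0
  have h3 := h2.continuous_deriv (by norm_num)
  exact (h1.continuous.inner h3).neg

theorem continuous_density (W : CurvedStrip) : Continuous W.density :=
  continuous_const.sub (continuous_snd.mul (W.continuous_γ.comp continuous_fst))

theorem exists_density_bounds (W : CurvedStrip) : ∃ c C : ℝ, 0 < c ∧
    ∀ p ∈ straightStrip W.d, c ≤ W.density p ∧ W.density p ≤ C := by
  obtain ⟨a, b, ha, hb, hbd, h⟩ := W.curvature_bounds
  have hd := W.d_pos
  refine ⟨1 - W.d * b, 1 + W.d * a, ?_, ?_⟩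
  · rw [lt_div_iff₀ hd] at hbd; linarith
  · rintro ⟨s, u⟩ ⟨-, hu0, hud⟩
    simp only at hu0 hud
    have h1 := (h s).1
    have h2 := (h s).2
    simp only [density, γ]
    constructor <;> nlinarith

theorem density_pos (W : CurvedStrip) {p : ℝ × ℝ} (hp : p ∈ straightStrip W.d) :
    0 < W.density p := by
  obtain ⟨c, C, hc, h⟩ := W.exists_density_bounds
  exact hc.trans_le (h p hp).1

theorem ae_mem_straightStrip (d : ℝ) :
    ∀ᵐ p ∂(volume.restrict (straightStrip d)), p ∈ straightStrip d :=
  ae_restrict_mem (isOpen_straightStrip d).measurableSet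

/-- The measures `ds du` and `(1 - u γ(s)) ds du` on `ℝ × (0, d)` have the same null sets. -/
theorem volume_absolutelyContinuous (W : CurvedStrip) :
    volume.restrict (straightStrip W.d) ≪ W.weightedMeasure := by
  refine withDensity_absolutelyContinuous'
    W.continuous_density.measurable.ennreal_ofReal.aemeasurable ?_
  filter_upwards [ae_mem_straightStrip W.d] with p hp
  simpa using W.density_pos hp

theorem weightedMeasure_le (W : CurvedStrip) : ∃ c : ℝ≥0∞, c ≠ ⊤ ∧
    W.weightedMeasure ≤ c • volume.restrict (straightStrip W.d) := by
  obtain ⟨c, C, hc, h⟩ := W.exists_density_bounds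
  refine ⟨ENNReal.ofReal C, ENNReal.ofReal_ne_top, ?_⟩
  rw [← withDensity_const]
  refine withDensity_mono ?_
  filter_upwards [ae_mem_straightStrip W.d] with p hp
  exact ENNReal.ofReal_le_ofReal (h p hp).2

theorem memLp_weightedMeasure (W : CurvedStrip) {f : ℝ × ℝ → ℂ}
    (hf : MemLp f 2 (volume.restrict (straightStrip W.d))) : MemLp f 2 W.weightedMeasure := by
  obtain ⟨c, hc, h⟩ := W.weightedMeasure_le
  exact hf.of_measure_le_smul hc h

theorem MemFormDomain.congr {W : CurvedStrip} {f f' : ℝ × ℝ → ℂ} (h : W.MemFormDomain f)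
    (hf : f' =ᵐ[volume.restrict (straightStrip W.d)] f) : W.MemFormDomain f' := by
  obtain ⟨⟨h0, ⟨g1, h1⟩, g2, h2⟩, τ, ⟨hτ, ht⟩, hz⟩ := h
  refine ⟨⟨(memLp_congr_ae hf).2 h0, ⟨g1, h1.congr hf⟩, g2, h2.congr hf⟩, τ, ⟨hτ, fun φ hφ => ?_⟩,
    hz⟩
  have hw := (weakDeriv_spec ⟨g2, h2.congr hf⟩).ae_unique (isOpen_straightStrip W.d)
    ((weakDeriv_spec ⟨g2, h2⟩).congr hf)
  have e1 : ∫ p in straightStrip W.d, φ p • weakDeriv (straightStrip W.d) (0, 1) f' p =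
      ∫ p in straightStrip W.d, φ p • weakDeriv (straightStrip W.d) (0, 1) f p := by
    refine integral_congr_ae ?_
    filter_upwards [hw] with p hp
    rw [hp]
  have e2 : ∫ p in straightStrip W.d, fderiv ℝ φ p (0, 1) • f' p =
      ∫ p in straightStrip W.d, fderiv ℝ φ p (0, 1) • f p := by
    refine integral_congr_ae ?_
    filter_upwards [hf] with p hp
    rw [hp]
  rw [e1, e2, ht φ hφ]

theorem weakDeriv_add_ae {d : ℝ} {v : ℝ × ℝ} {f g : ℝ × ℝ → ℂ}
    (hf : MemLp f 2 (volume.restrict (straightStrip d)))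
    (hg : MemLp g 2 (volume.restrict (straightStrip d)))
    (h : ∃ k, HasL2WeakDeriv (straightStrip d) v f k)
    (h' : ∃ k, HasL2WeakDeriv (straightStrip d) v g k) :
    weakDeriv (straightStrip d) v (f + g) =ᵐ[volume.restrict (straightStrip d)]
      weakDeriv (straightStrip d) v f + weakDeriv (straightStrip d) v g :=
  have k := (weakDeriv_spec h).add hf hg (weakDeriv_spec h')
  (weakDeriv_spec ⟨_, k⟩).ae_unique (isOpen_straightStrip d) k

theorem weakDeriv_smul_ae {d : ℝ} {v : ℝ × ℝ} (c : ℂ) {f : ℝ × ℝ → ℂ}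
    (h : ∃ k, HasL2WeakDeriv (straightStrip d) v f k) :
    weakDeriv (straightStrip d) v (c • f) =ᵐ[volume.restrict (straightStrip d)]
      c • weakDeriv (straightStrip d) v f :=
  have k := (weakDeriv_spec h).const_smul c
  (weakDeriv_spec ⟨_, k⟩).ae_unique (isOpen_straightStrip d) k

theorem MemFormDomain.add {W : CurvedStrip} {f g : ℝ × ℝ → ℂ} (hf : W.MemFormDomain f)
    (hg : W.MemFormDomain g) : W.MemFormDomain (f + g) := by
  obtain ⟨⟨f0, ⟨f1, hf1⟩, f2, hf2⟩, τ, ⟨hτ, ht⟩, hz⟩ := hf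
  obtain ⟨⟨g0, ⟨g1, hg1⟩, g2, hg2⟩, τ', ⟨hτ', ht'⟩, hz'⟩ := hg
  refine ⟨⟨f0.add g0, ⟨_, hf1.add f0 g0 hg1⟩, _, hf2.add f0 g0 hg2⟩, 0, ⟨MemLp.zero, ?_⟩,
    Filter.Eventually.of_forall fun _ => rfl⟩
  intro φ hφ
  have hw := weakDeriv_add_ae f0 g0 ⟨f2, hf2⟩ ⟨g2, hg2⟩
  have z : ∫ s, φ (s, 0) • τ s = 0 := integral_eq_zero_of_ae (by
    filter_upwards [hz] with s hs
    simp [hs])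
  have z' : ∫ s, φ (s, 0) • τ' s = 0 := integral_eq_zero_of_ae (by
    filter_upwards [hz'] with s hs
    simp [hs])
  have a := ht φ hφ
  have b := ht' φ hφ
  rw [z] at a
  rw [z'] at b
  have e1 : ∫ p in straightStrip W.d, φ p • weakDeriv (straightStrip W.d) (0, 1) (f + g) p =
      (∫ p in straightStrip W.d, φ p • weakDeriv (straightStrip W.d) (0, 1) f p) +
      ∫ p in straightStrip W.d, φ p • weakDeriv (straightStrip W.d) (0, 1) g p := by
    rw [← integral_add
      (integrable_continuous_smul hφ.1.continuous hφ.2.1 (weakDeriv_spec ⟨f2, hf2⟩).1)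
      (integrable_continuous_smul hφ.1.continuous hφ.2.1 (weakDeriv_spec ⟨g2, hg2⟩).1)]
    refine integral_congr_ae ?_
    filter_upwards [hw] with p hp
    rw [hp, Pi.add_apply, smul_add]
  have e2 : ∫ p in straightStrip W.d, fderiv ℝ φ p (0, 1) • (f + g) p =
      (∫ p in straightStrip W.d, fderiv ℝ φ p (0, 1) • f p) +
      ∫ p in straightStrip W.d, fderiv ℝ φ p (0, 1) • g p := by
    have c1 := hφ.continuous_fderiv_apply (0, 1)
    have c2 := hφ.hasCompactSupport_fderiv_apply (0, 1)
    rw [← integral_add (integrable_continuous_smul c1 c2 f0) (integrable_continuous_smul c1 c2 g0)]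
    simp only [Pi.add_apply, smul_add]
  rw [e1, e2, a, b]
  simp only [Pi.zero_apply, smul_zero, integral_zero]
  ring

theorem MemFormDomain.const_smul {W : CurvedStrip} (c : ℂ) {f : ℝ × ℝ → ℂ}
    (hf : W.MemFormDomain f) : W.MemFormDomain (c • f) := by
  obtain ⟨⟨f0, ⟨f1, hf1⟩, f2, hf2⟩, τ, ⟨hτ, ht⟩, hz⟩ := hf
  refine ⟨⟨f0.const_smul c, ⟨_, hf1.const_smul c⟩, _, hf2.const_smul c⟩, 0, ⟨MemLp.zero, ?_⟩,
    Filter.Eventually.of_forall fun _ => rfl⟩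
  intro φ hφ
  have hw := weakDeriv_smul_ae c ⟨f2, hf2⟩
  have z : ∫ s, φ (s, 0) • τ s = 0 := integral_eq_zero_of_ae (by
    filter_upwards [hz] with s hs
    simp [hs])
  have a := ht φ hφ
  rw [z] at a
  have e1 : ∫ p in straightStrip W.d, φ p • weakDeriv (straightStrip W.d) (0, 1) (c • f) p =
      c • ∫ p in straightStrip W.d, φ p • weakDeriv (straightStrip W.d) (0, 1) f p := by
    rw [← integral_smul]
    refine integral_congr_ae ?_
    filter_upwards [hw] with p hp
    rw [hp, Pi.smul_apply, smul_comm]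
  have e2 : ∫ p in straightStrip W.d, fderiv ℝ φ p (0, 1) • (c • f) p =
      c • ∫ p in straightStrip W.d, fderiv ℝ φ p (0, 1) • f p := by
    rw [← integral_smul]
    refine integral_congr_ae (Filter.Eventually.of_forall fun p => ?_)
    exact smul_comm _ c (f p)
  rw [e1, e2, a]
  simp only [Pi.zero_apply, smul_zero, integral_zero, smul_eq_mul]
  ring

theorem memFormDomain_of_isTestFunction (W : CurvedStrip) {ψ : ℝ × ℝ → ℝ}
    (hψ : IsTestFunction (straightStrip W.d) ψ) :
    W.MemFormDomain (fun p => ((ψ p : ℝ) : ℂ)) := by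
  refine ⟨⟨hψ.memLp_ofReal _, ⟨_, hψ.hasL2WeakDeriv _⟩, _, hψ.hasL2WeakDeriv _⟩, 0,
    ⟨MemLp.zero, fun φ hφ => ?_⟩, Filter.Eventually.of_forall fun _ => rfl⟩
  have hw := (weakDeriv_spec ⟨_, hψ.hasL2WeakDeriv (0, 1)⟩).ae_unique (isOpen_straightStrip W.d)
    (hψ.hasL2WeakDeriv (0, 1))
  rw [setIntegral_fderiv_smul_of_tsupport_subset hψ hφ.1]
  simp only [Pi.zero_apply, smul_zero, integral_zero, sub_zero, neg_neg]
  refine integral_congr_ae ?_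
  filter_upwards [hw] with p hp
  rw [hp]

theorem coeFn_add_ae (W : CurvedStrip) (f g : W.HilbertSpace) :
    ⇑(f + g) =ᵐ[volume.restrict (straightStrip W.d)] ⇑f + ⇑g :=
  W.volume_absolutelyContinuous.ae_eq (Lp.coeFn_add f g)

theorem coeFn_smul_ae (W : CurvedStrip) (c : ℂ) (f : W.HilbertSpace) :
    ⇑(c • f) =ᵐ[volume.restrict (straightStrip W.d)] c • ⇑f :=
  W.volume_absolutelyContinuous.ae_eq (Lp.coeFn_smul c f)

theorem memFormDomain_zero (W : CurvedStrip) : W.MemFormDomain 0 := by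
  have h : IsTestFunction (straightStrip W.d) 0 :=
    ⟨contDiff_const, HasCompactSupport.zero, by simp [tsupport]⟩
  simpa [Pi.zero_def] using W.memFormDomain_of_isTestFunction h

/-- The form domain `Q(q₀) = {f ∈ H¹(ℝ × (0, d)) | f(s, 0) = 0 for a.e. s}`. -/
noncomputable def formDomain (W : CurvedStrip) : Submodule ℂ W.HilbertSpace where
  carrier := {f | W.MemFormDomain f}
  zero_mem' := W.memFormDomain_zero.congr
    (W.volume_absolutelyContinuous.ae_eq (Lp.coeFn_zero ℂ 2 W.weightedMeasure))
  add_mem' {f g} hf hg :=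
    (MemFormDomain.add (W := W) (f := f) (g := g) hf hg).congr (W.coeFn_add_ae f g)
  smul_mem' c f hf :=
    (MemFormDomain.const_smul (W := W) c (f := f) hf).congr (W.coeFn_smul_ae c f)

theorem weakDeriv_coeFn_add (W : CurvedStrip) {v : ℝ × ℝ} {f g : W.HilbertSpace}
    (hf : MemLp f 2 (volume.restrict (straightStrip W.d)))
    (hg : MemLp g 2 (volume.restrict (straightStrip W.d)))
    (h : ∃ k, HasL2WeakDeriv (straightStrip W.d) v f k)
    (h' : ∃ k, HasL2WeakDeriv (straightStrip W.d) v g k) :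
    weakDeriv (straightStrip W.d) v ⇑(f + g) =ᵐ[volume.restrict (straightStrip W.d)]
      weakDeriv (straightStrip W.d) v f + weakDeriv (straightStrip W.d) v g :=
  have k := ((weakDeriv_spec h).add hf hg (weakDeriv_spec h')).congr (W.coeFn_add_ae f g)
  (weakDeriv_spec ⟨_, k⟩).ae_unique (isOpen_straightStrip W.d) k

theorem weakDeriv_coeFn_smul (W : CurvedStrip) {v : ℝ × ℝ} (c : ℂ) {f : W.HilbertSpace}
    (h : ∃ k, HasL2WeakDeriv (straightStrip W.d) v f k) :
    weakDeriv (straightStrip W.d) v ⇑(c • f) =ᵐ[volume.restrict (straightStrip W.d)]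
      c • weakDeriv (straightStrip W.d) v f :=
  have k := ((weakDeriv_spec h).const_smul c).congr (W.coeFn_smul_ae c f)
  (weakDeriv_spec ⟨_, k⟩).ae_unique (isOpen_straightStrip W.d) k

theorem integrable_weighted_mul (W : CurvedStrip) {w : ℝ × ℝ → ℝ} {C : ℝ} (hw : Measurable w)
    (hC : ∀ p ∈ straightStrip W.d, |w p| ≤ C) {f g : ℝ × ℝ → ℂ}
    (hf : MemLp f 2 (volume.restrict (straightStrip W.d)))
    (hg : MemLp g 2 (volume.restrict (straightStrip W.d))) :
    Integrable (fun p => (w p : ℂ) * conj (f p) * g p) (volume.restrict (straightStrip W.d)) := by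
  have h1 : Integrable (fun p => conj (f p) * g p) (volume.restrict (straightStrip W.d)) :=
    MemLp.integrable_mul (p := 2) (q := 2) hf.star hg
  have := h1.bdd_mul (c := C) (f := fun p => (w p : ℂ))
    (Complex.measurable_ofReal.comp hw).aestronglyMeasurable (by
      filter_upwards [ae_mem_straightStrip W.d] with p hp
      simpa using hC p hp)
  simpa only [mul_assoc] using this

theorem integrable_form (W : CurvedStrip) {f g : ℝ × ℝ → ℂ}
    (hf : MemH1 (straightStrip W.d) f) (hg : MemH1 (straightStrip W.d) g) :
    Integrable (fun p =>
      ((1 / W.density p : ℝ) * conj (weakDeriv (straightStrip W.d) (1, 0) f p) *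
        weakDeriv (straightStrip W.d) (1, 0) g p +
      (W.density p : ℝ) * conj (weakDeriv (straightStrip W.d) (0, 1) f p) *
        weakDeriv (straightStrip W.d) (0, 1) g p)) (volume.restrict (straightStrip W.d)) := by
  obtain ⟨c, C, hc, h⟩ := W.exists_density_bounds
  have hm := W.continuous_density.measurable
  refine (W.integrable_weighted_mul (C := 1 / c) (hm.const_div 1) (fun p hp => ?_)
    (weakDeriv_spec hf.2.1).1 (weakDeriv_spec hg.2.1).1).add
    (W.integrable_weighted_mul (C := C) hm (fun p hp => ?_)
    (weakDeriv_spec hf.2.2).1 (weakDeriv_spec hg.2.2).1)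
  · rw [abs_of_pos (one_div_pos.2 (W.density_pos hp))]
    exact one_div_le_one_div_of_le hc (h p hp).1
  · rw [abs_of_pos (W.density_pos hp)]
    exact (h p hp).2

theorem q₀_add_right (W : CurvedStrip) {k f g : W.HilbertSpace} (hk : k ∈ W.formDomain)
    (hf : f ∈ W.formDomain) (hg : g ∈ W.formDomain) :
    W.q₀ k ⇑(f + g) = W.q₀ k f + W.q₀ k g := by
  unfold q₀
  rw [← integral_add (W.integrable_form hk.1 hf.1) (W.integrable_form hk.1 hg.1)]
  refine integral_congr_ae ?_
  filter_upwards [W.weakDeriv_coeFn_add hf.1.1 hg.1.1 hf.1.2.1 hg.1.2.1,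
    W.weakDeriv_coeFn_add hf.1.1 hg.1.1 hf.1.2.2 hg.1.2.2] with p h1 h2
  rw [h1, h2, Pi.add_apply, Pi.add_apply]
  ring

theorem q₀_smul_right (W : CurvedStrip) (c : ℂ) {k f : W.HilbertSpace}
    (hf : f ∈ W.formDomain) : W.q₀ k ⇑(c • f) = c * W.q₀ k f := by
  unfold q₀
  rw [← integral_const_mul]
  refine integral_congr_ae ?_
  filter_upwards [W.weakDeriv_coeFn_smul c hf.1.2.1, W.weakDeriv_coeFn_smul c hf.1.2.2] with p h1 h2
  rw [h1, h2, Pi.smul_apply, Pi.smul_apply, smul_eq_mul, smul_eq_mul]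
  ring

/-- The graph of the operator associated with the form `q₀`: the pairs `(f, h)` with `f ∈ Q(q₀)`
and `q₀(g, f) = ⟨g, h⟩` for all `g ∈ Q(q₀)`. -/
noncomputable def operatorGraph (W : CurvedStrip) :
    Submodule ℂ (W.HilbertSpace × W.HilbertSpace) where
  carrier := {x | x.1 ∈ W.formDomain ∧ ∀ g ∈ W.formDomain, W.q₀ g x.1 = inner ℂ g x.2}
  zero_mem' := by
    refine ⟨W.formDomain.zero_mem, fun g hg => ?_⟩
    have := W.q₀_smul_right 0 (k := g) W.formDomain.zero_mem
    rw [zero_smul, zero_mul] at this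
    simpa using this
  add_mem' {x y} hx hy := by
    refine ⟨W.formDomain.add_mem hx.1 hy.1, fun g hg => ?_⟩
    rw [Prod.fst_add, Prod.snd_add, W.q₀_add_right hg hx.1 hy.1, hx.2 g hg, hy.2 g hg,
      inner_add_right]
  smul_mem' c x hx := by
    refine ⟨W.formDomain.smul_mem c hx.1, fun g hg => ?_⟩
    rw [Prod.smul_fst, Prod.smul_snd, W.q₀_smul_right c hx.1, hx.2 g hg, inner_smul_right]

/-- The Hamiltonian `L_Ω^{DN}` of the strip, with Dirichlet condition at `u = 0` and Neumann
condition at `u = d`: the operator associated with the form `q₀`. Its graph is indeed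
`W.operatorGraph`, as the theorem below shows. -/
noncomputable def hamiltonian (W : CurvedStrip) : W.HilbertSpace →ₗ.[ℂ] W.HilbertSpace :=
  W.operatorGraph.toLinearPMap

/-- A vector that is orthogonal to the form domain vanishes. -/
theorem eq_zero_of_forall_inner_eq_zero (W : CurvedStrip) {h : W.HilbertSpace}
    (hh : ∀ g ∈ W.formDomain, inner ℂ g h = 0) : h = 0 := by
  obtain ⟨c, C, hc, hb⟩ := W.exists_density_bounds
  have hle : volume.restrict (straightStrip W.d) ≤
      (ENNReal.ofReal c)⁻¹ • W.weightedMeasure := by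
    have hc0 : ENNReal.ofReal c ≠ 0 := by simpa using hc
    have : ENNReal.ofReal c • volume.restrict (straightStrip W.d) ≤ W.weightedMeasure := by
      rw [← withDensity_const]
      refine withDensity_mono ?_
      filter_upwards [ae_mem_straightStrip W.d] with p hp
      exact ENNReal.ofReal_le_ofReal (hb p hp).1
    intro s
    have hs := this s
    simp only [Measure.smul_apply, smul_eq_mul] at hs ⊢
    calc (volume.restrict (straightStrip W.d)) s
        = (ENNReal.ofReal c)⁻¹ * (ENNReal.ofReal c * (volume.restrict (straightStrip W.d)) s) := by
          rw [← mul_assoc, ENNReal.inv_mul_cancel hc0 ENNReal.ofReal_ne_top, one_mul]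
      _ ≤ _ := by gcongr
  have hL : MemLp h 2 (volume.restrict (straightStrip W.d)) :=
    (Lp.memLp h).of_measure_le_smul (by simpa using hc) hle
  have hl : LocallyIntegrableOn (fun p => W.density p • h p) (straightStrip W.d) volume :=
    (locallyIntegrableOn_of_locallyIntegrable_restrict
      (hL.locallyIntegrable (by norm_num))).continuousOn_smul
      (isOpen_straightStrip W.d).isLocallyClosed W.continuous_density.continuousOn
  have key := (isOpen_straightStrip W.d).ae_eq_zero_of_integral_contDiff_smul_eq_zero hl
    (fun ψ h1 h2 h3 => by
      have hψ : IsTestFunction (straightStrip W.d) ψ := ⟨h1, h2, h3⟩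
      have hm := W.memLp_weightedMeasure (hψ.memLp_ofReal _)
      have hae := hm.coeFn_toLp
      have hQ : hm.toLp ∈ W.formDomain :=
        (W.memFormDomain_of_isTestFunction hψ).congr (W.volume_absolutelyContinuous.ae_eq hae)
      have e := hh _ hQ
      rw [L2.inner_def] at e
      have e' : ∫ p, ((ψ p : ℝ) : ℂ) * h p ∂W.weightedMeasure = 0 := by
        rw [← e]
        refine integral_congr_ae ?_
        filter_upwards [hae] with p hp
        rw [hp]
        simp [mul_comm]
      unfold weightedMeasure at e'
      rw [integral_withDensity_eq_integral_toReal_smul₀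
        W.continuous_density.measurable.ennreal_ofReal.aemeasurable
        (Filter.Eventually.of_forall fun _ => ENNReal.ofReal_lt_top)] at e'
      rw [← e', ← setIntegral_eq_integral_of_forall_compl_eq_zero (s := straightStrip W.d)]
      · refine integral_congr_ae ?_
        filter_upwards [ae_mem_straightStrip W.d] with p hp
        rw [ENNReal.toReal_ofReal (W.density_pos hp).le]
        simp only [Complex.real_smul]
        exact mul_left_comm _ _ _
      · intro p hp
        rw [image_eq_zero_of_notMem_tsupport (fun h => hp (h3 h)), zero_smul])
  have hz : ⇑h =ᵐ[volume.restrict (straightStrip W.d)] 0 := by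
    rw [Filter.EventuallyEq, ae_restrict_iff' (isOpen_straightStrip W.d).measurableSet]
    filter_upwards [key] with p hp hpU
    exact (smul_eq_zero.mp (hp hpU)).resolve_left (W.density_pos hpU).ne'
  exact (Lp.eq_zero_iff_ae_eq_zero).2 ((withDensity_absolutelyContinuous _ _).ae_eq hz)

/-- The Hamiltonian `L` is the operator with `f ∈ D(L)`, `L f = h` if and only if `f ∈ Q(q₀)` and
`q₀(g, f) = ⟨g, h⟩` for all `g ∈ Q(q₀)`. -/
theorem hamiltonian_graph (W : CurvedStrip) : W.hamiltonian.graph = W.operatorGraph := by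
  refine Submodule.toLinearPMap_graph_eq _ fun x hx hx0 => ?_
  refine W.eq_zero_of_forall_inner_eq_zero fun g hg => ?_
  rw [← hx.2 g hg, hx0]
  have := W.q₀_smul_right 0 (k := g) W.formDomain.zero_mem
  rwa [zero_smul, zero_mul] at this

end CurvedStrip

/-! ### Spectra of unbounded operators -/

section Spectrum

variable {H : Type*} [NormedAddCommGroup H] [InnerProductSpace ℂ H]

/-- The resolvent set of an unbounded operator `A`: the complex `z` such that `A - z` is a
bijection of the domain onto the whole space with bounded inverse `R`. -/
def opResolventSet (A : H →ₗ.[ℂ] H) : Set ℂ :=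
  {z | ∃ R : H →L[ℂ] H,
    (∀ y : H, ∃ h : R y ∈ A.domain, A ⟨R y, h⟩ - z • R y = y) ∧
    ∀ x : A.domain, R (A x - z • (x : H)) = x}

/-- The spectrum of an unbounded operator. -/
def opSpectrum (A : H →ₗ.[ℂ] H) : Set ℂ := (opResolventSet A)ᶜ

/-- The eigenspace of an unbounded operator at `z`. -/
def opEigenspace (A : H →ₗ.[ℂ] H) (z : ℂ) : Submodule ℂ H where
  carrier := {x | (x, z • x) ∈ A.graph}
  zero_mem' := by
    change ((0 : H), z • (0 : H)) ∈ A.graph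
    rw [smul_zero]
    exact A.graph.zero_mem
  add_mem' {x y} hx hy := by
    have := A.graph.add_mem hx hy
    change (x + y, z • (x + y)) ∈ A.graph
    rwa [smul_add]
  smul_mem' c x hx := by
    have := A.graph.smul_mem c hx
    change (c • x, z • c • x) ∈ A.graph
    rwa [smul_comm z c]

/-- `z` is a discrete eigenvalue of the (self-adjoint) operator `A`: an eigenvalue of finite
multiplicity that is an isolated point of the spectrum. -/
def IsDiscreteEigenvalue (A : H →ₗ.[ℂ] H) (z : ℂ) : Prop :=
  opEigenspace A z ≠ ⊥ ∧ FiniteDimensional ℂ (opEigenspace A z) ∧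
    ∃ ε > 0, ∀ w ∈ opSpectrum A, ‖w - z‖ < ε → w = z

end Spectrum

/-! ### Compact perturbations of operators of small norm -/

section CompactPerturbation

open Module.End

variable {H : Type*} [NormedAddCommGroup H] [InnerProductSpace ℂ H] [CompleteSpace H]

/-! Write `κ = π / (2d)`, so that `κ²` is the threshold. Let `V` be the form domain with the inner
product `q₀(f, g) + ⟨f, g⟩`, and let `J : V → H` be its embedding in the Hilbert space. By the
definition of the operator, `(L + 1)⁻¹ = J J*` (`mem_hamiltonian_graph_iff`). Hence the bottom of
the spectrum of `L` is `‖J‖⁻² - 1`, and every question about it becomes a question about the bounded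
positive operator `T = J J*` near the top `‖J‖²` of its spectrum.

Discreteness. Split `J = K + B`, where `K` cuts off to the middle part `|s| ≤ s₀` and `B` to the
rest. `K` is compact (`isCompactOperator_interior_formEmbedding`). Where `B` lives the strip is
straight, so the sharp Poincaré inequality on `(0, d)`, with a Dirichlet condition at one end only,
gives `‖B‖² ≤ 1 / (κ² + 1)` (`norm_exterior_formEmbedding_le`). If `‖J‖² > 1 / (κ² + 1)`, then `T`
is a compact perturbation of `B B*`, whose norm is below `‖T‖ = ‖J‖²`. The Fredholm alternative then
makes `‖J‖²` an isolated eigenvalue of finite multiplicity, and `‖J‖⁻² - 1 < κ²` is a discrete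
eigenvalue of `L` (`exists_isDiscreteEigenvalue_of_form_embedding`). It is positive because `‖J‖ <
1`, by a cruder form of the same Poincaré inequality.

Energy below the threshold. For `f = ψ(s) sin(κu)` the transversal energy minus `κ² ‖f‖²` equals `½
∫ γ ψ²` (`integral_transversal_energy`), and the longitudinal energy is at most a constant times `∫
ψ'²`. With `ψ` a long plateau, `∫ γ ψ² = ∫ γ = 0` and `∫ ψ'²` is small. Since `γ` is not zero, some
test function `η` has `∫ γ η ≠ 0`. Adding a small multiple `δη` changes the energy by a term linear
in `δ`, which has a favourable sign for a suitable `δ` and outweighs the terms of order `δ²` and the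
cost of the cutoff (`exists_contDiff_energy_neg`). This yields `‖J‖² > 1 / (κ² + 1)`. -/

theorem isUnit_algebraMap_sub_of_norm_lt {B : H →L[ℂ] H} {ν : ℂ} (h : ‖B‖ < ‖ν‖) :
    IsUnit (algebraMap ℂ (H →L[ℂ] H) ν - B) := by
  rcases subsingleton_or_nontrivial H with hH | hH
  · exact isUnit_of_subsingleton _
  · exact spectrum.mem_resolventSet_iff.1 (spectrum.mem_resolventSet_of_norm_lt h)

/-- The Fredholm alternative outside the ball that contains the essential spectrum. -/
theorem eigenspace_finiteDimensional_and_isUnit_of_compact_perturbation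
    {T B K : H →L[ℂ] H} (hT : T = B + K) (hK : IsCompactOperator K) {ν : ℂ} (h : ‖B‖ < ‖ν‖) :
    FiniteDimensional ℂ (eigenspace (T : H →ₗ[ℂ] H) ν) ∧
      (eigenspace (T : H →ₗ[ℂ] H) ν = ⊥ → IsUnit (algebraMap ℂ (H →L[ℂ] H) ν - T)) := by
  obtain ⟨u, hu⟩ := isUnit_algebraMap_sub_of_norm_lt h
  -- Factoring the invertible `u = ν - B` out of `ν - T` leaves `1 - K'` with `K' = u⁻¹ K` compact,
  -- so the Riesz theory of compact operators applies at the point `1`.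
  set K' : H →L[ℂ] H := (↑u⁻¹ : H →L[ℂ] H) * K with hK'
  have hc : IsCompactOperator K' := hK.clm_comp (↑u⁻¹ : H →L[ℂ] H)
  have huK : (u : H →L[ℂ] H) * K' = K := by rw [hK', ← mul_assoc, Units.mul_inv, one_mul]
  have hfac : algebraMap ℂ (H →L[ℂ] H) ν - T = u * (1 - K') := by
    rw [mul_sub, mul_one, huK, hu, hT]; abel
  have heig : eigenspace (T : H →ₗ[ℂ] H) ν = eigenspace (K' : H →ₗ[ℂ] H) 1 := by
    ext x
    rw [mem_eigenspace_iff, mem_eigenspace_iff, one_smul]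
    have e : ν • x - T x = (u : H →L[ℂ] H) (x - K' x) := by
      have := congrArg (fun A : H →L[ℂ] H => A x) hfac
      simpa [Algebra.algebraMap_eq_smul_one] using this
    have hinj : ∀ y, (u : H →L[ℂ] H) y = 0 → y = 0 := fun y hy => by
      have : ((↑u⁻¹ : H →L[ℂ] H) * u) y = 0 := by
        rw [mul_apply_eq_comp, hy, map_zero]
      simpa using this
    constructor
    · intro hx
      have hx' : T x = ν • x := hx
      rw [hx', sub_self] at e
      exact (sub_eq_zero.1 (hinj _ e.symm)).symm
    · intro hx
      have hx' : K' x = x := hx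
      rw [hx', sub_self, map_zero] at e
      exact (sub_eq_zero.1 e).symm
  refine ⟨?_, fun hbot => ?_⟩
  · rw [heig]
    exact ContinuousLinearMap.finite_dimensional_eigenspace hc 1 one_ne_zero
  · rw [hfac]
    refine u.isUnit.mul ?_
    rcases hc.hasEigenvalue_or_mem_resolventSet one_ne_zero with h1 | h1
    · exact absurd (heig.symm.trans hbot) h1
    · simpa using spectrum.mem_resolventSet_iff.1 h1

/-- `1 - tP` acts as `1 - t` on the range of `P` and as the identity on its kernel, so `1 + t / (1 -
t) P` is its inverse. -/
theorem isUnit_one_sub_smul_of_isIdempotentElem {A : Type*} [Ring A] [Algebra ℂ A] {P : A}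
    (hP : IsIdempotentElem P) {t : ℂ} (ht : t ≠ 1) : IsUnit (1 - t • P) := by
  have h1 : (1 : ℂ) - t ≠ 0 := sub_ne_zero.2 ht.symm
  have key : ∀ a b : ℂ, (1 - a • P) * (1 + b • P) = 1 + (b - a - a * b) • P := fun a b => by
    have := hP.eq
    simp only [mul_add, sub_mul, one_mul, mul_one, smul_mul_smul_comm, this]
    module
  have key' : ∀ a b : ℂ, (1 + b • P) * (1 - a • P) = 1 + (b - a - a * b) • P := fun a b => by
    have := hP.eq
    simp only [add_mul, mul_sub, one_mul, mul_one, smul_mul_smul_comm, this]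
    module
  have e : t / (1 - t) - t - t * (t / (1 - t)) = 0 := by field_simp; ring
  exact ⟨⟨1 - t • P, 1 + (t / (1 - t)) • P, by rw [key, e, zero_smul, add_zero],
    by rw [key', e, zero_smul, add_zero]⟩, rfl⟩

/-- A real spectral value outside the ball that contains the essential spectrum of a
self-adjoint operator is isolated. -/
theorem exists_forall_isUnit_of_compact_perturbation
    {T B K : H →L[ℂ] H} (hT : T = B + K) (hK : IsCompactOperator K) (hsa : IsSelfAdjoint T)
    {ν : ℝ} (hν : 0 < ν) (h : ‖B‖ < ν) :
    ∃ ε > 0, ∀ w : ℂ, ‖w - ν‖ < ε → w ≠ ν → IsUnit (algebraMap ℂ (H →L[ℂ] H) w - T) := by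
  have hn : ‖B‖ < ‖(ν : ℂ)‖ := by rwa [Complex.norm_real, Real.norm_of_nonneg hν.le]
  set N := eigenspace (T : H →ₗ[ℂ] H) (ν : ℂ) with hN
  have hfin : FiniteDimensional ℂ N :=
    (eigenspace_finiteDimensional_and_isUnit_of_compact_perturbation hT hK hn).1
  set P : H →L[ℂ] H := N.starProjection with hP
  have hPidem : IsIdempotentElem P := N.isIdempotentElem_starProjection
  have hPsa : IsSelfAdjoint P := isSelfAdjoint_starProjection N
  have hPc : IsCompactOperator P := by
    have h1 : IsCompactOperator (N.subtypeL : N → H) :=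
      isCompactOperator_id_iff_finiteDimensional (𝕜 := ℂ) |>.2 hfin |>.clm_comp N.subtypeL
    exact h1.comp_clm N.orthogonalProjectionOnto
  have hTP : T * P = (ν : ℂ) • P := by
    ext x
    have : P x ∈ N := Submodule.starProjection_apply_mem N x
    exact mem_eigenspace_iff.1 this
  -- The adjoint of `hTP`; the eigenvalue must be real here.
  have hPT : P * T = (ν : ℂ) • P := by
    have := congrArg star hTP
    rwa [star_mul, hsa.star_eq, hPsa.star_eq, star_smul, hPsa.star_eq, Complex.star_def,
      Complex.conj_ofReal] at this
  -- Deflation: `T'` agrees with `T` on the orthogonal complement of the eigenspace and vanishes on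
  -- the eigenspace. It is still a compact perturbation of `B` but no longer has the eigenvalue `ν`,
  -- so `w - T'` is invertible for all `w` near `ν`, including `ν` itself.
  set T' : H →L[ℂ] H := T - (ν : ℂ) • P with hT'
  have hT'e : T' = B + (K - (ν : ℂ) • P) := by rw [hT', hT]; abel
  have hT'P : T' * P = 0 := by rw [hT', sub_mul, hTP, smul_mul_assoc, hPidem.eq, sub_self]
  have hPT' : P * T' = 0 := by rw [hT', mul_sub, hPT, mul_smul_comm, hPidem.eq, sub_self]
  have hbot : eigenspace (T' : H →ₗ[ℂ] H) (ν : ℂ) = ⊥ := by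
    rw [eq_bot_iff]
    intro x hx
    have hx' : T' x = (ν : ℂ) • x := mem_eigenspace_iff.1 hx
    have h1 : P x = 0 := by
      have e : P (T' x) = 0 := congrArg (fun A : H →L[ℂ] H => A x) hPT'
      rw [hx', map_smul] at e
      exact (smul_eq_zero.1 e).resolve_left (by exact_mod_cast hν.ne')
    have h2 : x ∈ N := by
      rw [hN, mem_eigenspace_iff]
      have : T' x = T x - (ν : ℂ) • P x := rfl
      rw [h1, smul_zero, sub_zero] at this
      rw [← hx', this]; rfl
    rw [Submodule.mem_bot, ← h1]
    exact (Submodule.starProjection_eq_self_iff.2 h2).symm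
  have hunit := (eigenspace_finiteDimensional_and_isUnit_of_compact_perturbation hT'e
    (hK.sub (hPc.smul (ν : ℂ))) hn).2 hbot
  have hopen := spectrum.isOpen_resolventSet (𝕜 := ℂ) T'
  obtain ⟨ε, hε, hball⟩ := Metric.isOpen_iff.1 hopen ν (spectrum.mem_resolventSet_iff.2 hunit)
  -- The bound by `ν` keeps `w` away from `0`, by which the factorization below divides.
  refine ⟨min ε ν, lt_min hε hν, fun w hw hwν => ?_⟩
  have hw0 : w ≠ 0 := by
    rintro rfl
    rw [zero_sub, norm_neg, Complex.norm_real, Real.norm_of_nonneg hν.le] at hw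
    exact absurd (hw.trans_le (min_le_right _ _)) (lt_irrefl _)
  have hres : IsUnit (algebraMap ℂ (H →L[ℂ] H) w - T') :=
    spectrum.mem_resolventSet_iff.1 (hball (by
      rw [Metric.mem_ball, dist_eq_norm]; exact hw.trans_le (min_le_left _ _)))
  -- `T' P = 0` gives `(w - T') P = w P`, so the deflation is undone by the factor `1 - (ν / w) P`,
  -- which is invertible as long as `w ≠ ν`.
  have hfac : algebraMap ℂ (H →L[ℂ] H) w - T =
      (algebraMap ℂ (H →L[ℂ] H) w - T') * (1 - ((ν : ℂ) / w) • P) := by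
    have e1 : (algebraMap ℂ (H →L[ℂ] H) w - T') * P = w • P := by
      rw [sub_mul, hT'P, sub_zero, Algebra.algebraMap_eq_smul_one, smul_mul_assoc, one_mul]
    rw [mul_sub, mul_one, mul_smul_comm, e1, smul_smul, div_mul_cancel₀ _ hw0, hT']
    abel
  rw [hfac]
  exact hres.mul (isUnit_one_sub_smul_of_isIdempotentElem hPidem fun h => hwν (by
    rw [div_eq_one_iff_eq hw0] at h; exact h.symm))

end CompactPerturbation

/-! ### Operators given by the embedding of a form domain -/

section FormOperator

open Module.End

variable {H V : Type*} [NormedAddCommGroup H] [InnerProductSpace ℂ H] [CompleteSpace H]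
  [NormedAddCommGroup V] [InnerProductSpace ℂ V] [CompleteSpace V]

/-- Schauder's theorem, in the form that the inner product allows: `‖K* z‖² = ⟨K K* z, z⟩ ≤ ‖K K* z‖
‖z‖`. A finite net for the image of the unit ball under the compact operator `K K*` is therefore
also the source of a finite net for its image under `K*`. -/
theorem isCompactOperator_adjoint {K : V →L[ℂ] H} (hK : IsCompactOperator K) :
    IsCompactOperator (ContinuousLinearMap.adjoint K) := by
  set Kd := ContinuousLinearMap.adjoint K
  have hKK : IsCompactOperator (K ∘L Kd) := hK.comp_clm Kd
  refine (isCompactOperator_iff_isCompact_closure_image_closedBall (Kd : H →ₗ[ℂ] V) one_pos).2 ?_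
  refine TotallyBounded.isCompact_of_isClosed ?_ isClosed_closure
  refine TotallyBounded.closure ?_
  have htb : TotallyBounded ((K ∘L Kd) '' Metric.closedBall 0 1) :=
    (hKK.isCompact_closure_image_closedBall
      (f := ((K ∘L Kd : H →L[ℂ] H) : H →ₗ[ℂ] H)) 1).totallyBounded.subset subset_closure
  rw [Metric.totallyBounded_iff]
  intro ε hε
  -- Differences of points of the unit ball have norm at most `2`, so the accuracy `ε² / 2` for `K
  -- K*` becomes `ε² / 2 · 2 = ε²` for the square of the distance under `K*`.
  obtain ⟨t, htsub, htf, hcov⟩ := Metric.finite_approx_of_totallyBounded htb (ε ^ 2 / 2)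
    (by positivity)
  obtain ⟨r, hr, hrf, rfl⟩ := Set.exists_subset_image_finite_and.1 ⟨t, htsub, htf, rfl⟩
  refine ⟨Kd '' r, hrf.image _, ?_⟩
  rintro _ ⟨x, hx, rfl⟩
  obtain ⟨_, ⟨y, hy, rfl⟩, hxy⟩ := Set.mem_iUnion₂.1 (hcov ⟨x, hx, rfl⟩)
  refine Set.mem_iUnion₂.2 ⟨_, ⟨y, hy, rfl⟩, ?_⟩
  rw [Metric.mem_ball, dist_eq_norm, ← map_sub] at hxy
  rw [Metric.mem_ball, dist_eq_norm]
  change ‖Kd x - Kd y‖ < ε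
  rw [← map_sub]
  rw [mem_closedBall_zero_iff] at hx
  have hy' := mem_closedBall_zero_iff.1 (hr hy)
  have h1 : ‖Kd (x - y)‖ ^ 2 ≤ ‖(K ∘L Kd) (x - y)‖ * ‖x - y‖ := by
    have e : inner ℂ (K (Kd (x - y))) (x - y) = inner ℂ (Kd (x - y)) (Kd (x - y)) :=
      (ContinuousLinearMap.adjoint_inner_right K _ _).symm
    have := norm_inner_le_norm (𝕜 := ℂ) (K (Kd (x - y))) (x - y)
    rw [e, inner_self_eq_norm_sq_to_K] at this
    simpa using this
  have h2 : ‖x - y‖ ≤ 2 := (norm_sub_le _ _).trans (by linarith)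
  refine lt_of_pow_lt_pow_left₀ 2 hε.le (h1.trans_lt ?_)
  nlinarith [norm_nonneg ((K ∘L Kd) (x - y))]

omit [CompleteSpace H] in
-- `hA` says that `T = (A + 1)⁻¹`. With `w = z + 1` one has `T (A - z) = 1 - wT = w (w⁻¹ - T)` on
-- the domain of `A`, so the resolvent at `z` must be `w⁻¹ (w⁻¹ - T)⁻¹ T`.
theorem mem_opResolventSet_of_isUnit {A : H →ₗ.[ℂ] H} {T : H →L[ℂ] H}
    (hA : ∀ f h : H, (f, h) ∈ A.graph ↔ T (f + h) = f) {z : ℂ} (hz : z + 1 ≠ 0)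
    (hu : IsUnit (algebraMap ℂ (H →L[ℂ] H) (z + 1)⁻¹ - T)) : z ∈ opResolventSet A := by
  set w := z + 1 with hw
  obtain ⟨u, hu⟩ := hu
  have hux : ∀ x, (u : H →L[ℂ] H) x = w⁻¹ • x - T x := fun x => by
    rw [hu, Algebra.algebraMap_eq_smul_one]; rfl
  have hinv : ∀ x, (u : H →L[ℂ] H) ((↑u⁻¹ : H →L[ℂ] H) x) = x := fun x => by
    rw [← mul_apply_eq_comp, Units.mul_inv]; rfl
  have hinv' : ∀ x, (↑u⁻¹ : H →L[ℂ] H) ((u : H →L[ℂ] H) x) = x := fun x => by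
    rw [← mul_apply_eq_comp, Units.inv_mul]; rfl
  have hz' : z = w - 1 := by rw [hw]; ring
  refine ⟨w⁻¹ • ((↑u⁻¹ : H →L[ℂ] H) * T), fun y => ?_, fun x => ?_⟩
  · set x : H := (w⁻¹ • ((↑u⁻¹ : H →L[ℂ] H) * T)) y with hx
    have h1 : (u : H →L[ℂ] H) x = w⁻¹ • T y := by
      rw [hx]
      change (u : H →L[ℂ] H) (w⁻¹ • ((↑u⁻¹ : H →L[ℂ] H) (T y))) = _
      rw [map_smul, hinv]
    have h2 : (x, y + z • x) ∈ A.graph := by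
      rw [hA]
      rw [hux] at h1
      have : x + (y + z • x) = y + w • x := by rw [hz']; module
      rw [this, map_add, map_smul]
      have h3 : w • (w⁻¹ • x - T x) = w • w⁻¹ • T y := by rw [h1]
      rw [smul_sub, smul_smul, smul_smul, mul_inv_cancel₀ hz, one_smul, one_smul] at h3
      rw [← h3]; abel
    obtain ⟨a, ha1, ha2⟩ := LinearPMap.mem_graph_iff _ |>.1 h2
    have hmem : x ∈ A.domain := mem_of_eq_of_mem (show _ = (a : H) from ha1.symm) a.2
    refine ⟨hmem, ?_⟩
    have : (⟨x, hmem⟩ : A.domain) = a := Subtype.ext ha1.symm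
    rw [this, ha2]
    simp
  · have h1 := (hA x (A x)).1 (LinearPMap.mem_graph A x)
    change w⁻¹ • (↑u⁻¹ : H →L[ℂ] H) (T (A x - z • (x : H))) = x
    have h2 : T (A x - z • (x : H)) = w • (u : H →L[ℂ] H) (x : H) := by
      have : A x - z • (x : H) = (x + A x) - w • (x : H) := by rw [hz']; module
      rw [this, map_sub, h1, map_smul, hux, smul_sub, smul_smul, mul_inv_cancel₀ hz, one_smul]
    rw [h2, map_smul, hinv', smul_smul, inv_mul_cancel₀ hz, one_smul]

/-- Let `A + 1` be the operator associated with the form `⟪·, ·⟫` of `V`, embedded in `H` by `J`.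
If `J` is the sum of a compact operator and an operator of norm less than `‖J‖ < 1`, then
`‖J‖⁻² - 1` is positive, the least point of the spectrum of `A` and a discrete eigenvalue. -/
theorem exists_isDiscreteEigenvalue_of_form_embedding {A : H →ₗ.[ℂ] H} {J K B : V →L[ℂ] H}
    (hA : ∀ f h : H, (f, h) ∈ A.graph ↔ J (ContinuousLinearMap.adjoint J (f + h)) = f)
    (hJ : J = K + B) (hK : IsCompactOperator K) (hB : ‖B‖ < ‖J‖) (hJ1 : ‖J‖ < 1) :
    0 < (‖J‖ ^ 2)⁻¹ - 1 ∧
    IsLeast {x : ℝ | (x : ℂ) ∈ opSpectrum A} ((‖J‖ ^ 2)⁻¹ - 1) ∧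
    IsDiscreteEigenvalue A (((‖J‖ ^ 2)⁻¹ - 1 : ℝ) : ℂ) := by
  set Jd := ContinuousLinearMap.adjoint J with hJd
  set T : H →L[ℂ] H := J ∘L Jd with hTdef
  have hpos : T.IsPositive := ContinuousLinearMap.isPositive_self_comp_adjoint J
  have hTnn : 0 ≤ T := (ContinuousLinearMap.nonneg_iff_isPositive T).2 hpos
  have hsa : IsSelfAdjoint T := hpos.isSelfAdjoint
  have hJ0 : 0 < ‖J‖ := (norm_nonneg B).trans_lt hB
  have hnorm : ‖T‖ = ‖J‖ ^ 2 := by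
    have := ContinuousLinearMap.norm_adjoint_comp_self (Jd)
    rw [hJd, ContinuousLinearMap.adjoint_adjoint] at this
    rw [hTdef, hJd, this, LinearIsometryEquiv.norm_map, sq]
  set ν : ℝ := ‖J‖ ^ 2 with hν
  have hν0 : 0 < ν := by positivity
  have hν1 : ν < 1 := by rw [hν]; nlinarith
  have : Nontrivial H := by
    by_contra hc
    rw [not_nontrivial_iff_subsingleton] at hc
    have : J = 0 := by ext; exact Subsingleton.elim _ _
    rw [this, norm_zero] at hJ0
    exact lt_irrefl _ hJ0
  have hA' : ∀ f h : H, (f, h) ∈ A.graph ↔ T (f + h) = f := hA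
  -- the decomposition of `T`
  set Bd := ContinuousLinearMap.adjoint B
  set Kd := ContinuousLinearMap.adjoint K
  -- In the expansion of `(K + B)(K + B)*` every term except `B B*` contains `K` or `K*` and is
  -- compact.
  have hdec : T = B ∘L Bd + (K ∘L Jd + B ∘L Kd) := by
    have : Jd = Kd + Bd := by rw [hJd, hJ, map_add]
    rw [hTdef]
    conv_lhs => rw [hJ]
    rw [ContinuousLinearMap.add_comp]
    conv_lhs => rw [this]
    rw [ContinuousLinearMap.comp_add B, ← this]
    abel
  have hKd : IsCompactOperator (B ∘L Kd) := (isCompactOperator_adjoint hK).clm_comp B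
  have hcomp : IsCompactOperator (K ∘L Jd + B ∘L Kd : H →L[ℂ] H) :=
    (hK.comp_clm Jd).add hKd
  have hBn : ‖B ∘L Bd‖ < ν := by
    refine (ContinuousLinearMap.opNorm_comp_le _ _).trans_lt ?_
    rw [LinearIsometryEquiv.norm_map, hν, sq]
    exact mul_self_lt_mul_self (norm_nonneg _) hB
  have hn : ‖B ∘L Bd‖ < ‖(ν : ℂ)‖ := by rwa [Complex.norm_real, Real.norm_of_nonneg hν0.le]
  -- The norm of a positive operator belongs to its spectrum. This is where the eigenvalue comes
  -- from: `ν = ‖T‖` lies outside the ball of radius `‖B B*‖`, so as a spectral value it has to be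
  -- an eigenvalue.
  have hspec : ν ∈ spectrum ℝ T := by
    rw [← hnorm]; exact CStarAlgebra.norm_mem_spectrum_of_nonneg hTnn
  have hspecC : ¬ IsUnit (algebraMap ℂ (H →L[ℂ] H) ν - T) := by
    have := spectrum.algebraMap_mem ℂ hspec
    exact spectrum.mem_iff.1 this
  obtain ⟨hfin, hbot⟩ :=
    eigenspace_finiteDimensional_and_isUnit_of_compact_perturbation hdec hcomp hn
  have hEig : opEigenspace A ((ν⁻¹ - 1 : ℝ) : ℂ) = eigenspace (T : H →ₗ[ℂ] H) (ν : ℂ) := by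
    have hνc : (ν : ℂ) ≠ 0 := by exact_mod_cast hν0.ne'
    ext x
    rw [mem_eigenspace_iff]
    change (x, ((ν⁻¹ - 1 : ℝ) : ℂ) • x) ∈ A.graph ↔ T x = (ν : ℂ) • x
    rw [hA']
    have : x + ((ν⁻¹ - 1 : ℝ) : ℂ) • x = (ν : ℂ)⁻¹ • x := by push_cast; module
    rw [this, map_smul, inv_smul_eq_iff₀ hνc]
  have hEne : opEigenspace A ((ν⁻¹ - 1 : ℝ) : ℂ) ≠ ⊥ := fun h => hspecC (hbot (hEig ▸ h))
  refine ⟨sub_pos.2 ((one_lt_inv₀ hν0).2 hν1), ⟨?_, fun x hx => ?_⟩, hEne,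
    by rw [hEig]; exact hfin, ?_⟩
  -- A left inverse of `A - z` would annihilate the eigenvector.
  · rintro ⟨R, -, hR⟩
    obtain ⟨x, hx, hx0⟩ := Submodule.exists_mem_ne_zero_of_ne_bot hEne
    obtain ⟨a, ha1, ha2⟩ := LinearPMap.mem_graph_iff _ |>.1 hx
    have := hR a
    rw [ha2, ha1, sub_self, map_zero] at this
    exact hx0 this.symm
  · by_contra hlt
    push Not at hlt
    apply hx
    -- At `x = -1` the substitution `x ↦ (x + 1)⁻¹` breaks down, but there `T` itself is the
    -- resolvent. Elsewhere `(x + 1)⁻¹` would lie in the spectrum of `T`, hence in `[0, ν]`, which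
    -- forces `x ≥ ν⁻¹ - 1`.
    by_cases h0 : (x : ℂ) + 1 = 0
    · refine ⟨T, fun y => ?_, fun y => ?_⟩
      · have h2 : (T y, y - T y) ∈ A.graph := by rw [hA']; congr 1; abel
        obtain ⟨a, ha1, ha2⟩ := LinearPMap.mem_graph_iff _ |>.1 h2
        have hmem : T y ∈ A.domain := mem_of_eq_of_mem (show _ = (a : H) from ha1.symm) a.2
        refine ⟨hmem, ?_⟩
        have : (⟨T y, hmem⟩ : A.domain) = a := Subtype.ext ha1.symm
        rw [this, ha2, eq_neg_of_add_eq_zero_left h0]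
        simp
      · have h1 := (hA' y (A y)).1 (LinearPMap.mem_graph A y)
        rw [eq_neg_of_add_eq_zero_left h0, neg_one_smul, sub_neg_eq_add, add_comm]
        exact h1
    · refine mem_opResolventSet_of_isUnit hA' h0 ?_
      by_contra hnu
      have hmem : (x + 1)⁻¹ ∈ spectrum ℝ T := by
        rw [← spectrum.algebraMap_mem_iff ℂ, spectrum.mem_iff]
        simpa using hnu
      have h1 : 0 ≤ (x + 1)⁻¹ := spectrum_nonneg_of_nonneg hTnn hmem
      have h2 : (x + 1)⁻¹ ≤ ν := by
        have := spectrum.norm_le_norm_of_mem hmem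
        rw [hnorm] at this
        exact (Real.le_norm_self _).trans this
      have hx1 : x + 1 ≠ 0 := by exact_mod_cast h0
      have h3 : 0 < (x + 1)⁻¹ := lt_of_le_of_ne h1 (inv_ne_zero hx1).symm
      have h4 : ν⁻¹ ≤ x + 1 := by
        have := inv_anti₀ h3 h2
        rwa [inv_inv] at this
      linarith
  · obtain ⟨ε, hε, hiso⟩ := exists_forall_isUnit_of_compact_perturbation hdec hcomp hsa hν0 hBn
    have hcont : ContinuousAt (fun z : ℂ => (z + 1)⁻¹) ((ν⁻¹ - 1 : ℝ) : ℂ) := by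
      refine (continuousAt_id.add continuousAt_const).inv₀ ?_
      simp [hν0.ne']
    have hev : ((ν⁻¹ - 1 : ℝ) : ℂ) + 1 = (ν : ℂ)⁻¹ := by push_cast; ring
    obtain ⟨δ, hδ, hδ'⟩ := Metric.continuousAt_iff.1 hcont ε hε
    have hνi : 0 < ν⁻¹ := by positivity
    -- `ν⁻¹` is the distance from `ν⁻¹ - 1` to the exceptional point `-1`.
    refine ⟨min δ ν⁻¹, lt_min hδ hνi, fun w hw hwlt => ?_⟩
    by_contra hne
    have h0 : w + 1 ≠ 0 := fun h => by
      rw [eq_neg_of_add_eq_zero_left h] at hwlt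
      have : (-1 : ℂ) - ((ν⁻¹ - 1 : ℝ) : ℂ) = ((-ν⁻¹ : ℝ) : ℂ) := by push_cast; ring
      rw [this, Complex.norm_real, norm_neg, Real.norm_of_nonneg hνi.le] at hwlt
      exact absurd (hwlt.trans_le (min_le_right _ _)) (lt_irrefl _)
    refine hw (mem_opResolventSet_of_isUnit hA' h0 (hiso _ ?_ ?_))
    · have := hδ' (x := w) (by rw [dist_eq_norm]; exact hwlt.trans_le (min_le_left _ _))
      rwa [hev, inv_inv, dist_eq_norm] at this
    · intro h
      apply hne
      have h5 : w + 1 = (ν : ℂ)⁻¹ := by rw [← h, inv_inv]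
      rw [eq_sub_of_add_eq h5]; push_cast; ring

end FormOperator

/-! ### Operators with square integrable kernels -/

section KernelOperator

variable {α V : Type*} [MeasurableSpace α] {μ : Measure α} [NormedAddCommGroup V]
  [NormedSpace ℂ V]

/-- The operators `v ↦ (x ↦ κ x v)` with values in `L²`, whose kernel is a square integrable
family `κ` of functionals. -/
noncomputable def kernelOperator (V : Type*) [NormedAddCommGroup V] [NormedSpace ℂ V]
    (μ : Measure α) : Lp (V →L[ℂ] ℂ) 2 μ →L[ℂ] V →L[ℂ] Lp ℂ 2 μ :=
  (ContinuousLinearMap.compLpL₂ 2 μ (ContinuousLinearMap.apply ℂ ℂ)).flip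

theorem coeFn_kernelOperator (κ : Lp (V →L[ℂ] ℂ) 2 μ) (v : V) :
    kernelOperator V μ κ v =ᵐ[μ] fun x => κ x v :=
  ContinuousLinearMap.coeFn_compLp (ContinuousLinearMap.apply ℂ ℂ v) κ

/-- The Hilbert–Schmidt argument: a kernel that is constant on a set of finite measure and zero
elsewhere gives an operator of rank at most one. Sums of such kernels are dense in `L²`, the
operator depends continuously on its kernel, and compact operators form a closed set. -/
theorem isCompactOperator_kernelOperator (κ : Lp (V →L[ℂ] ℂ) 2 μ) :
    IsCompactOperator (kernelOperator V μ κ) := by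
  refine Lp.induction (by norm_num) (fun κ => IsCompactOperator (kernelOperator V μ κ)) ?_ ?_ ?_ κ
  · intro c s hs hμs
    set e : Lp ℂ 2 μ := indicatorConstLp 2 hs hμs.ne 1
    have : kernelOperator V μ (Lp.simpleFunc.indicatorConst 2 hs hμs.ne c : Lp (V →L[ℂ] ℂ) 2 μ) =
        (ContinuousLinearMap.toSpanSingleton ℂ e) ∘L c := by
      ext1 v
      apply Lp.ext
      have h1 := coeFn_kernelOperator
        (Lp.simpleFunc.indicatorConst 2 hs hμs.ne c : Lp (V →L[ℂ] ℂ) 2 μ) v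
      rw [Lp.simpleFunc.coe_indicatorConst] at h1
      have h2 : ((ContinuousLinearMap.toSpanSingleton ℂ e) ∘L c) v = c v • e := rfl
      rw [h2, Lp.simpleFunc.coe_indicatorConst]
      filter_upwards [h1, Lp.coeFn_smul (c v) e, indicatorConstLp_coeFn (p := 2) (hs := hs)
        (hμs := hμs.ne) (c := c), indicatorConstLp_coeFn (p := 2) (hs := hs)
        (hμs := hμs.ne) (c := (1 : ℂ))] with x h1 h2 h3 h4
      rw [h1, h2, h3, Pi.smul_apply, h4]
      by_cases hx : x ∈ s <;> simp [hx]
    rw [this]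
    exact (isCompactOperator_of_locallyCompactSpace_rng
      (ContinuousLinearMap.toSpanSingleton ℂ e)).comp_clm c
  · intro f g hf hg _ h1 h2
    rw [map_add]
    exact h1.add h2
  · exact isClosed_setOfPred_isCompactOperator.preimage (kernelOperator V μ).continuous

end KernelOperator

/-! ### Averages of test functions along lines -/

/-- The weighted average of `k` along the segment from `p` to `p - a e`. -/
noncomputable def lineAverage (a : ℝ) (e : ℝ × ℝ) (w : ℝ → ℝ) (k : ℝ × ℝ → ℝ) (p : ℝ × ℝ) : ℝ :=
  ∫ t in Ioc 0 a, w t * k (p - t • e)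

section LineAverage

open ContinuousLinearMap
open scoped Convolution

variable {a : ℝ} {e : ℝ × ℝ} {w : ℝ → ℝ} {k : ℝ × ℝ → ℝ}

/-- The average is a convolution with a measure carried by a segment. The functional `l` recovers
the parameter `t` from the point `t e`, so that the weight becomes a function on the plane.
Smoothness is then inherited from `k`. -/
theorem convolution_eq_lineAverage (hw : Continuous w) {l : ℝ × ℝ →L[ℝ] ℝ} (hl : l e = 1)
    {k : ℝ × ℝ → ℝ} (hk : Continuous k) :
    ((fun q => w (l q)) ⋆[lsmul ℝ ℝ,
      (volume.restrict (Ioc 0 a)).map (fun t : ℝ => t • e)] k) = lineAverage a e w k := by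
  ext p
  rw [convolution_def, integral_map (by fun_prop)]
  · simp only [map_smul, hl, smul_eq_mul, mul_one, lsmul_apply, lineAverage]
  · refine Continuous.aestronglyMeasurable ?_
    simp only [lsmul_apply]
    fun_prop

theorem contDiff_lineAverage (hw : Continuous w) {l : ℝ × ℝ →L[ℝ] ℝ} (hl : l e = 1)
    (hk : ContDiff ℝ ∞ k) (hc : HasCompactSupport k) : ContDiff ℝ ∞ (lineAverage a e w k) := by
  rw [← convolution_eq_lineAverage hw hl hk.continuous]
  exact hc.contDiff_convolution_right _
    (Continuous.locallyIntegrable (by fun_prop)) hk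

theorem fderiv_lineAverage (hw : Continuous w)
    (hk : ContDiff ℝ ∞ k) (hc : HasCompactSupport k) (p v : ℝ × ℝ) :
    fderiv ℝ (lineAverage a e w k) p v = lineAverage a e w (fun q => fderiv ℝ k q v) p := by
  have hk' : Continuous (fderiv ℝ k) := hk.continuous_fderiv (by simp)
  have hkc := hk.continuous
  obtain ⟨M, hM⟩ := hk'.bounded_above_of_compact_support (hc.fderiv ℝ)
  have hint : ∀ x : ℝ × ℝ, Integrable (fun t => w t • fderiv ℝ k (x - t • e))
      (volume.restrict (Ioc 0 a)) := fun x =>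
    (Continuous.integrableOn_Icc (by fun_prop)).mono_set Ioc_subset_Icc_self
  have hD : HasFDerivAt (lineAverage a e w k)
      (∫ t in Ioc 0 a, w t • fderiv ℝ k (p - t • e)) p := by
    refine hasFDerivAt_integral_of_dominated_of_fderiv_le (bound := fun t => |w t| * M)
      (F := fun x t => w t * k (x - t • e))
      (F' := fun x t => w t • fderiv ℝ k (x - t • e)) (s := univ) Filter.univ_mem
      (Filter.Eventually.of_forall fun x => ?_) ?_
      (hint p).aestronglyMeasurable (Filter.Eventually.of_forall fun t x _ => ?_) ?_
      (Filter.Eventually.of_forall fun t x _ => ?_)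
    · exact Continuous.aestronglyMeasurable (by fun_prop)
    · exact (Continuous.integrableOn_Icc (by fun_prop)).mono_set Ioc_subset_Icc_self
    · rw [norm_smul, Real.norm_eq_abs]
      exact mul_le_mul_of_nonneg_left (hM _) (abs_nonneg _)
    · exact (Continuous.integrableOn_Icc (by fun_prop)).mono_set Ioc_subset_Icc_self
    · have h1 : HasFDerivAt (fun x : ℝ × ℝ => k (x - t • e)) (fderiv ℝ k (x - t • e)) x := by
        have := ((hk.differentiable (by simp)) (x - t • e)).hasFDerivAt.comp x
          ((hasFDerivAt_id x).sub_const (t • e))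
        simpa using! this
      exact h1.const_mul (w t)
  rw [hD.fderiv, ContinuousLinearMap.integral_apply (hint p)]
  rfl

theorem hasDerivAt_comp_sub_smul (hk : ContDiff ℝ ∞ k) (p : ℝ × ℝ) (t : ℝ) :
    HasDerivAt (fun t : ℝ => k (p - t • e)) (-fderiv ℝ k (p - t • e) e) t := by
  have h1 : HasDerivAt (fun t : ℝ => p - t • e) (-e) t := by
    simpa using ((hasDerivAt_id t).smul_const e).const_sub p
  have := ((hk.differentiable (by simp)) (p - t • e)).hasFDerivAt.comp_hasDerivAt t h1
  rwa [map_neg] at this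

/-- The fundamental theorem of calculus along the segment. It supplies test functions with
prescribed derivative along `e` wherever the shifted copy of `k` vanishes. -/
theorem fderiv_lineAverage_one (ha : 0 ≤ a)
    (hk : ContDiff ℝ ∞ k) (hc : HasCompactSupport k) (p : ℝ × ℝ) :
    fderiv ℝ (lineAverage a e (fun _ => 1) k) p e = k p - k (p - a • e) := by
  have hk' : Continuous (fderiv ℝ k) := hk.continuous_fderiv (by simp)
  rw [fderiv_lineAverage continuous_const hk hc, lineAverage,
    ← intervalIntegral.integral_of_le ha]
  have := intervalIntegral.integral_eq_sub_of_hasDerivAt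
    (fun t _ => (hasDerivAt_comp_sub_smul (e := e) hk p t)) (a := 0) (b := a)
    (Continuous.intervalIntegrable (by fun_prop) _ _)
  simp only [one_mul]
  rw [intervalIntegral.integral_neg] at this
  simp only [zero_smul, sub_zero] at this
  linarith

/-- Integration by parts along the segment: the weight is `1` at `t = 0` and `0` at `t = a`, so only
the boundary term `k p` survives, and the constant slope of the weight leaves the mean of `k`. -/
theorem fderiv_lineAverage_linear (ha : 0 < a)
    (hk : ContDiff ℝ ∞ k) (hc : HasCompactSupport k) (p : ℝ × ℝ) :
    fderiv ℝ (lineAverage a e (fun t => 1 - t / a) k) p e =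
      k p - lineAverage a e (fun _ => 1 / a) k p := by
  have hk' : Continuous (fderiv ℝ k) := hk.continuous_fderiv (by simp)
  rw [fderiv_lineAverage (by fun_prop) hk hc, lineAverage, lineAverage,
    ← intervalIntegral.integral_of_le ha.le, ← intervalIntegral.integral_of_le ha.le]
  have hd : ∀ t : ℝ, HasDerivAt (fun t : ℝ => (1 - t / a) * k (p - t • e))
      (-(1 / a * k (p - t • e)) - (1 - t / a) * fderiv ℝ k (p - t • e) e) t := fun t => by
    have h1 : HasDerivAt (fun t : ℝ => 1 - t / a) (-(1 / a)) t :=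
      ((hasDerivAt_id t).div_const a).const_sub 1
    refine (h1.mul (hasDerivAt_comp_sub_smul hk p t)).congr_deriv ?_
    ring
  have hkc := hk.continuous
  have i1 : IntervalIntegrable (fun t : ℝ => -(1 / a * k (p - t • e))) volume 0 a :=
    Continuous.intervalIntegrable (by fun_prop) _ _
  have i2 : IntervalIntegrable (fun t : ℝ => (1 - t / a) * fderiv ℝ k (p - t • e) e) volume 0 a :=
    Continuous.intervalIntegrable (by fun_prop) _ _
  have := intervalIntegral.integral_eq_sub_of_hasDerivAt (fun t _ => hd t) (i1.sub i2)
  rw [intervalIntegral.integral_sub i1 i2, intervalIntegral.integral_neg, div_self ha.ne'] at this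
  simp only [zero_smul, sub_zero, zero_div, sub_self, zero_mul, one_mul] at this
  linarith

theorem tsupport_lineAverage_subset (hc : HasCompactSupport k) :
    tsupport (lineAverage a e w k) ⊆
      (fun x : ℝ × (ℝ × ℝ) => x.2 + x.1 • e) '' (Icc 0 a ×ˢ tsupport k) := by
  have hcomp : IsCompact ((fun x : ℝ × (ℝ × ℝ) => x.2 + x.1 • e) '' (Icc 0 a ×ˢ tsupport k)) :=
    (isCompact_Icc.prod hc).image (by fun_prop)
  refine closure_minimal (fun p hp => ?_) hcomp.isClosed
  by_contra hn
  refine hp (setIntegral_eq_zero_of_forall_eq_zero fun t ht => ?_)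
  have : k (p - t • e) = 0 := image_eq_zero_of_notMem_tsupport fun hmem =>
    hn ⟨(t, p - t • e), ⟨⟨ht.1.le, ht.2⟩, hmem⟩, by simp⟩
  rw [this, mul_zero]

theorem isTestFunction_lineAverage (hw : Continuous w) {l : ℝ × ℝ →L[ℝ] ℝ} (hl : l e = 1)
    {U U' : Set (ℝ × ℝ)} (hk : IsTestFunction U k)
    (hU : ∀ q ∈ U, ∀ t ∈ Icc 0 a, q + t • e ∈ U') : IsTestFunction U' (lineAverage a e w k) := by
  have hcomp : IsCompact ((fun x : ℝ × (ℝ × ℝ) => x.2 + x.1 • e) '' (Icc 0 a ×ˢ tsupport k)) :=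
    (isCompact_Icc.prod hk.2.1).image (by fun_prop)
  refine ⟨contDiff_lineAverage hw hl hk.1 hk.2.1,
    hcomp.of_isClosed_subset (isClosed_tsupport _) (tsupport_lineAverage_subset hk.2.1),
    (tsupport_lineAverage_subset hk.2.1).trans ?_⟩
  rintro _ ⟨⟨t, q⟩, ⟨ht, hq⟩, rfl⟩
  exact hU q (hk.2.2 hq) t ht

end LineAverage

/-! ### The sharp Poincaré inequality on an interval with a Dirichlet condition at one end -/

section Poincare

theorem lintegral_mul_sq_le {α : Type*} [MeasurableSpace α] (μ : Measure α) {f g : α → ℝ≥0∞}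
    (hf : AEMeasurable f μ) (hg : AEMeasurable g μ) :
    (∫⁻ x, f x * g x ∂μ) ^ 2 ≤ (∫⁻ x, f x ^ 2 ∂μ) * ∫⁻ x, g x ^ 2 ∂μ := by
  have := ENNReal.lintegral_mul_le_Lp_mul_Lq μ Real.HolderConjugate.two_two hf hg
  have h2 := pow_le_pow_left' this 2
  refine h2.trans_eq ?_
  rw [mul_pow, ← ENNReal.rpow_natCast, ← ENNReal.rpow_natCast, ← ENNReal.rpow_mul,
    ← ENNReal.rpow_mul]
  simp

theorem lintegral_Ioo_cos {κ u : ℝ} (hκ : 0 < κ) (hu : 0 < u) (huκ : κ * u ≤ Real.pi / 2) :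
    ∫⁻ t in Ioo 0 u, ENNReal.ofReal (Real.cos (κ * t)) =
      ENNReal.ofReal (Real.sin (κ * u) / κ) := by
  rw [← ofReal_integral_eq_lintegral_ofReal]
  · rw [← integral_Ioc_eq_integral_Ioo, ← intervalIntegral.integral_of_le hu.le,
      intervalIntegral.integral_comp_mul_left _ hκ.ne', integral_cos]
    simp [div_eq_inv_mul]
  · exact (Continuous.integrableOn_Icc (by fun_prop)).mono_set Ioo_subset_Icc_self
  · filter_upwards [ae_restrict_mem measurableSet_Ioo] with t ht
    refine Real.cos_nonneg_of_neg_pi_div_two_le_of_le ?_ ?_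
    · have := mul_pos hκ ht.1
      linarith [Real.pi_pos]
    · exact (mul_le_mul_of_nonneg_left ht.2.le hκ.le).trans huκ

/-- Because `cos(κd) = 0` there is no contribution from the upper end. Integrating `cos(κ·)` from
`0` to `u` and then from `t` to `d` reproduces it with the factor `κ⁻²`, the best constant in the
Poincaré inequality. -/
theorem lintegral_Ioo_sin {κ d t : ℝ} (hκ : 0 < κ) (ht : t ∈ Ioo 0 d)
    (hd : κ * d = Real.pi / 2) :
    ∫⁻ u in Ioo t d, ENNReal.ofReal (Real.sin (κ * u) / κ) =
      ENNReal.ofReal (Real.cos (κ * t)) * ENNReal.ofReal ((κ ^ 2)⁻¹) := by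
  rw [← ENNReal.ofReal_mul' (by positivity), ← ofReal_integral_eq_lintegral_ofReal]
  · rw [← integral_Ioc_eq_integral_Ioo, ← intervalIntegral.integral_of_le ht.2.le,
      intervalIntegral.integral_div,
      intervalIntegral.integral_comp_mul_left _ hκ.ne', integral_sin, hd]
    congr 1
    rw [Real.cos_pi_div_two, sub_zero, smul_eq_mul]
    field_simp
  · exact (Continuous.integrableOn_Icc (by fun_prop)).mono_set Ioo_subset_Icc_self
  · filter_upwards [ae_restrict_mem measurableSet_Ioo] with u hu
    have h0 : 0 < u := ht.1.trans hu.1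
    have h1 : κ * u ≤ κ * d := mul_le_mul_of_nonneg_left hu.2.le hκ.le
    exact div_nonneg (Real.sin_nonneg_of_nonneg_of_le_pi (by positivity)
      (by linarith [Real.pi_pos])) hκ.le

/-- The Poincaré inequality on `(0, d)` with the optimal constant, for functions
`u ↦ ∫_0^u G` that vanish at `0`. -/
theorem lintegral_primitive_sq_le {κ d : ℝ} (hκ : 0 < κ) (hd : κ * d = Real.pi / 2)
    {G : ℝ → ℝ≥0∞} (hG : Measurable G) :
    ∫⁻ u in Ioo 0 d, (∫⁻ t in Ioo 0 u, G t) ^ 2 ≤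
      ENNReal.ofReal ((κ ^ 2)⁻¹) * ∫⁻ t in Ioo 0 d, G t ^ 2 := by
  -- Schur's test with the weight `cos(κt) = c(t)²`. Cauchy–Schwarz applied to `G = (G / c) · c`
  -- bounds the square of the primitive by `sin(κu) / κ · ∫₀ᵘ (G / c)²`. After exchanging the
  -- integrals, the integral of `sin(κu) / κ` over `(t, d)` is `κ⁻² c(t)²` and cancels the division
  -- by `c²`.
  set c : ℝ → ℝ≥0∞ := fun t => ENNReal.ofReal (Real.sqrt (Real.cos (κ * t))) with hc
  have hcm : Measurable c := by fun_prop
  have hcos : ∀ t ∈ Ioo 0 d, 0 < Real.cos (κ * t) := fun t ht => by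
    refine Real.cos_pos_of_mem_Ioo ⟨?_, ?_⟩
    · have := mul_pos hκ ht.1
      linarith [Real.pi_pos]
    · rw [← hd]; exact mul_lt_mul_of_pos_left ht.2 hκ
  have hc2 : ∀ t ∈ Ioo 0 d, c t ^ 2 = ENNReal.ofReal (Real.cos (κ * t)) := fun t ht => by
    rw [hc, ← ENNReal.ofReal_pow (Real.sqrt_nonneg _), Real.sq_sqrt (hcos t ht).le]
  have hc0 : ∀ t ∈ Ioo 0 d, c t ≠ 0 := fun t ht => by
    simpa [hc] using hcos t ht
  have hctop : ∀ t, c t ≠ ⊤ := fun t => ENNReal.ofReal_ne_top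
  set S : ℝ → ℝ≥0∞ := fun u => ENNReal.ofReal (Real.sin (κ * u) / κ) with hS
  have hSm : Measurable S := by fun_prop
  set F : ℝ → ℝ≥0∞ := fun t => (G t * (c t)⁻¹) ^ 2 with hF
  have hFm : Measurable F := by fun_prop
  have step1 : ∀ u ∈ Ioo 0 d, (∫⁻ t in Ioo 0 u, G t) ^ 2 ≤
      ∫⁻ t in Ioo 0 d, (Ioi t).indicator S u * F t := fun u hu => by
    have hsub : Ioo 0 u ⊆ Ioo 0 d := Ioo_subset_Ioo_right hu.2.le
    have e1 : ∫⁻ t in Ioo 0 u, G t = ∫⁻ t in Ioo 0 u, G t * (c t)⁻¹ * c t := by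
      refine setLIntegral_congr_fun measurableSet_Ioo fun t ht => ?_
      rw [mul_assoc, ENNReal.inv_mul_cancel (hc0 t (hsub ht)) (hctop t), mul_one]
    have e2 : ∫⁻ t in Ioo 0 u, c t ^ 2 = S u := by
      rw [setLIntegral_congr_fun measurableSet_Ioo fun t ht => hc2 t (hsub ht)]
      exact lintegral_Ioo_cos hκ hu.1 (by
        rw [← hd]; exact mul_le_mul_of_nonneg_left hu.2.le hκ.le)
    rw [e1]
    refine (lintegral_mul_sq_le _ (by fun_prop) (by fun_prop)).trans_eq ?_
    rw [e2, mul_comm, ← lintegral_const_mul _ hFm, ← lintegral_indicator measurableSet_Ioo,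
      ← lintegral_indicator measurableSet_Ioo]
    refine lintegral_congr fun t => ?_
    by_cases h1 : t ∈ Ioo 0 u
    · rw [indicator_of_mem h1, indicator_of_mem (hsub h1),
        indicator_of_mem (show u ∈ Ioi t from h1.2)]
    · rw [indicator_of_notMem h1]
      by_cases h2 : t ∈ Ioo 0 d
      · rw [indicator_of_mem h2,
          indicator_of_notMem (show u ∉ Ioi t from fun h => h1 ⟨h2.1, h⟩), zero_mul]
      · rw [indicator_of_notMem h2]
  calc ∫⁻ u in Ioo 0 d, (∫⁻ t in Ioo 0 u, G t) ^ 2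
      ≤ ∫⁻ u in Ioo 0 d, ∫⁻ t in Ioo 0 d, (Ioi t).indicator S u * F t :=
        setLIntegral_mono' measurableSet_Ioo step1
    _ = ∫⁻ t in Ioo 0 d, ∫⁻ u in Ioo 0 d, (Ioi t).indicator S u * F t := by
        refine lintegral_lintegral_swap (Measurable.aemeasurable ?_)
        refine Measurable.mul ?_ (hFm.comp measurable_snd)
        have : (fun p : ℝ × ℝ => (Ioi p.2).indicator S p.1) =
            {p : ℝ × ℝ | p.2 < p.1}.indicator (fun p => S p.1) := by
          ext p; simp [indicator]
        rw [this]
        exact (hSm.comp measurable_fst).indicator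
          (measurableSet_lt measurable_snd measurable_fst)
    _ = ∫⁻ t in Ioo 0 d, ENNReal.ofReal ((κ ^ 2)⁻¹) * G t ^ 2 := by
        refine setLIntegral_congr_fun measurableSet_Ioo fun t ht => ?_
        rw [lintegral_mul_const _ (hSm.indicator measurableSet_Ioi),
          setLIntegral_indicator measurableSet_Ioi]
        have : Ioi t ∩ Ioo 0 d = Ioo t d := by
          ext u; exact ⟨fun h => ⟨h.1, h.2.2⟩, fun h => ⟨h.1, ht.1.trans h.1, h.2⟩⟩
        rw [this, lintegral_Ioo_sin hκ ht hd, ← hc2 t ht]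
        change c t ^ 2 * _ * (G t * (c t)⁻¹) ^ 2 = _
        rw [mul_pow, mul_comm (c t ^ 2), mul_assoc]
        congr 1
        rw [mul_left_comm, ← mul_pow, ENNReal.mul_inv_cancel (hc0 t ht) (hctop t), one_pow,
          mul_one]
    _ = _ := lintegral_const_mul _ (by fun_prop)

end Poincare

/-! ### Square integrable functions -/

section SquareIntegrable

variable {α : Type*} [MeasurableSpace α] {μ : Measure α} {f : α → ℂ}

theorem eLpNorm_two_sq (f : α → ℂ) (μ : Measure α) :
    eLpNorm f 2 μ ^ 2 = ∫⁻ x, ‖f x‖ₑ ^ 2 ∂μ := by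
  rw [eLpNorm_eq_lintegral_rpow_enorm_toReal (by norm_num) (by norm_num), ← ENNReal.rpow_natCast,
    ← ENNReal.rpow_mul]
  simp

theorem lintegral_enorm_sq_congr {f g : α → ℂ} (h : f =ᵐ[μ] g) :
    ∫⁻ x, ‖f x‖ₑ ^ 2 ∂μ = ∫⁻ x, ‖g x‖ₑ ^ 2 ∂μ :=
  lintegral_congr_ae (h.mono fun x hx => by simp only [hx])

theorem memLp_two_iff_lintegral_lt_top (hf : AEStronglyMeasurable f μ) :
    MemLp f 2 μ ↔ ∫⁻ x, ‖f x‖ₑ ^ 2 ∂μ < ⊤ := by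
  rw [← eLpNorm_two_sq, MemLp, and_iff_right hf]
  simp

theorem ofReal_norm_sq_eq_lintegral (f : Lp ℂ 2 μ) :
    ENNReal.ofReal (‖f‖ ^ 2) = ∫⁻ x, ‖f x‖ₑ ^ 2 ∂μ := by
  rw [← eLpNorm_two_sq, ENNReal.ofReal_pow (norm_nonneg _), Lp.norm_def,
    ENNReal.ofReal_toReal (Lp.eLpNorm_ne_top f)]

end SquareIntegrable

/-! ### Functions on the strip that vanish on the Dirichlet side -/

theorem restrict_straightStrip (d : ℝ) : (volume : Measure (ℝ × ℝ)).restrict (straightStrip d) =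
    (volume : Measure ℝ).prod (volume.restrict (Ioo 0 d)) := by
  rw [straightStrip, Measure.volume_eq_prod, ← Measure.prod_restrict, Measure.restrict_univ]

/-- The primitive `(s, u) ↦ ∫_0^u g(s, t) dt`. -/
noncomputable def verticalPrimitive (g : ℝ × ℝ → ℂ) (p : ℝ × ℝ) : ℂ :=
  ∫ t in Ioo 0 p.2, g (p.1, t)

theorem ae_section_straightStrip {d : ℝ} {P : ℝ × ℝ → Prop}
    (h : ∀ᵐ p ∂(volume.restrict (straightStrip d)), P p) :
    ∀ᵐ s : ℝ, ∀ᵐ t ∂(volume.restrict (Ioo 0 d)), P (s, t) := by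
  rw [restrict_straightStrip] at h
  exact Measure.ae_ae_of_ae_prod h

theorem ae_straightStrip_of_ae_fst {d : ℝ} {P : ℝ → Prop} (h : ∀ᵐ s : ℝ, P s) :
    ∀ᵐ p ∂(volume.restrict (straightStrip d)), P p.1 := by
  rw [restrict_straightStrip]
  exact Measure.quasiMeasurePreserving_fst.ae h

theorem verticalPrimitive_congr {d : ℝ} {g g' : ℝ × ℝ → ℂ}
    (h : g =ᵐ[volume.restrict (straightStrip d)] g') :
    verticalPrimitive g =ᵐ[volume.restrict (straightStrip d)] verticalPrimitive g' := by
  filter_upwards [ae_straightStrip_of_ae_fst (d := d) (ae_section_straightStrip h),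
    CurvedStrip.ae_mem_straightStrip d] with p hp hpS
  exact integral_congr_ae (ae_mono (Measure.restrict_mono
    (Ioo_subset_Ioo_right hpS.2.2.le) le_rfl) hp)

theorem stronglyMeasurable_verticalPrimitive {g : ℝ × ℝ → ℂ} (hg : StronglyMeasurable g) :
    StronglyMeasurable (verticalPrimitive g) := by
  have h1 : StronglyMeasurable ({q : (ℝ × ℝ) × ℝ | 0 < q.2 ∧ q.2 < q.1.2}.indicator
      fun q => g (q.1.1, q.2)) :=
    (hg.comp_measurable (by fun_prop)).indicator
      ((measurableSet_lt measurable_const measurable_snd).inter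
        (measurableSet_lt measurable_snd (by fun_prop)))
  have h2 : verticalPrimitive g = fun p => ∫ t, ({q : (ℝ × ℝ) × ℝ | 0 < q.2 ∧ q.2 < q.1.2}.indicator
      fun q => g (q.1.1, q.2)) (p, t) := by
    ext p
    rw [verticalPrimitive, ← integral_indicator measurableSet_Ioo]
    rfl
  rw [h2]
  exact h1.integral_prod_right'

/-- The one-dimensional inequality on each line `s = const`. It is local in `s`: the sharp constant
will be needed only over the straight ends of the strip, where the weight of the measure is `1`. -/
theorem lintegral_verticalPrimitive_sq_le {κ d : ℝ} (hκ : 0 < κ) (hd : κ * d = Real.pi / 2)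
    {g : ℝ × ℝ → ℂ} (hg : AEStronglyMeasurable g (volume.restrict (straightStrip d)))
    {A : Set ℝ} :
    ∫⁻ p in A ×ˢ Ioo 0 d, ‖verticalPrimitive g p‖ₑ ^ 2 ≤
      ENNReal.ofReal ((κ ^ 2)⁻¹) * ∫⁻ p in A ×ˢ Ioo 0 d, ‖g p‖ₑ ^ 2 := by
  wlog h : StronglyMeasurable g generalizing g
  · have hle : volume.restrict (A ×ˢ Ioo 0 d) ≤ volume.restrict (straightStrip d) :=
      Measure.restrict_mono (prod_mono_left (subset_univ A)) le_rfl
    have e1 := ae_mono hle hg.ae_eq_mk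
    have e2 := ae_mono hle (verticalPrimitive_congr hg.ae_eq_mk)
    have := this hg.stronglyMeasurable_mk.aestronglyMeasurable hg.stronglyMeasurable_mk
    rwa [lintegral_enorm_sq_congr e2, lintegral_enorm_sq_congr e1]
  have hV := stronglyMeasurable_verticalPrimitive h
  rw [Measure.volume_eq_prod, ← Measure.prod_restrict,
    lintegral_prod _ (hV.enorm.pow_const 2).aemeasurable,
    lintegral_prod _ (h.enorm.pow_const 2).aemeasurable,
    ← lintegral_const_mul' _ _ ENNReal.ofReal_ne_top]
  refine lintegral_mono fun s => ?_
  refine le_trans (lintegral_mono fun u => ?_) (lintegral_primitive_sq_le hκ hd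
    (G := fun t => ‖g (s, t)‖ₑ) (h.comp_measurable measurable_prodMk_left).enorm)
  gcongr
  exact enorm_integral_le_lintegral_enorm _

theorem MeasureTheory.MemLp.verticalPrimitive {d : ℝ} (hd : 0 < d) {g : ℝ × ℝ → ℂ}
    (hg : MemLp g 2 (volume.restrict (straightStrip d))) :
    MemLp (verticalPrimitive g) 2 (volume.restrict (straightStrip d)) := by
  have hm : AEStronglyMeasurable (_root_.verticalPrimitive g) (volume.restrict (straightStrip d)) :=
    ⟨_, stronglyMeasurable_verticalPrimitive hg.1.stronglyMeasurable_mk,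
      verticalPrimitive_congr hg.1.ae_eq_mk⟩
  rw [memLp_two_iff_lintegral_lt_top hm]
  have hκ : Real.pi / (2 * d) * d = Real.pi / 2 := by field_simp
  refine (lintegral_verticalPrimitive_sq_le (by positivity) hκ hg.1 (A := univ)).trans_lt ?_
  exact ENNReal.mul_lt_top ENNReal.ofReal_lt_top
    ((memLp_two_iff_lintegral_lt_top hg.1).1 hg)

theorem ae_memLp_section {d : ℝ} {g : ℝ × ℝ → ℂ}
    (hg : MemLp g 2 (volume.restrict (straightStrip d))) :
    ∀ᵐ s : ℝ, MemLp (fun t => g (s, t)) 2 (volume.restrict (Ioo 0 d)) := by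
  have h2 := (memLp_two_iff_integrable_sq_norm hg.1).1 hg
  have hm := hg.1
  rw [restrict_straightStrip] at h2 hm
  filter_upwards [h2.prod_right_ae, hm.prodMk_left] with s hs hs'
  exact (memLp_two_iff_integrable_sq_norm hs').2 hs

/-- The segment from `(s, u)` in the direction `-(0, -1)` has length `d` and therefore leaves the
strip through its upper side, above which `k` vanishes. What remains is `∫_u^d k(s, t) dt`. -/
theorem lineAverage_vertical {d : ℝ} {k : ℝ × ℝ → ℝ} (hk : IsTestFunction (straightStrip d) k)
    {s u : ℝ} (hu : u ∈ Ioo 0 d) : lineAverage d (0, -1) (fun _ => 1) k (s, u) =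
      ∫ t in Ioo 0 d, (Ioi u).indicator (fun t => k (s, t)) t := by
  have hd : 0 ≤ d := (hu.1.trans hu.2).le
  rw [lineAverage, ← intervalIntegral.integral_of_le hd, setIntegral_indicator measurableSet_Ioi]
  have h1 : ∀ t : ℝ, (1 : ℝ) * k ((s, u) - t • (0, -1)) = (fun t => k (s, t)) (t + u) := fun t => by
    simp [add_comm]
  simp only [h1]
  rw [intervalIntegral.integral_comp_add_right (fun t => k (s, t)), zero_add,
    intervalIntegral.integral_of_le (by linarith)]
  refine setIntegral_eq_of_subset_of_forall_sdiff_eq_zero measurableSet_Ioc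
    (fun t ht => ⟨ht.2, by linarith [ht.1.2, hu.1]⟩) fun t ht => ?_
  refine image_eq_zero_of_notMem_tsupport fun hmem => ht.2 ?_
  exact ⟨(hk.2.2 hmem).2, ht.1.1⟩

/-- Fubini on the triangle `u < t`: integration from `u` to `d` is the transpose of integration from
`0` to `t`. -/
theorem setIntegral_lineAverage_vertical {d : ℝ} (hd : 0 < d) {k : ℝ × ℝ → ℝ}
    (hk : IsTestFunction (straightStrip d) k) {g : ℝ × ℝ → ℂ}
    (hg : MemLp g 2 (volume.restrict (straightStrip d))) :
    ∫ p in straightStrip d, lineAverage d (0, -1) (fun _ => 1) k p • g p =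
      ∫ p in straightStrip d, k p • verticalPrimitive g p := by
  -- Averaging sweeps the support downwards: it may cross the Dirichlet side `u = 0`, but it stays
  -- below `u = d`.
  have hφ : IsTestFunction {p | p.2 < d} (lineAverage d (0, -1) (fun _ => 1) k) :=
    isTestFunction_lineAverage continuous_const (l := -ContinuousLinearMap.snd ℝ ℝ ℝ) (by simp) hk
      fun q hq t ht => by
        have := hq.2.2
        have := ht.1
        simp only [mem_ofPred_eq, Prod.snd_add, Prod.smul_snd, smul_eq_mul]
        linarith
  have i1 := integrable_continuous_smul hφ.1.continuous hφ.2.1 hg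
  have i2 := integrable_continuous_smul hk.1.continuous hk.2.1 (hg.verticalPrimitive hd)
  rw [restrict_straightStrip] at i1 i2 ⊢
  rw [integral_prod _ i1, integral_prod _ i2]
  refine integral_congr_ae ?_
  filter_upwards [ae_memLp_section hg] with s hs
  have hgi : Integrable (fun t => g (s, t)) (volume.restrict (Ioo 0 d)) :=
    hs.integrable (by norm_num)
  have hki : Integrable (fun t => k (s, t)) (volume.restrict (Ioo 0 d)) :=
    (Continuous.integrableOn_Icc (hk.1.continuous.comp (by fun_prop))).mono_set Ioo_subset_Icc_self
  have hint : Integrable (fun q : ℝ × ℝ => {q : ℝ × ℝ | q.1 < q.2}.indicator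
      (fun q => k (s, q.2) • g (s, q.1)) q)
      ((volume.restrict (Ioo 0 d)).prod (volume.restrict (Ioo 0 d))) := by
    refine Integrable.indicator ?_ (measurableSet_lt measurable_fst measurable_snd)
    have := hgi.mul_prod (hki.ofReal (𝕜 := ℂ))
    refine this.congr (Filter.Eventually.of_forall fun q => ?_)
    simp [mul_comm]
  calc ∫ u in Ioo 0 d, lineAverage d (0, -1) (fun _ => 1) k (s, u) • g (s, u)
      = ∫ u in Ioo 0 d, ∫ t in Ioo 0 d, {q : ℝ × ℝ | q.1 < q.2}.indicator
          (fun q => k (s, q.2) • g (s, q.1)) (u, t) := by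
        refine setIntegral_congr_fun measurableSet_Ioo fun u hu => ?_
        rw [lineAverage_vertical hk hu, ← integral_smul_const]
        refine integral_congr_ae (Filter.Eventually.of_forall fun t => ?_)
        by_cases h : u < t <;> simp [indicator, h]
    _ = ∫ t in Ioo 0 d, ∫ u in Ioo 0 d, {q : ℝ × ℝ | q.1 < q.2}.indicator
          (fun q => k (s, q.2) • g (s, q.1)) (u, t) := integral_integral_swap hint
    _ = ∫ t in Ioo 0 d, k (s, t) • verticalPrimitive g (s, t) := by
        refine setIntegral_congr_fun measurableSet_Ioo fun t ht => ?_
        simp only [verticalPrimitive]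
        rw [← integral_smul]
        have e : Ioo 0 t = Ioo 0 d ∩ Iio t := by
          ext x; exact ⟨fun h => ⟨⟨h.1, h.2.trans ht.2⟩, h.2⟩, fun h => ⟨h.1.1, h.2⟩⟩
        rw [e, ← setIntegral_indicator measurableSet_Iio]
        rfl

/-- Two functions in `L²` of an open set with the same integrals against test functions agree. -/
theorem ae_eq_of_forall_isTestFunction {U : Set (ℝ × ℝ)} (hU : IsOpen U) {f g : ℝ × ℝ → ℂ}
    (hf : MemLp f 2 (volume.restrict U)) (hg : MemLp g 2 (volume.restrict U))
    (h : ∀ k, IsTestFunction U k → ∫ p in U, k p • f p = ∫ p in U, k p • g p) :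
    f =ᵐ[volume.restrict U] g := by
  have hl : LocallyIntegrableOn (fun p => f p - g p) U volume :=
    locallyIntegrableOn_of_locallyIntegrable_restrict ((hf.sub hg).locallyIntegrable (by norm_num))
  have key := hU.ae_eq_zero_of_integral_contDiff_smul_eq_zero hl (fun φ h1 h2 h3 => by
    have e : ∫ p in U, φ p • (f p - g p) = 0 := by
      simp only [smul_sub]
      rw [integral_sub (integrable_continuous_smul h1.continuous h2 hf)
        (integrable_continuous_smul h1.continuous h2 hg), h φ ⟨h1, h2, h3⟩, sub_self]
    rw [← e]
    refine (setIntegral_eq_integral_of_forall_compl_eq_zero fun p hp => ?_).symm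
    rw [image_eq_zero_of_notMem_tsupport (fun h => hp (h3 h)), zero_smul])
  rw [Filter.EventuallyEq, ae_restrict_iff' hU.measurableSet]
  filter_upwards [key] with p hp hpU
  exact sub_eq_zero.mp (hp hpU)

/-- `g` is the derivative `∂f/∂u` of a function `f` on the strip with trace zero on `ℝ × {0}`:
Green's formula holds without boundary term for test functions that vanish near `u ≥ d`. -/
def HasDirichletDeriv (d : ℝ) (f g : ℝ × ℝ → ℂ) : Prop :=
  ∀ φ : ℝ × ℝ → ℝ, IsTestFunction {p | p.2 < d} φ →
    ∫ p in straightStrip d, fderiv ℝ φ p (0, 1) • f p = -∫ p in straightStrip d, φ p • g p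

/-- Green's formula is tested with `φ(s, u) = ∫_u^d k(s, t) dt`, which satisfies `∂φ/∂u = -k` in the
strip. Such a `φ` need not vanish at `u = 0`, so it is exactly the Dirichlet condition that admits
it. The outcome `∫ k f = ∫ φ g` is the weak form of the assertion. -/
theorem HasDirichletDeriv.ae_eq_verticalPrimitive {d : ℝ} (hd : 0 < d) {f g : ℝ × ℝ → ℂ}
    (hf : MemLp f 2 (volume.restrict (straightStrip d)))
    (hg : MemLp g 2 (volume.restrict (straightStrip d))) (h : HasDirichletDeriv d f g) :
    f =ᵐ[volume.restrict (straightStrip d)] verticalPrimitive g := by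
  refine ae_eq_of_forall_isTestFunction (isOpen_straightStrip d) hf (hg.verticalPrimitive hd)
    fun k hk => ?_
  rw [← setIntegral_lineAverage_vertical hd hk hg]
  have hφ : IsTestFunction {p | p.2 < d} (lineAverage d (0, -1) (fun _ => 1) k) :=
    isTestFunction_lineAverage continuous_const (l := -ContinuousLinearMap.snd ℝ ℝ ℝ) (by simp) hk
      fun q hq t ht => by
        have := hq.2.2
        have := ht.1
        simp only [mem_ofPred_eq, Prod.snd_add, Prod.smul_snd, smul_eq_mul]
        linarith
  have := h _ hφ
  rw [← neg_inj, ← this, ← integral_neg]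
  refine setIntegral_congr_fun (isOpen_straightStrip d).measurableSet fun p hp => ?_
  have e1 : ((0, 1) : ℝ × ℝ) = -(0, -1) := by simp
  have e2 : k (p - d • (0, -1)) = 0 := image_eq_zero_of_notMem_tsupport fun hmem => by
    have h1 := (hk.2.2 hmem).2.2
    have h2 := hp.2.1
    simp only [Prod.snd_sub, Prod.smul_snd, smul_eq_mul] at h1
    linarith
  rw [e1, map_neg, fderiv_lineAverage_one hd.le hk.1 hk.2.1, e2, sub_zero, neg_smul]

/-! ### Averages along the strip -/

/-- The weighted average of `g` along the segment from `p` to `p + (a, 0)`. -/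
noncomputable def horizontalAverage (a : ℝ) (w : ℝ → ℝ) (g : ℝ × ℝ → ℂ) (p : ℝ × ℝ) : ℂ :=
  ∫ t in Ioc 0 a, w t • g (p + t • (1, 0))

theorem measurePreserving_add_horizontal (d t : ℝ) :
    MeasurePreserving (fun p : ℝ × ℝ => p + t • ((1, 0) : ℝ × ℝ))
      (volume.restrict (straightStrip d)) (volume.restrict (straightStrip d)) := by
  have h1 : MeasurePreserving (fun p : ℝ × ℝ => p + t • ((1, 0) : ℝ × ℝ)) volume volume :=
    measurePreserving_add_right _ _
  have := h1.restrict_preimage (isOpen_straightStrip d).measurableSet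
  convert this using 2
  ext p
  simp [straightStrip]

/-- Translations along the strip preserve its measure, hence so does the shear. It transfers
measurability, almost everywhere identities and integrals from `g(p)` to `g(p + t(1, 0))` jointly in
`t` and `p`. -/
theorem measurePreserving_shear (d a : ℝ) :
    MeasurePreserving (fun q : ℝ × (ℝ × ℝ) => (q.1, q.2 + q.1 • ((1, 0) : ℝ × ℝ)))
      ((volume.restrict (Ioc 0 a)).prod (volume.restrict (straightStrip d)))
      ((volume.restrict (Ioc 0 a)).prod (volume.restrict (straightStrip d))) :=
  (MeasurePreserving.id _).skew_product (g := fun t p => p + t • ((1, 0) : ℝ × ℝ))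
    (by simp only [Function.uncurry_def]; fun_prop)
    (Filter.Eventually.of_forall fun t => (measurePreserving_add_horizontal d t).map_eq)

theorem aestronglyMeasurable_shear {d a : ℝ} {g : ℝ × ℝ → ℂ}
    (hg : AEStronglyMeasurable g (volume.restrict (straightStrip d))) :
    AEStronglyMeasurable (fun q : ℝ × (ℝ × ℝ) => g (q.2 + q.1 • ((1, 0) : ℝ × ℝ)))
      ((volume.restrict (Ioc 0 a)).prod (volume.restrict (straightStrip d))) :=
  hg.comp_snd.comp_measurePreserving (measurePreserving_shear d a)

theorem aestronglyMeasurable_horizontalAverage {d a : ℝ} {w : ℝ → ℝ} (hw : Continuous w)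
    {g : ℝ × ℝ → ℂ} (hg : AEStronglyMeasurable g (volume.restrict (straightStrip d))) :
    AEStronglyMeasurable (horizontalAverage a w g) (volume.restrict (straightStrip d)) := by
  have h1 : AEStronglyMeasurable (fun q : ℝ × (ℝ × ℝ) => w q.1 • g (q.2 + q.1 • ((1, 0) : ℝ × ℝ)))
      ((volume.restrict (Ioc 0 a)).prod (volume.restrict (straightStrip d))) :=
    AEStronglyMeasurable.smul (hw.comp continuous_fst).aestronglyMeasurable
      (aestronglyMeasurable_shear hg)
  exact h1.prod_swap.integral_prod_right'

theorem horizontalAverage_congr {d a : ℝ} {w : ℝ → ℝ} {g g' : ℝ × ℝ → ℂ}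
    (h : g =ᵐ[volume.restrict (straightStrip d)] g') :
    horizontalAverage a w g =ᵐ[volume.restrict (straightStrip d)] horizontalAverage a w g' := by
  have h1 : ∀ᵐ q ∂((volume.restrict (Ioc 0 a)).prod (volume.restrict (straightStrip d))),
      g q.2 = g' q.2 := Measure.quasiMeasurePreserving_snd.ae h
  have h2 := (measurePreserving_shear d a).quasiMeasurePreserving.ae h1
  have h3 := Measure.ae_ae_of_ae_prod (Measure.measurePreserving_swap.quasiMeasurePreserving.ae h2)
  filter_upwards [h3] with p hp
  refine integral_congr_ae ?_
  filter_upwards [hp] with t ht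
  simp only [Prod.fst_swap, Prod.snd_swap] at ht
  rw [ht]

/-- Cauchy–Schwarz in `t`, followed by Tonelli and the invariance of the measure under translations
along the strip. -/
theorem lintegral_horizontalAverage_sq_le {d a M : ℝ} (ha : 0 < a) {w : ℝ → ℝ}
    (hw : ∀ t ∈ Ioc 0 a, |w t| ≤ M) {g : ℝ × ℝ → ℂ}
    (hg : AEStronglyMeasurable g (volume.restrict (straightStrip d))) :
    ∫⁻ p in straightStrip d, ‖horizontalAverage a w g p‖ₑ ^ 2 ≤
      ENNReal.ofReal (a * M) ^ 2 * ∫⁻ p in straightStrip d, ‖g p‖ₑ ^ 2 := by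
  wlog h : StronglyMeasurable g generalizing g
  · have := this hg.stronglyMeasurable_mk.aestronglyMeasurable hg.stronglyMeasurable_mk
    rwa [lintegral_enorm_sq_congr (horizontalAverage_congr hg.ae_eq_mk),
      lintegral_enorm_sq_congr hg.ae_eq_mk]
  set m := ENNReal.ofReal M
  have hgm : Measurable fun q : ℝ × (ℝ × ℝ) => ‖g (q.2 + q.1 • ((1, 0) : ℝ × ℝ))‖ₑ ^ 2 :=
    (h.enorm.comp (by fun_prop)).pow_const 2
  have step : ∀ p, ‖horizontalAverage a w g p‖ₑ ^ 2 ≤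
      ENNReal.ofReal a * m ^ 2 * ∫⁻ t in Ioc 0 a, ‖g (p + t • ((1, 0) : ℝ × ℝ))‖ₑ ^ 2 := fun p => by
    have h1 : ‖horizontalAverage a w g p‖ₑ ≤
        ∫⁻ t in Ioc 0 a, m * ‖g (p + t • ((1, 0) : ℝ × ℝ))‖ₑ := by
      refine (enorm_integral_le_lintegral_enorm _).trans ?_
      refine setLIntegral_mono' measurableSet_Ioc fun t ht => ?_
      rw [enorm_smul]
      gcongr
      rw [Real.enorm_eq_ofReal_abs]
      exact ENNReal.ofReal_le_ofReal (hw t ht)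
    refine (pow_le_pow_left' h1 2).trans ((lintegral_mul_sq_le _ aemeasurable_const
      (h.enorm.comp (by fun_prop)).aemeasurable).trans_eq ?_)
    rw [setLIntegral_const, Real.volume_Ioc, sub_zero, mul_comm (m ^ 2)]
    rfl
  calc ∫⁻ p in straightStrip d, ‖horizontalAverage a w g p‖ₑ ^ 2
      ≤ ∫⁻ p in straightStrip d, ENNReal.ofReal a * m ^ 2 *
          ∫⁻ t in Ioc 0 a, ‖g (p + t • ((1, 0) : ℝ × ℝ))‖ₑ ^ 2 := lintegral_mono step
    _ = ENNReal.ofReal a * m ^ 2 * ∫⁻ t in Ioc 0 a, ∫⁻ p in straightStrip d,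
          ‖g (p + t • ((1, 0) : ℝ × ℝ))‖ₑ ^ 2 := by
        rw [lintegral_const_mul' _ _ (by finiteness), lintegral_lintegral_swap]
        exact (hgm.comp measurable_swap).aemeasurable
    _ = ENNReal.ofReal a * m ^ 2 * ∫⁻ _ in Ioc 0 a, ∫⁻ p in straightStrip d, ‖g p‖ₑ ^ 2 := by
        congr 1
        refine lintegral_congr fun t => ?_
        exact (measurePreserving_add_horizontal d t).lintegral_comp (h.enorm.pow_const 2)
    _ = _ := by
        rw [setLIntegral_const, Real.volume_Ioc, sub_zero, ENNReal.ofReal_mul ha.le, mul_pow]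
        ring

theorem MeasureTheory.MemLp.horizontalAverage {d a : ℝ} (ha : 0 < a) {w : ℝ → ℝ}
    (hw : Continuous w) {g : ℝ × ℝ → ℂ} (hg : MemLp g 2 (volume.restrict (straightStrip d))) :
    MemLp (horizontalAverage a w g) 2 (volume.restrict (straightStrip d)) := by
  obtain ⟨M, hM⟩ := (isCompact_Icc (a := 0) (b := a)).exists_bound_of_continuousOn hw.continuousOn
  rw [memLp_two_iff_lintegral_lt_top (aestronglyMeasurable_horizontalAverage hw hg.1)]
  refine (lintegral_horizontalAverage_sq_le ha (M := M)
    (fun t ht => hM t (Ioc_subset_Icc_self ht)) hg.1).trans_lt ?_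
  exact ENNReal.mul_lt_top (by finiteness) ((memLp_two_iff_lintegral_lt_top hg.1).1 hg)

/-- The shear moves the translation from the test function to `g`, which makes backward and forward
averaging transposes of each other. -/
theorem setIntegral_lineAverage_horizontal {d a : ℝ} {w : ℝ → ℝ} (hw : Continuous w)
    {k : ℝ × ℝ → ℝ} (hk : IsTestFunction (straightStrip d) k) {g : ℝ × ℝ → ℂ}
    (hg : MemLp g 2 (volume.restrict (straightStrip d))) :
    ∫ p in straightStrip d, lineAverage a (1, 0) w k p • g p =
      ∫ p in straightStrip d, k p • horizontalAverage a w g p := by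
  obtain ⟨M, hM⟩ := (isCompact_Icc (a := 0) (b := a)).exists_bound_of_continuousOn hw.continuousOn
  obtain ⟨N, hN⟩ := hk.1.continuous.bounded_above_of_compact_support hk.2.1
  set e : ℝ × ℝ := (1, 0)
  set C : Set (ℝ × ℝ) := (fun x : ℝ × (ℝ × ℝ) => x.2 + x.1 • e) '' (Icc 0 a ×ˢ tsupport k)
  have hC : IsCompact C := (isCompact_Icc.prod hk.2.1).image (by fun_prop)
  set τ := volume.restrict (Ioc 0 a)
  set lam := volume.restrict (straightStrip d)
  set G : ℝ × (ℝ × ℝ) → ℂ := fun q => (w q.1 * k (q.2 - q.1 • e)) • g q.2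
  have hkc := hk.1.continuous
  have hG : Integrable G (τ.prod lam) := by
    -- On the infinite strip `g` need only be square integrable. The integrand vanishes unless the
    -- point lies in the compact set `C` swept out by the support of `k`, and on `C` the function
    -- `g` is integrable.
    have hb : Integrable (fun q : ℝ × (ℝ × ℝ) => (1 : ℝ) * ‖C.indicator g q.2‖) (τ.prod lam) := by
      have h1 : Integrable (C.indicator g) lam := by
        rw [integrable_indicator_iff hC.measurableSet]
        exact (hg.locallyIntegrable (by norm_num)).integrableOn_isCompact hC
      have h2 : Integrable (fun _ : ℝ => (1 : ℝ)) τ := integrable_const _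
      exact h2.mul_prod h1.norm
    refine (hb.const_mul (M * N)).mono' ?_ ?_
    · have hcont : Continuous fun q : ℝ × (ℝ × ℝ) => w q.1 * k (q.2 - q.1 • e) := by fun_prop
      exact AEStronglyMeasurable.smul hcont.aestronglyMeasurable hg.1.comp_snd
    · have : ∀ᵐ q ∂(τ.prod lam), q.1 ∈ Ioc 0 a :=
        Measure.quasiMeasurePreserving_fst.ae (ae_restrict_mem measurableSet_Ioc)
      filter_upwards [this] with q hq
      rw [one_mul, norm_smul, norm_mul]
      by_cases hqC : q.2 ∈ C
      · rw [indicator_of_mem hqC]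
        have h1 := hM q.1 (Ioc_subset_Icc_self hq)
        gcongr
        · exact (norm_nonneg _).trans h1
        · exact hN _
      · have : k (q.2 - q.1 • e) = 0 := image_eq_zero_of_notMem_tsupport fun hmem =>
          hqC ⟨(q.1, q.2 - q.1 • e), ⟨Ioc_subset_Icc_self hq, hmem⟩, by simp⟩
        rw [this, indicator_of_notMem hqC]
        simp
  have hmp := measurePreserving_shear d a
  have hG' := hmp.integrable_comp_of_integrable hG
  have eG : ∀ t p, G (t, p + t • e) = k p • (w t • g (p + t • e)) := fun t p => by
    simp only [G, add_sub_cancel_right, smul_smul, mul_comm]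
  calc ∫ p, lineAverage a e w k p • g p ∂lam
      = ∫ p, ∫ t, G (t, p) ∂τ ∂lam := by
        refine integral_congr_ae (Filter.Eventually.of_forall fun p => ?_)
        simp only [lineAverage, G]
        rw [integral_smul_const]
    _ = ∫ q, G q ∂(τ.prod lam) := (integral_prod_symm _ hG).symm
    _ = ∫ q : ℝ × (ℝ × ℝ), G (q.1, q.2 + q.1 • e) ∂(τ.prod lam) := by
        have h1 : AEStronglyMeasurable G
            ((τ.prod lam).map fun q : ℝ × (ℝ × ℝ) => (q.1, q.2 + q.1 • e)) := by
          rw [hmp.map_eq]; exact hG.1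
        have := integral_map hmp.measurable.aemeasurable h1
        rwa [hmp.map_eq] at this
    _ = ∫ p, ∫ t, G (t, p + t • e) ∂τ ∂lam := integral_prod_symm _ hG'
    _ = ∫ p, k p • horizontalAverage a w g p ∂lam := by
        refine integral_congr_ae (Filter.Eventually.of_forall fun p => ?_)
        simp only [eG, horizontalAverage]
        rw [integral_smul]

/-- The transpose of `fderiv_lineAverage_linear`. Its right side has `L²` norm at most `a` times
that of the longitudinal derivative, so averaging over short segments changes `f` little, uniformly
on bounded sets of the form domain. -/
theorem HasL2WeakDeriv.ae_eq_horizontalAverage {d a : ℝ} (ha : 0 < a) {f g : ℝ × ℝ → ℂ}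
    (hf : MemLp f 2 (volume.restrict (straightStrip d)))
    (h : HasL2WeakDeriv (straightStrip d) (1, 0) f g) :
    f - horizontalAverage a (fun _ => 1 / a) f =ᵐ[volume.restrict (straightStrip d)]
      -horizontalAverage a (fun t => 1 - t / a) g := by
  have m1 := hf.horizontalAverage ha (w := fun _ => 1 / a) continuous_const
  have m2 := h.1.horizontalAverage ha (w := fun t => 1 - t / a) (by fun_prop)
  refine ae_eq_of_forall_isTestFunction (isOpen_straightStrip d) (hf.sub m1) m2.neg
    fun k hk => ?_
  have hS : ∀ q ∈ straightStrip d, ∀ t ∈ Icc 0 a, q + t • ((1, 0) : ℝ × ℝ) ∈ straightStrip d :=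
    fun q hq t _ => ⟨mem_univ _, by simpa using hq.2⟩
  have hφ := isTestFunction_lineAverage (w := fun t => 1 - t / a) (by fun_prop)
    (l := ContinuousLinearMap.fst ℝ ℝ ℝ) (by simp) hk hS
  have hψ := isTestFunction_lineAverage (w := fun _ => 1 / a) continuous_const
    (l := ContinuousLinearMap.fst ℝ ℝ ℝ) (by simp) hk hS
  have key := h.2 _ hφ
  simp only [fderiv_lineAverage_linear ha hk.1 hk.2.1, sub_smul] at key
  rw [integral_sub (integrable_continuous_smul hk.1.continuous hk.2.1 hf)
    (integrable_continuous_smul hψ.1.continuous hψ.2.1 hf),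
    setIntegral_lineAverage_horizontal continuous_const hk hf,
    setIntegral_lineAverage_horizontal (by fun_prop) hk h.1] at key
  simp only [Pi.sub_apply, Pi.neg_apply, smul_sub, smul_neg]
  rw [integral_sub (integrable_continuous_smul hk.1.continuous hk.2.1 hf)
    (integrable_continuous_smul hk.1.continuous hk.2.1 m1), integral_neg, key]

/-! ### Bounded weights -/

/-- A measurable weight with values in `[a, b]`, where `a > 0`. -/
structure IsBoundedWeight {α : Type*} [MeasurableSpace α] (lam : Measure α) (w : α → ℝ)
    (a b : ℝ) : Prop where
  measurable : Measurable w
  pos : 0 < a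
  bounds : ∀ᵐ x ∂lam, a ≤ w x ∧ w x ≤ b

namespace IsBoundedWeight

variable {α : Type*} [MeasurableSpace α] {lam : Measure α} {w : α → ℝ} {a b : ℝ}

theorem lintegral_eq (h : IsBoundedWeight lam w a b) (F : α → ℝ≥0∞) :
    ∫⁻ x, F x ∂(lam.withDensity fun x => ENNReal.ofReal (w x)) =
      ∫⁻ x, ENNReal.ofReal (w x) * F x ∂lam :=
  lintegral_withDensity_eq_lintegral_mul_non_measurable _ h.measurable.ennreal_ofReal
    (Filter.Eventually.of_forall fun _ => ENNReal.ofReal_lt_top) _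

theorem lintegral_le (h : IsBoundedWeight lam w a b) (F : α → ℝ≥0∞) :
    ∫⁻ x, F x ∂(lam.withDensity fun x => ENNReal.ofReal (w x)) ≤
      ENNReal.ofReal b * ∫⁻ x, F x ∂lam := by
  rw [h.lintegral_eq, ← lintegral_const_mul' _ _ ENNReal.ofReal_ne_top]
  refine lintegral_mono_ae ?_
  filter_upwards [h.bounds] with x hx
  gcongr
  exact hx.2

theorem le_lintegral (h : IsBoundedWeight lam w a b) (F : α → ℝ≥0∞) :
    ENNReal.ofReal a * ∫⁻ x, F x ∂lam ≤
      ∫⁻ x, F x ∂(lam.withDensity fun x => ENNReal.ofReal (w x)) := by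
  rw [h.lintegral_eq, ← lintegral_const_mul' _ _ ENNReal.ofReal_ne_top]
  refine lintegral_mono_ae ?_
  filter_upwards [h.bounds] with x hx
  gcongr
  exact hx.1

theorem absolutelyContinuous (h : IsBoundedWeight lam w a b) :
    lam ≪ lam.withDensity fun x => ENNReal.ofReal (w x) := by
  refine withDensity_absolutelyContinuous' h.measurable.ennreal_ofReal.aemeasurable ?_
  filter_upwards [h.bounds] with x hx
  simpa using h.pos.trans_le hx.1

theorem memLp_iff (h : IsBoundedWeight lam w a b) {f : α → ℂ} :
    MemLp f 2 (lam.withDensity fun x => ENNReal.ofReal (w x)) ↔ MemLp f 2 lam := by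
  constructor
  · intro hf
    have hm := hf.1.mono_ac h.absolutelyContinuous
    rw [memLp_two_iff_lintegral_lt_top hm]
    have h1 := (memLp_two_iff_lintegral_lt_top hf.1).1 hf
    by_contra hc
    rw [not_lt, top_le_iff] at hc
    have := h.le_lintegral fun x => ‖f x‖ₑ ^ 2
    rw [hc, ENNReal.mul_top (by simpa using h.pos)] at this
    exact absurd h1 (not_lt.2 this)
  · intro hf
    have hm := hf.1.mono_ac (withDensity_absolutelyContinuous lam fun x => ENNReal.ofReal (w x))
    rw [memLp_two_iff_lintegral_lt_top hm]
    exact (h.lintegral_le _).trans_lt (ENNReal.mul_lt_top ENNReal.ofReal_lt_top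
      ((memLp_two_iff_lintegral_lt_top hf.1).1 hf))

theorem memLp (h : IsBoundedWeight lam w a b)
    (f : Lp ℂ 2 (lam.withDensity fun x => ENNReal.ofReal (w x))) : MemLp f 2 lam :=
  h.memLp_iff.1 (Lp.memLp f)

theorem integral_eq (h : IsBoundedWeight lam w a b) (f : α → ℂ) :
    ∫ x, f x ∂(lam.withDensity fun x => ENNReal.ofReal (w x)) = ∫ x, w x • f x ∂lam := by
  rw [integral_withDensity_eq_integral_toReal_smul₀ h.measurable.ennreal_ofReal.aemeasurable
    (Filter.Eventually.of_forall fun _ => ENNReal.ofReal_lt_top)]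
  refine integral_congr_ae ?_
  filter_upwards [h.bounds] with x hx
  rw [ENNReal.toReal_ofReal (h.pos.le.trans hx.1)]

theorem inner_eq (h : IsBoundedWeight lam w a b)
    (f g : Lp ℂ 2 (lam.withDensity fun x => ENNReal.ofReal (w x))) :
    inner ℂ f g = ∫ x, (w x : ℂ) * conj (f x) * g x ∂lam := by
  rw [L2.inner_def, h.integral_eq]
  refine integral_congr_ae (Filter.Eventually.of_forall fun x => ?_)
  simp only [RCLike.inner_apply, Complex.real_smul]
  ring

/-- Integration against a square integrable function is a continuous functional on a weighted
`L²` space. -/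
theorem exists_pairing (h : IsBoundedWeight lam w a b) {φ : α → ℝ} (hφ : MemLp φ 2 lam) :
    ∃ l : Lp ℂ 2 (lam.withDensity fun x => ENNReal.ofReal (w x)) →L[ℂ] ℂ,
      ∀ f, l f = ∫ x, φ x • f x ∂lam := by
  have h1 : MemLp (fun x => ((φ x / w x : ℝ) : ℂ)) 2 lam := by
    have hm : AEStronglyMeasurable (fun x => φ x / w x) lam :=
      (hφ.1.aemeasurable.div h.measurable.aemeasurable).aestronglyMeasurable
    refine (hφ.of_le_mul (c := a⁻¹) hm ?_).ofReal
    filter_upwards [h.bounds] with x hx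
    rw [norm_div, div_eq_inv_mul, Real.norm_of_nonneg (h.pos.le.trans hx.1)]
    have := inv_anti₀ h.pos hx.1
    gcongr
  have h2 := h.memLp_iff.2 h1
  refine ⟨innerSL ℂ h2.toLp, fun f => ?_⟩
  rw [innerSL_apply_apply, h.inner_eq]
  refine integral_congr_ae ?_
  filter_upwards [h.absolutelyContinuous.ae_eq h2.coeFn_toLp, h.bounds] with x hx hb
  have : w x ≠ 0 := (h.pos.trans_le hb.1).ne'
  rw [hx, Complex.conj_ofReal, Complex.real_smul, ← Complex.ofReal_mul, mul_div_cancel₀ _ this]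

end IsBoundedWeight

/-! ### The form domain as a Hilbert space -/

namespace CurvedStrip

variable (W : CurvedStrip)

/-- The measure `(1 - u γ(s))⁻¹ ds du` on `ℝ × (0, d)`. -/
noncomputable def inverseMeasure : Measure (ℝ × ℝ) :=
  (volume.restrict (straightStrip W.d)).withDensity fun p => ENNReal.ofReal (1 / W.density p)

theorem exists_isBoundedWeight_density : ∃ a b : ℝ,
    IsBoundedWeight (volume.restrict (straightStrip W.d)) W.density a b := by
  obtain ⟨c, C, hc, h⟩ := W.exists_density_bounds
  refine ⟨c, C, W.continuous_density.measurable, hc, ?_⟩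
  filter_upwards [ae_mem_straightStrip W.d] with p hp
  exact h p hp

theorem exists_isBoundedWeight_inv_density : ∃ a b : ℝ,
    IsBoundedWeight (volume.restrict (straightStrip W.d)) (fun p => 1 / W.density p) a b := by
  obtain ⟨c, C, hc, h⟩ := W.exists_density_bounds
  -- Any point of the strip would do; it only serves to show that the upper bound `C` is positive.
  have hmem : ((0, W.d / 2) : ℝ × ℝ) ∈ straightStrip W.d :=
    ⟨mem_univ _, by simpa using W.d_pos, by simpa using W.d_pos⟩
  have hC : 0 < C := (W.density_pos hmem).trans_le (h _ hmem).2
  refine ⟨1 / C, 1 / c, W.continuous_density.measurable.const_div 1, by positivity, ?_⟩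
  filter_upwards [ae_mem_straightStrip W.d] with p hp
  exact ⟨one_div_le_one_div_of_le (W.density_pos hp) (h p hp).2,
    one_div_le_one_div_of_le hc (h p hp).1⟩

/-- Triples `(f, f₁, f₂)` of square integrable functions. -/
abbrev FormAmbient : Type :=
  WithLp 2 (W.HilbertSpace × WithLp 2 (Lp ℂ 2 W.inverseMeasure × W.HilbertSpace))

variable {W} in
theorem memLp_coe (f : W.HilbertSpace) : MemLp f 2 (volume.restrict (straightStrip W.d)) := by
  obtain ⟨a, b, h⟩ := W.exists_isBoundedWeight_density
  exact h.memLp f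

variable {W} in
theorem memLp_coe_inverse (f : Lp ℂ 2 W.inverseMeasure) :
    MemLp f 2 (volume.restrict (straightStrip W.d)) := by
  obtain ⟨a, b, h⟩ := W.exists_isBoundedWeight_inv_density
  exact h.memLp f

theorem exists_pairing {φ : ℝ × ℝ → ℝ} (hφ : Continuous φ) (hc : HasCompactSupport φ) :
    ∃ l : W.HilbertSpace →L[ℂ] ℂ, ∀ f, l f = ∫ p in straightStrip W.d, φ p • f p := by
  obtain ⟨a, b, h⟩ := W.exists_isBoundedWeight_density
  exact h.exists_pairing (hφ.memLp_of_hasCompactSupport hc)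

theorem exists_pairing_inverse {φ : ℝ × ℝ → ℝ} (hφ : Continuous φ) (hc : HasCompactSupport φ) :
    ∃ l : Lp ℂ 2 W.inverseMeasure →L[ℂ] ℂ, ∀ f, l f = ∫ p in straightStrip W.d, φ p • f p := by
  obtain ⟨a, b, h⟩ := W.exists_isBoundedWeight_inv_density
  exact h.exists_pairing (hφ.memLp_of_hasCompactSupport hc)

/-- For a fixed test function the identity that defines the weak derivative says that a continuous
functional vanishes on the triple. The form domain thus becomes an intersection of kernels, hence
closed and complete. -/
theorem exists_longitudinal_functional {φ : ℝ × ℝ → ℝ} (hφ : IsTestFunction (straightStrip W.d) φ) :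
    ∃ l : W.FormAmbient →L[ℂ] ℂ, ∀ v, l v =
      (∫ p in straightStrip W.d, fderiv ℝ φ p (1, 0) • v.fst p) +
        ∫ p in straightStrip W.d, φ p • v.snd.fst p := by
  obtain ⟨l₁, h₁⟩ := W.exists_pairing (hφ.continuous_fderiv_apply (1, 0))
    (hφ.hasCompactSupport_fderiv_apply _)
  obtain ⟨l₂, h₂⟩ := W.exists_pairing_inverse hφ.1.continuous hφ.2.1
  refine ⟨l₁ ∘L WithLp.fstL 2 ℂ _ _ + l₂ ∘L WithLp.fstL 2 ℂ _ _ ∘L WithLp.sndL 2 ℂ _ _,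
    fun v => ?_⟩
  rw [← h₁, ← h₂]
  rfl

/-- The test functions are those that need not vanish at `u = 0`. Their identities encode the
transversal derivative and the zero trace together, and both survive limits. -/
theorem exists_transversal_functional {φ : ℝ × ℝ → ℝ} (hφ : IsTestFunction {p | p.2 < W.d} φ) :
    ∃ l : W.FormAmbient →L[ℂ] ℂ, ∀ v, l v =
      (∫ p in straightStrip W.d, fderiv ℝ φ p (0, 1) • v.fst p) +
        ∫ p in straightStrip W.d, φ p • v.snd.snd p := by
  obtain ⟨l₁, h₁⟩ := W.exists_pairing (hφ.continuous_fderiv_apply (0, 1))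
    (hφ.hasCompactSupport_fderiv_apply _)
  obtain ⟨l₂, h₂⟩ := W.exists_pairing hφ.1.continuous hφ.2.1
  refine ⟨l₁ ∘L WithLp.fstL 2 ℂ _ _ + l₂ ∘L WithLp.sndL 2 ℂ _ _ ∘L WithLp.sndL 2 ℂ _ _,
    fun v => ?_⟩
  rw [← h₁, ← h₂]
  rfl

/-- The triples `(f, ∂f/∂s, ∂f/∂u)` with `f` in the form domain. -/
noncomputable def formSpace : Submodule ℂ W.FormAmbient :=
  (⨅ φ : {φ // IsTestFunction (straightStrip W.d) φ},
      (W.exists_longitudinal_functional φ.2).choose.ker) ⊓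
    ⨅ φ : {φ // IsTestFunction {p : ℝ × ℝ | p.2 < W.d} φ},
      (W.exists_transversal_functional φ.2).choose.ker

theorem isClosed_formSpace : IsClosed (W.formSpace : Set W.FormAmbient) := by
  rw [formSpace, Submodule.coe_inf, Submodule.coe_iInf, Submodule.coe_iInf]
  exact (isClosed_iInter fun φ => ContinuousLinearMap.isClosed_ker _).inter
    (isClosed_iInter fun φ => ContinuousLinearMap.isClosed_ker _)

instance : CompleteSpace W.formSpace := W.isClosed_formSpace.completeSpace_coe

theorem mem_formSpace {v : W.FormAmbient} : v ∈ W.formSpace ↔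
    HasL2WeakDeriv (straightStrip W.d) (1, 0) v.fst v.snd.fst ∧
      HasDirichletDeriv W.d v.fst v.snd.snd := by
  rw [formSpace, Submodule.mem_inf, Submodule.mem_iInf, Submodule.mem_iInf, HasL2WeakDeriv,
    and_iff_right (memLp_coe_inverse _), HasDirichletDeriv]
  refine and_congr ⟨fun h φ hφ => ?_, fun h φ => ?_⟩ ⟨fun h φ hφ => ?_, fun h φ => ?_⟩
  · have := h ⟨φ, hφ⟩
    rw [LinearMap.mem_ker] at this
    exact eq_neg_of_add_eq_zero_left
      (((W.exists_longitudinal_functional hφ).choose_spec v).symm.trans this)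
  · rw [LinearMap.mem_ker]
    refine ((W.exists_longitudinal_functional φ.2).choose_spec v).trans ?_
    rw [h φ.1 φ.2, neg_add_cancel]
  · have := h ⟨φ, hφ⟩
    rw [LinearMap.mem_ker] at this
    exact eq_neg_of_add_eq_zero_left
      (((W.exists_transversal_functional hφ).choose_spec v).symm.trans this)
  · rw [LinearMap.mem_ker]
    refine ((W.exists_transversal_functional φ.2).choose_spec v).trans ?_
    rw [h φ.1 φ.2, neg_add_cancel]

/-- The embedding of the form domain in the Hilbert space. -/
noncomputable def formEmbedding : W.formSpace →L[ℂ] W.HilbertSpace :=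
  WithLp.fstL 2 ℂ _ _ ∘L W.formSpace.subtypeL

variable {W}

theorem _root_.HasDirichletDeriv.hasL2WeakDeriv {d : ℝ} {f g : ℝ × ℝ → ℂ}
    (hg : MemLp g 2 (volume.restrict (straightStrip d))) (h : HasDirichletDeriv d f g) :
    HasL2WeakDeriv (straightStrip d) (0, 1) f g :=
  ⟨hg, fun φ hφ => h φ ⟨hφ.1, hφ.2.1, hφ.2.2.trans fun _ hp => hp.2.2⟩⟩

theorem memFormDomain_of_hasDirichletDeriv {f f₁ f₂ : ℝ × ℝ → ℂ}
    (hf : MemLp f 2 (volume.restrict (straightStrip W.d)))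
    (h₁ : HasL2WeakDeriv (straightStrip W.d) (1, 0) f f₁)
    (hf₂ : MemLp f₂ 2 (volume.restrict (straightStrip W.d))) (h₂ : HasDirichletDeriv W.d f f₂) :
    W.MemFormDomain f := by
  have h₂' := h₂.hasL2WeakDeriv hf₂
  refine ⟨⟨hf, ⟨_, h₁⟩, _, h₂'⟩, 0, ⟨MemLp.zero, fun φ hφ => ?_⟩,
    Filter.Eventually.of_forall fun _ => rfl⟩
  have hw := (weakDeriv_spec ⟨_, h₂'⟩).ae_unique (isOpen_straightStrip W.d) h₂'
  rw [integral_congr_ae (g := fun p => φ p • f₂ p) (hw.mono fun p hp => by simp only [hp]),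
    h₂ φ hφ]
  simp

theorem MemFormDomain.hasDirichletDeriv {f : ℝ × ℝ → ℂ} (h : W.MemFormDomain f) :
    HasDirichletDeriv W.d f (weakDeriv (straightStrip W.d) (0, 1) f) := by
  obtain ⟨-, τ, ⟨-, ht⟩, hz⟩ := h
  intro φ hφ
  have z : ∫ s, φ (s, 0) • τ s = 0 := integral_eq_zero_of_ae (by
    filter_upwards [hz] with s hs
    simp [hs])
  rw [ht φ hφ, z, sub_zero, neg_neg]

theorem formEmbedding_mem (v : W.formSpace) : W.formEmbedding v ∈ W.formDomain :=
  memFormDomain_of_hasDirichletDeriv (memLp_coe _) (W.mem_formSpace.1 v.2).1 (memLp_coe _)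
    (W.mem_formSpace.1 v.2).2

theorem weakDeriv_longitudinal_ae (v : W.formSpace) :
    weakDeriv (straightStrip W.d) (1, 0) (W.formEmbedding v)
      =ᵐ[volume.restrict (straightStrip W.d)] v.1.snd.fst :=
  have h := (W.mem_formSpace.1 v.2).1
  (weakDeriv_spec ⟨_, h⟩).ae_unique (isOpen_straightStrip W.d) h

theorem weakDeriv_transversal_ae (v : W.formSpace) :
    weakDeriv (straightStrip W.d) (0, 1) (W.formEmbedding v)
      =ᵐ[volume.restrict (straightStrip W.d)] v.1.snd.snd :=
  have h := (W.mem_formSpace.1 v.2).2.hasL2WeakDeriv (memLp_coe _)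
  (weakDeriv_spec ⟨_, h⟩).ae_unique (isOpen_straightStrip W.d) h

/-- A function in the form domain, given with its derivatives, as an element of `formSpace`. -/
theorem exists_formSpace {f f₁ f₂ : ℝ × ℝ → ℂ}
    (hf : MemLp f 2 (volume.restrict (straightStrip W.d)))
    (h₁ : HasL2WeakDeriv (straightStrip W.d) (1, 0) f f₁)
    (hf₂ : MemLp f₂ 2 (volume.restrict (straightStrip W.d))) (h₂ : HasDirichletDeriv W.d f f₂) :
    ∃ v : W.formSpace, W.formEmbedding v =ᵐ[volume.restrict (straightStrip W.d)] f ∧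
      v.1.snd.fst =ᵐ[volume.restrict (straightStrip W.d)] f₁ ∧
      v.1.snd.snd =ᵐ[volume.restrict (straightStrip W.d)] f₂ := by
  obtain ⟨a, b, hw⟩ := W.exists_isBoundedWeight_density
  obtain ⟨a', b', hw'⟩ := W.exists_isBoundedWeight_inv_density
  have m := hw.memLp_iff.2 hf
  have m₁ := hw'.memLp_iff.2 h₁.1
  have m₂ := hw.memLp_iff.2 hf₂
  have e := hw.absolutelyContinuous.ae_eq m.coeFn_toLp
  have e₁ := hw'.absolutelyContinuous.ae_eq m₁.coeFn_toLp
  have e₂ := hw.absolutelyContinuous.ae_eq m₂.coeFn_toLp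
  refine ⟨⟨WithLp.toLp 2 (m.toLp, WithLp.toLp 2 (m₁.toLp, m₂.toLp)), ?_⟩, e, e₁, e₂⟩
  rw [mem_formSpace]
  refine ⟨⟨hw'.memLp _, fun φ hφ => ?_⟩, fun φ hφ => ?_⟩
  · refine Eq.trans ?_ ((h₁.2 φ hφ).trans (congrArg Neg.neg ?_))
    · exact integral_congr_ae (e.mono fun p hp => congrArg (fderiv ℝ φ p (1, 0) • ·) hp)
    · exact integral_congr_ae (e₁.mono fun p hp => congrArg (φ p • ·) hp.symm)
  · refine Eq.trans ?_ ((h₂ φ hφ).trans (congrArg Neg.neg ?_))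
    · exact integral_congr_ae (e.mono fun p hp => congrArg (fderiv ℝ φ p (0, 1) • ·) hp)
    · exact integral_congr_ae (e₂.mono fun p hp => congrArg (φ p • ·) hp.symm)

theorem exists_formEmbedding_eq {f : W.HilbertSpace} (hf : f ∈ W.formDomain) :
    ∃ v, W.formEmbedding v = f := by
  obtain ⟨v, hv, -⟩ := exists_formSpace (W := W) hf.1.1 (weakDeriv_spec hf.1.2.1)
    (weakDeriv_spec hf.1.2.2).1 (MemFormDomain.hasDirichletDeriv hf)
  exact ⟨v, Lp.ext ((withDensity_absolutelyContinuous _ _).ae_eq hv)⟩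

/-- The longitudinal component was given the measure with density `(1 - uγ)⁻¹`, and the other two
the density `1 - uγ`, so that the product inner product reproduces the form. -/
theorem inner_formSpace (v w : W.formSpace) :
    inner ℂ v w = W.q₀ (W.formEmbedding v) (W.formEmbedding w) +
      inner ℂ (W.formEmbedding v) (W.formEmbedding w) := by
  obtain ⟨a, b, hw⟩ := W.exists_isBoundedWeight_density
  obtain ⟨a', b', hw'⟩ := W.exists_isBoundedWeight_inv_density
  have e : inner ℂ v w = inner ℂ (W.formEmbedding v) (W.formEmbedding w) +
      (inner ℂ v.1.snd.fst w.1.snd.fst + inner ℂ v.1.snd.snd w.1.snd.snd) := by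
    rw [Submodule.coe_inner, WithLp.prod_inner_apply, WithLp.prod_inner_apply]
    rfl
  rw [e, add_comm]
  congr 1
  rw [q₀, integral_congr_ae (g := fun p =>
      ((1 / W.density p : ℝ) : ℂ) * conj (v.1.snd.fst p) * w.1.snd.fst p +
      (W.density p : ℂ) * conj (v.1.snd.snd p) * w.1.snd.snd p) ?_]
  · have hi := hw'.inner_eq v.1.snd.fst w.1.snd.fst
    have hj := hw.inner_eq v.1.snd.snd w.1.snd.snd
    obtain ⟨c, C, hc, h⟩ := W.exists_density_bounds
    have hm := W.continuous_density.measurable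
    rw [integral_add]
    · exact congrArg₂ _ hi hj
    · refine W.integrable_weighted_mul (C := 1 / c) (hm.const_div 1) (fun p hp => ?_)
        (memLp_coe_inverse _) (memLp_coe_inverse _)
      rw [abs_of_pos (one_div_pos.2 (W.density_pos hp))]
      exact one_div_le_one_div_of_le hc (h p hp).1
    · refine W.integrable_weighted_mul (C := C) hm (fun p hp => ?_) (memLp_coe _) (memLp_coe _)
      rw [abs_of_pos (W.density_pos hp)]
      exact (h p hp).2
  · filter_upwards [weakDeriv_longitudinal_ae v, weakDeriv_longitudinal_ae w,
      weakDeriv_transversal_ae v, weakDeriv_transversal_ae w] with p h1 h2 h3 h4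
    rw [h1, h2, h3, h4]

variable (W) in
/-- The adjoint of the embedding of the form domain. -/
noncomputable abbrev formAdjoint : W.HilbertSpace →L[ℂ] W.formSpace :=
  ContinuousLinearMap.adjoint (𝕜 := ℂ) (E := W.formSpace) (F := W.HilbertSpace) W.formEmbedding

theorem inner_formAdjoint (v : W.formSpace) (f : W.HilbertSpace) :
    inner ℂ v (W.formAdjoint f) = inner ℂ (W.formEmbedding v) f :=
  ContinuousLinearMap.adjoint_inner_right (𝕜 := ℂ) (E := W.formSpace) (F := W.HilbertSpace) _ _ _

/-- Adding `⟨g, f⟩` to both sides, `q₀(g, f) = ⟨g, h⟩` becomes `⟨w, v⟩ = ⟨J w, f + h⟩` in the form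
space, with `f = J v` and `g = J w`. For all `w` this means `v = J* (f + h)`. In other words `(L +
1)⁻¹ = J J*`. -/
theorem mem_hamiltonian_graph_iff (f h : W.HilbertSpace) : (f, h) ∈ W.hamiltonian.graph ↔
    W.formEmbedding (W.formAdjoint (f + h)) = f := by
  rw [hamiltonian_graph]
  constructor
  · rintro ⟨hf, hq⟩
    obtain ⟨v, hv⟩ := exists_formEmbedding_eq hf
    have : W.formAdjoint (f + h) = v := by
      refine ext_inner_left ℂ fun w => ?_
      rw [inner_formAdjoint, inner_formSpace, hv, inner_add_right, add_comm]
      rw [← hq _ (formEmbedding_mem w)]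
    rw [this, hv]
  · intro hf
    set v := W.formAdjoint (f + h) with hv
    refine ⟨hf ▸ formEmbedding_mem v, fun g hg => ?_⟩
    obtain ⟨w, rfl⟩ := exists_formEmbedding_eq hg
    have h1 := inner_formSpace w v
    rw [hv, inner_formAdjoint, ← hv, hf, inner_add_right, add_comm] at h1
    exact (add_right_cancel h1).symm

end CurvedStrip

/-! ### Bounds for the embedding of the form domain -/

/-! ### Cutoffs and changes of weight in `L²`. -/

section LpOperators

variable {α : Type*} [MeasurableSpace α] {μ : Measure α}

theorem norm_sq_le_of_lintegral_le {β : Type*} [MeasurableSpace β] {ν : Measure β}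
    {f : Lp ℂ 2 μ} {g : Lp ℂ 2 ν} {C : ℝ} (hC : 0 ≤ C)
    (h : ∫⁻ x, ‖f x‖ₑ ^ 2 ∂μ ≤ ENNReal.ofReal C * ∫⁻ x, ‖g x‖ₑ ^ 2 ∂ν) :
    ‖f‖ ^ 2 ≤ C * ‖g‖ ^ 2 := by
  rw [← ofReal_norm_sq_eq_lintegral, ← ofReal_norm_sq_eq_lintegral, ← ENNReal.ofReal_mul hC] at h
  exact (ENNReal.ofReal_le_ofReal_iff (by positivity)).1 h

theorem norm_le_of_sq_le {x y C : ℝ} (hy : 0 ≤ y) (h : x ^ 2 ≤ C * y ^ 2) :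
    x ≤ Real.sqrt C * y := by
  have := (le_abs_self x).trans (Real.abs_le_sqrt h)
  rwa [Real.sqrt_mul' _ (sq_nonneg y), Real.sqrt_sq hy] at this

theorem IsBoundedWeight.lintegral_le_inv_mul {lam : Measure α} {w : α → ℝ} {a b : ℝ}
    (h : IsBoundedWeight lam w a b) (F : α → ℝ≥0∞) : ∫⁻ x, F x ∂lam ≤
      ENNReal.ofReal a⁻¹ * ∫⁻ x, F x ∂(lam.withDensity fun x => ENNReal.ofReal (w x)) := by
  have h1 : ENNReal.ofReal a⁻¹ * ENNReal.ofReal a = 1 := by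
    rw [← ENNReal.ofReal_mul (inv_nonneg.2 h.pos.le), inv_mul_cancel₀ h.pos.ne', ENNReal.ofReal_one]
  calc ∫⁻ x, F x ∂lam = ENNReal.ofReal a⁻¹ * (ENNReal.ofReal a * ∫⁻ x, F x ∂lam) := by
        rw [← mul_assoc, h1, one_mul]
    _ ≤ _ := by gcongr; exact h.le_lintegral F

/-- Multiplication by the indicator function of a measurable set. -/
noncomputable def indicatorOperator {A : Set α} (hA : MeasurableSet A) :
    Lp ℂ 2 μ →L[ℂ] Lp ℂ 2 μ :=
  LinearMap.mkContinuous
    { toFun f := ((Lp.memLp f).indicator hA).toLp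
      map_add' f g := by
        ext1
        filter_upwards [((Lp.memLp (f + g)).indicator hA).coeFn_toLp,
          ((Lp.memLp f).indicator hA).coeFn_toLp, ((Lp.memLp g).indicator hA).coeFn_toLp,
          Lp.coeFn_add f g, Lp.coeFn_add ((Lp.memLp f).indicator hA).toLp
            ((Lp.memLp g).indicator hA).toLp] with x h1 h2 h3 h4 h5
        rw [h1, h5, Pi.add_apply, h2, h3]
        by_cases hx : x ∈ A
        · simp only [indicator_of_mem hx, h4, Pi.add_apply]
        · simp only [indicator_of_notMem hx, add_zero]
      map_smul' c f := by
        ext1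
        filter_upwards [((Lp.memLp (c • f)).indicator hA).coeFn_toLp,
          ((Lp.memLp f).indicator hA).coeFn_toLp,
          Lp.coeFn_smul c f, Lp.coeFn_smul c ((Lp.memLp f).indicator hA).toLp] with x h1 h2 h3 h4
        rw [RingHom.id_apply, h1, h4, Pi.smul_apply, h2]
        by_cases hx : x ∈ A
        · simp only [indicator_of_mem hx, h3, Pi.smul_apply]
        · simp only [indicator_of_notMem hx, smul_zero] } 1 fun f => by
    rw [one_mul]
    refine Lp.norm_le_norm_of_ae_le ?_
    filter_upwards [((Lp.memLp f).indicator hA).coeFn_toLp] with x hx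
    change ‖(((Lp.memLp f).indicator hA).toLp : Lp ℂ 2 μ) x‖ ≤ _
    rw [hx]
    exact norm_indicator_le_norm_self _ _

theorem coeFn_indicatorOperator {A : Set α} (hA : MeasurableSet A) (f : Lp ℂ 2 μ) :
    indicatorOperator hA f =ᵐ[μ] A.indicator f :=
  ((Lp.memLp f).indicator hA).coeFn_toLp

theorem norm_indicatorOperator_le {A : Set α} (hA : MeasurableSet A) (f : Lp ℂ 2 μ) :
    ‖indicatorOperator hA f‖ ≤ ‖f‖ := by
  refine Lp.norm_le_norm_of_ae_le ?_
  filter_upwards [coeFn_indicatorOperator hA f] with x hx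
  rw [hx]
  exact norm_indicator_le_norm_self _ _

theorem lintegral_indicatorOperator {A : Set α} (hA : MeasurableSet A) (f : Lp ℂ 2 μ) :
    ∫⁻ x, ‖indicatorOperator hA f x‖ₑ ^ 2 ∂μ = ∫⁻ x in A, ‖f x‖ₑ ^ 2 ∂μ := by
  rw [lintegral_enorm_sq_congr (coeFn_indicatorOperator hA f), ← lintegral_indicator hA]
  refine lintegral_congr fun x => ?_
  by_cases hx : x ∈ A <;> simp [hx]

theorem indicatorOperator_add_compl {A : Set α} (hA : MeasurableSet A) (f : Lp ℂ 2 μ) :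
    indicatorOperator hA f + indicatorOperator hA.compl f = f := by
  ext1
  filter_upwards [Lp.coeFn_add (indicatorOperator hA f) (indicatorOperator hA.compl f),
    coeFn_indicatorOperator hA f, coeFn_indicatorOperator hA.compl f] with x h1 h2 h3
  rw [h1, Pi.add_apply, h2, h3]
  by_cases hx : x ∈ A <;> simp [hx]

/-- The identity as an operator from a weighted `L²` space to the space without weight. -/
noncomputable def IsBoundedWeight.unweight {lam : Measure α} {w : α → ℝ} {a b : ℝ}
    (h : IsBoundedWeight lam w a b) :
    Lp ℂ 2 (lam.withDensity fun x => ENNReal.ofReal (w x)) →L[ℂ] Lp ℂ 2 lam :=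
  LinearMap.mkContinuous
    { toFun f := (h.memLp f).toLp
      map_add' f g := by
        ext1
        filter_upwards [(h.memLp (f + g)).coeFn_toLp, (h.memLp f).coeFn_toLp,
          (h.memLp g).coeFn_toLp, h.absolutelyContinuous.ae_eq (Lp.coeFn_add f g),
          Lp.coeFn_add (h.memLp f).toLp (h.memLp g).toLp] with x h1 h2 h3 h4 h5
        rw [h1, h5, h4, Pi.add_apply, Pi.add_apply, h2, h3]
      map_smul' c f := by
        ext1
        filter_upwards [(h.memLp (c • f)).coeFn_toLp, (h.memLp f).coeFn_toLp,
          h.absolutelyContinuous.ae_eq (Lp.coeFn_smul c f),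
          Lp.coeFn_smul c (h.memLp f).toLp] with x h1 h2 h3 h4
        rw [RingHom.id_apply, h1, h4, h3, Pi.smul_apply, Pi.smul_apply, h2] }
    (Real.sqrt a⁻¹) fun f => by
      refine norm_le_of_sq_le (norm_nonneg _) ?_
      have ha := h.pos
      refine norm_sq_le_of_lintegral_le (by positivity) ?_
      change ∫⁻ x, ‖((h.memLp f).toLp : Lp ℂ 2 lam) x‖ₑ ^ 2 ∂lam ≤ _
      rw [lintegral_enorm_sq_congr (h.memLp f).coeFn_toLp]
      exact h.lintegral_le_inv_mul _

theorem IsBoundedWeight.coeFn_unweight {lam : Measure α} {w : α → ℝ} {a b : ℝ}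
    (h : IsBoundedWeight lam w a b)
    (f : Lp ℂ 2 (lam.withDensity fun x => ENNReal.ofReal (w x))) : h.unweight f =ᵐ[lam] f :=
  (h.memLp f).coeFn_toLp

end LpOperators

/-! ### Norm bounds on the whole strip and on its straight ends. -/

namespace CurvedStrip

variable {W : CurvedStrip}

theorem norm_sq_formSpace (v : W.formSpace) :
    ‖v‖ ^ 2 = ‖W.formEmbedding v‖ ^ 2 + (‖v.1.snd.fst‖ ^ 2 + ‖v.1.snd.snd‖ ^ 2) := by
  rw [Submodule.coe_norm, WithLp.prod_norm_sq_eq_of_L2, WithLp.prod_norm_sq_eq_of_L2]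
  rfl

theorem formEmbedding_ae_eq (v : W.formSpace) :
    W.formEmbedding v =ᵐ[volume.restrict (straightStrip W.d)]
      verticalPrimitive v.1.snd.snd :=
  (W.mem_formSpace.1 v.2).2.ae_eq_verticalPrimitive W.d_pos (memLp_coe _) (memLp_coe _)

variable (W) in
/-- The square root `π / (2 d)` of the threshold of the essential spectrum. -/
noncomputable def transversalFrequency : ℝ := Real.pi / (2 * W.d)

theorem transversalFrequency_pos : 0 < W.transversalFrequency :=
  div_pos Real.pi_pos (mul_pos two_pos W.d_pos)

theorem transversalFrequency_mul : W.transversalFrequency * W.d = Real.pi / 2 := by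
  have := W.d_pos
  rw [transversalFrequency]
  field_simp

theorem lintegral_formEmbedding_le (v : W.formSpace) (A : Set ℝ) :
    ∫⁻ p in A ×ˢ Ioo 0 W.d, ‖W.formEmbedding v p‖ₑ ^ 2 ≤
      ENNReal.ofReal ((W.transversalFrequency ^ 2)⁻¹) *
        ∫⁻ p in A ×ˢ Ioo 0 W.d, ‖v.1.snd.snd p‖ₑ ^ 2 := by
  have hle : volume.restrict (A ×ˢ Ioo 0 W.d) ≤ volume.restrict (straightStrip W.d) :=
    Measure.restrict_mono (prod_mono_left (subset_univ A)) le_rfl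
  rw [lintegral_enorm_sq_congr (ae_mono hle (formEmbedding_ae_eq v))]
  exact lintegral_verticalPrimitive_sq_le transversalFrequency_pos transversalFrequency_mul
    (memLp_coe _).1

/-- The Poincaré inequality with the two-sided bounds of the weight gives `‖J v‖² ≤ C ‖∂v/∂u‖²`,
hence `‖J v‖² ≤ C / (1 + C) ‖v‖²`. The constant is not sharp; the strict inequality is what makes
the eigenvalue positive. -/
theorem norm_formEmbedding_lt_one : ‖W.formEmbedding‖ < 1 := by
  obtain ⟨a, b, h⟩ := W.exists_isBoundedWeight_density
  set κ := W.transversalFrequency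
  have hκ : 0 < κ := transversalFrequency_pos
  have ha := h.pos
  -- The Poincaré constant `κ⁻²`, times the cost of passing from the weighted measure to Lebesgue
  -- measure and back. The maximum with `0` makes the nonnegativity of `C` immediate.
  set C : ℝ := max b 0 * ((κ ^ 2)⁻¹ * a⁻¹) with hC
  have hC0 : 0 ≤ C := by positivity
  have key : ∀ v : W.formSpace, ‖W.formEmbedding v‖ ^ 2 ≤ C * ‖v.1.snd.snd‖ ^ 2 := fun v => by
    refine norm_sq_le_of_lintegral_le hC0 ?_
    have h1 := h.lintegral_le fun p => ‖W.formEmbedding v p‖ₑ ^ 2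
    have h2 := lintegral_formEmbedding_le v univ
    have h3 : ∫⁻ p in straightStrip W.d, ‖v.1.snd.snd p‖ₑ ^ 2 ≤
        ENNReal.ofReal a⁻¹ * ∫⁻ p, ‖v.1.snd.snd p‖ₑ ^ 2 ∂W.weightedMeasure :=
      h.lintegral_le_inv_mul _
    calc ∫⁻ p, ‖W.formEmbedding v p‖ₑ ^ 2 ∂W.weightedMeasure
        ≤ ENNReal.ofReal b * ∫⁻ p in straightStrip W.d, ‖W.formEmbedding v p‖ₑ ^ 2 := h1
      _ ≤ ENNReal.ofReal (max b 0) * (ENNReal.ofReal ((κ ^ 2)⁻¹) *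
            (ENNReal.ofReal a⁻¹ * ∫⁻ p, ‖v.1.snd.snd p‖ₑ ^ 2 ∂W.weightedMeasure)) := by
          gcongr
          · exact le_max_left _ _
          · exact h2.trans (by gcongr; exact h3)
      _ = _ := by
          rw [hC, ENNReal.ofReal_mul (le_max_right _ _), ENNReal.ofReal_mul (by positivity)]
          ring
  have hbound : ‖W.formEmbedding‖ ≤ Real.sqrt (C / (1 + C)) := by
    refine ContinuousLinearMap.opNorm_le_bound _ (Real.sqrt_nonneg _) fun v => ?_
    refine norm_le_of_sq_le (norm_nonneg _) ?_
    rw [div_mul_eq_mul_div, le_div_iff₀ (by positivity), norm_sq_formSpace]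
    nlinarith [key v, mul_nonneg hC0 (sq_nonneg ‖v.1.snd.fst‖)]
  refine hbound.trans_lt ?_
  rw [Real.sqrt_lt' one_pos, one_pow, div_lt_one (by positivity)]
  linarith

/-- The middle part of the strip, outside which the strip is straight. -/
def middlePart (d s₀ : ℝ) : Set (ℝ × ℝ) := Icc (-s₀) s₀ ×ˢ Icc 0 d

theorem measurableSet_middlePart (d s₀ : ℝ) : MeasurableSet (middlePart d s₀) :=
  measurableSet_Icc.prod measurableSet_Icc

theorem lintegral_compl_middlePart {s₀ : ℝ} (hsupp : ∀ s : ℝ, s₀ ≤ |s| → W.γ s = 0)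
    (F : ℝ × ℝ → ℝ≥0∞) : ∫⁻ p in (middlePart W.d s₀)ᶜ, F p ∂W.weightedMeasure =
      ∫⁻ p in {s : ℝ | s₀ < |s|} ×ˢ Ioo 0 W.d, F p := by
  obtain ⟨a, b, h⟩ := W.exists_isBoundedWeight_density
  have hK := measurableSet_middlePart W.d s₀
  have hA : MeasurableSet {s : ℝ | s₀ < |s|} := measurableSet_lt measurable_const measurable_norm
  rw [← lintegral_indicator hK.compl]
  refine (h.lintegral_eq _).trans ?_
  have hsub : {s : ℝ | s₀ < |s|} ×ˢ Ioo 0 W.d ⊆ straightStrip W.d := prod_mono_left (subset_univ _)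
  rw [← inter_eq_left.2 hsub, ← Measure.restrict_restrict (hA.prod measurableSet_Ioo),
    ← lintegral_indicator (hA.prod measurableSet_Ioo)]
  refine setLIntegral_congr_fun (isOpen_straightStrip W.d).measurableSet fun p hp => ?_
  by_cases hs : s₀ < |p.1|
  · have h1 : p ∈ (middlePart W.d s₀)ᶜ := fun hm => not_le.2 hs (abs_le.2 hm.1)
    have h2 : p ∈ {s : ℝ | s₀ < |s|} ×ˢ Ioo 0 W.d := ⟨hs, hp.2⟩
    rw [indicator_of_mem h1, indicator_of_mem h2, density, hsupp _ hs.le]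
    simp
  · have h1 : p ∉ (middlePart W.d s₀)ᶜ := fun hm =>
      hm ⟨abs_le.1 (not_lt.1 hs), Ioo_subset_Icc_self hp.2⟩
    have h2 : p ∉ {s : ℝ | s₀ < |s|} ×ˢ Ioo 0 W.d := fun hm => hs hm.1
    rw [indicator_of_notMem h1, indicator_of_notMem h2, mul_zero]

/-- Outside the middle part the density is `1`, so the sharp Poincaré inequality yields `κ² ‖1f‖² ≤
‖1 ∂f/∂u‖²` for the restrictions; adding `‖1f‖²` bounds `(κ² + 1) ‖1f‖²` by `‖v‖²`. The cutoff may
be discontinuous in `s`, since only the transversal derivative enters. -/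
theorem norm_exterior_formEmbedding_le {s₀ : ℝ} (hsupp : ∀ s : ℝ, s₀ ≤ |s| → W.γ s = 0)
    (v : W.formSpace) :
    ‖indicatorOperator (measurableSet_middlePart W.d s₀).compl (W.formEmbedding v)‖ ^ 2 ≤
      (W.transversalFrequency ^ 2 + 1)⁻¹ * ‖v‖ ^ 2 := by
  set κ := W.transversalFrequency
  have hκ : 0 < κ := transversalFrequency_pos
  have hK := (measurableSet_middlePart W.d s₀).compl
  set f := W.formEmbedding v
  set g := v.1.snd.snd
  have h1 : ‖indicatorOperator hK f‖ ^ 2 ≤ (κ ^ 2)⁻¹ * ‖indicatorOperator hK g‖ ^ 2 := by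
    refine norm_sq_le_of_lintegral_le (by positivity) ?_
    rw [lintegral_indicatorOperator, lintegral_indicatorOperator,
      lintegral_compl_middlePart hsupp, lintegral_compl_middlePart hsupp]
    exact lintegral_formEmbedding_le v _
  have h2 := norm_indicatorOperator_le hK f
  have h3 := norm_indicatorOperator_le hK g
  have h4 := norm_sq_formSpace v
  have h2' := pow_le_pow_left₀ (norm_nonneg _) h2 2
  have h3' := pow_le_pow_left₀ (norm_nonneg _) h3 2
  rw [le_inv_mul_iff₀ (by positivity)] at h1 ⊢
  nlinarith [sq_nonneg ‖v.1.snd.fst‖]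

end CurvedStrip

/-! ### Compactness of the embedding over the middle part of the strip -/

section Box

open Filter Topology

/-- The box `(s, s + ε] × (-∞, u)` at the point `(s, u)`. -/
def cornerBox (ε : ℝ) (p : ℝ × ℝ) : Set (ℝ × ℝ) := Ioc p.1 (p.1 + ε) ×ˢ Iio p.2

theorem measurableSet_cornerBox (ε : ℝ) (p : ℝ × ℝ) : MeasurableSet (cornerBox ε p) :=
  measurableSet_Ioc.prod measurableSet_Iio

theorem volume_cornerBox_lt_top (d ε : ℝ) (p : ℝ × ℝ) :
    volume.restrict (straightStrip d) (cornerBox ε p) < ⊤ := by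
  rw [restrict_straightStrip, cornerBox, Measure.prod_prod]
  exact ENNReal.mul_lt_top (by simp) (measure_lt_top _ _)

/-- The indicators converge at every point off the three lines that bound the box, and these form a
null set. Dominated convergence then makes the measure of the symmetric difference tend to zero. -/
theorem continuous_indicator_cornerBox (d ε : ℝ) : Continuous fun p : ℝ × ℝ =>
    indicatorConstLp 2 (measurableSet_cornerBox ε p)
      (volume_cornerBox_lt_top d ε p).ne (1 : ℂ) := by
  refine continuous_indicatorConstLp_set (by norm_num) fun p => ?_
  -- A slab of finite measure in the strip that contains every box whose corner is within distance
  -- `1` of `p` in the `s` direction.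
  set B : Set (ℝ × ℝ) := Ioc (p.1 - 1) (p.1 + 1 + ε) ×ˢ univ
  have hB : volume.restrict (straightStrip d) B ≠ ⊤ := by
    rw [restrict_straightStrip, Measure.prod_prod]
    exact (ENNReal.mul_lt_top (by simp) (measure_lt_top _ _)).ne
  have hfst : ∀ c : ℝ, ∀ᵐ q ∂(volume.restrict (straightStrip d)), q.1 ≠ c := fun c =>
    ae_straightStrip_of_ae_fst (Measure.ae_ne volume c)
  have hsnd : ∀ c : ℝ, ∀ᵐ q ∂(volume.restrict (straightStrip d)), q.2 ≠ c := fun c => by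
    rw [restrict_straightStrip]
    exact Measure.quasiMeasurePreserving_snd.ae (Measure.ae_ne _ c)
  have := tendsto_measure_of_ae_tendsto_indicator (μ := volume.restrict (straightStrip d))
    (L := 𝓝 p) (A := ∅) (As := fun q => symmDiff (cornerBox ε q) (cornerBox ε p)) (B := B)
    MeasurableSet.empty
    (fun q => (measurableSet_cornerBox ε q).symmDiff (measurableSet_cornerBox ε p))
    (measurableSet_Ioc.prod MeasurableSet.univ) hB ?_ ?_
  · rwa [measure_empty] at this
  · have h1 : ∀ᶠ q : ℝ × ℝ in 𝓝 p, q.1 ∈ Ioo (p.1 - 1) (p.1 + 1) :=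
      continuous_fst.continuousAt.eventually (Ioo_mem_nhds (by linarith) (by linarith))
    filter_upwards [h1] with q hq
    refine symmDiff_subset_union.trans (union_subset ?_ ?_)
    · exact fun x hx => ⟨⟨hq.1.trans hx.1.1, hx.1.2.trans (by linarith [hq.2])⟩, mem_univ _⟩
    · exact fun x hx => ⟨⟨by linarith [hx.1.1], by linarith [hx.1.2]⟩, mem_univ _⟩
  · filter_upwards [hfst p.1, hfst (p.1 + ε), hsnd p.2] with x h1 h2 h3
    have e1 : ∀ᶠ q : ℝ × ℝ in 𝓝 p, (q.1 < x.1 ↔ p.1 < x.1) := by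
      rcases lt_or_gt_of_ne h1 with h | h
      · filter_upwards [continuous_fst.continuousAt.eventually (lt_mem_nhds h)] with q hq
        exact iff_of_false (not_lt.2 hq.le) (not_lt.2 h.le)
      · filter_upwards [continuous_fst.continuousAt.eventually (gt_mem_nhds h)] with q hq
        exact iff_of_true hq h
    have hc : ContinuousAt (fun q : ℝ × ℝ => q.1 + ε) p := by fun_prop
    have e2 : ∀ᶠ q : ℝ × ℝ in 𝓝 p, (x.1 ≤ q.1 + ε ↔ x.1 ≤ p.1 + ε) := by
      rcases lt_or_gt_of_ne h2 with h | h
      · filter_upwards [hc.eventually (lt_mem_nhds h)] with q hq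
        exact iff_of_true hq.le h.le
      · filter_upwards [hc.eventually (gt_mem_nhds h)] with q hq
        exact iff_of_false (not_le.2 hq) (not_le.2 h)
    have e3 : ∀ᶠ q : ℝ × ℝ in 𝓝 p, (x.2 < q.2 ↔ x.2 < p.2) := by
      rcases lt_or_gt_of_ne h3 with h | h
      · filter_upwards [continuous_snd.continuousAt.eventually (lt_mem_nhds h)] with q hq
        exact iff_of_true hq h
      · filter_upwards [continuous_snd.continuousAt.eventually (gt_mem_nhds h)] with q hq
        exact iff_of_false (not_lt.2 hq.le) (not_lt.2 h.le)
    filter_upwards [e1, e2, e3] with q h1 h2 h3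
    have : x ∈ cornerBox ε q ↔ x ∈ cornerBox ε p := by
      simp only [cornerBox, mem_prod, mem_Ioc, mem_Iio, h1, h2, h3]
    simp [mem_symmDiff, this]

/-- The box is unbounded below, but the measure lives on `0 < u < d`, so each vertical section
contributes the primitive from `0`. An average along the strip of a function with zero trace is
thereby an inner product of its transversal derivative with an indicator function. -/
theorem setIntegral_cornerBox {d ε : ℝ} (hε : 0 < ε) {g : ℝ × ℝ → ℂ}
    (hg : MemLp g 2 (volume.restrict (straightStrip d))) {p : ℝ × ℝ} (hp : p ∈ straightStrip d) :
    (1 / ε : ℝ) • ∫ q in cornerBox ε p, g q ∂(volume.restrict (straightStrip d)) =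
      horizontalAverage ε (fun _ => 1 / ε) (verticalPrimitive g) p := by
  have hfin : IsFiniteMeasure ((volume.restrict (straightStrip d)).restrict (cornerBox ε p)) :=
    ⟨by rw [Measure.restrict_apply_univ]; exact volume_cornerBox_lt_top d ε p⟩
  have hi : Integrable g ((volume.restrict (straightStrip d)).restrict (cornerBox ε p)) :=
    (hg.restrict _).integrable (by norm_num)
  have hm : (volume.restrict (straightStrip d)).restrict (cornerBox ε p) =
      (volume.restrict (Ioc p.1 (p.1 + ε))).prod (volume.restrict (Ioo 0 p.2)) := by
    rw [restrict_straightStrip, cornerBox, ← Measure.prod_restrict,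
      Measure.restrict_restrict measurableSet_Iio]
    congr 2
    ext t
    exact ⟨fun h => ⟨h.2.1, h.1⟩, fun h => ⟨h.2, h.1, h.2.trans hp.2.2⟩⟩
  rw [hm] at hi ⊢
  rw [integral_prod _ hi, horizontalAverage, integral_smul]
  congr 1
  rw [← intervalIntegral.integral_of_le (by linarith), ← intervalIntegral.integral_of_le hε.le]
  have := intervalIntegral.integral_comp_add_left
    (fun s => ∫ t in Ioo 0 p.2, g (s, t)) (a := 0) (b := ε) p.1
  rw [add_zero] at this
  rw [← this]
  simp [verticalPrimitive]

end Box

namespace CurvedStrip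

variable {W : CurvedStrip}

variable (W) in
/-- The transversal derivative as an operator on the form domain. -/
theorem exists_transversalDerivative : ∃ D : W.formSpace →L[ℂ]
    Lp ℂ 2 (volume.restrict (straightStrip W.d)),
      ∀ v, D v =ᵐ[volume.restrict (straightStrip W.d)] v.1.snd.snd := by
  obtain ⟨a, b, h⟩ := W.exists_isBoundedWeight_density
  exact ⟨h.unweight ∘L WithLp.sndL 2 ℂ _ _ ∘L WithLp.sndL 2 ℂ _ _ ∘L W.formSpace.subtypeL,
    fun v => h.coeFn_unweight _⟩

variable (W) in
/-- The kernel of the operator that averages a function in the form domain along the strip. -/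
theorem exists_averageKernel {ε : ℝ} (hε : 0 < ε) : ∃ k : ℝ × ℝ → W.formSpace →L[ℂ] ℂ,
    Continuous k ∧ ∀ v, ∀ p ∈ straightStrip W.d,
      k p v = horizontalAverage ε (fun _ => 1 / ε) (verticalPrimitive v.1.snd.snd) p := by
  obtain ⟨D, hD⟩ := W.exists_transversalDerivative
  -- The functional is `ε⁻¹` times the inner product of the transversal derivative with the
  -- indicator of the box at `p`. Its norm continuity in `p` comes from the continuity of these
  -- indicators in `L²`.
  refine ⟨fun p => ((1 / ε : ℝ) : ℂ) • (innerSL ℂ (indicatorConstLp 2 (measurableSet_cornerBox ε p)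
    (volume_cornerBox_lt_top W.d ε p).ne (1 : ℂ))) ∘L D, ?_, fun v p hp => ?_⟩
  · have h1 : Continuous fun p => innerSL ℂ (indicatorConstLp 2 (measurableSet_cornerBox ε p)
        (volume_cornerBox_lt_top W.d ε p).ne (1 : ℂ)) :=
      (innerSL ℂ).continuous.comp (continuous_indicator_cornerBox W.d ε)
    have h2 : Continuous fun p => innerSL ℂ (indicatorConstLp 2 (measurableSet_cornerBox ε p)
        (volume_cornerBox_lt_top W.d ε p).ne (1 : ℂ)) ∘L D := h1.clm_comp continuous_const
    exact Continuous.const_smul (M := ℂ) h2 ((1 / ε : ℝ) : ℂ)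
  · rw [← setIntegral_cornerBox hε (memLp_coe _) hp]
    change ((1 / ε : ℝ) : ℂ) • inner ℂ (indicatorConstLp 2 _ _ (1 : ℂ)) (D v) = _
    rw [L2.inner_indicatorConstLp_one, Complex.real_smul, smul_eq_mul]
    congr 1
    exact integral_congr_ae (ae_restrict_of_ae (hD v))

theorem memLp_indicator_middlePart {V : Type*} [NormedAddCommGroup V] [NormedSpace ℂ V]
    {k : ℝ × ℝ → V →L[ℂ] ℂ} (hk : Continuous k) (s₀ : ℝ) :
    MemLp ((middlePart W.d s₀).indicator k) 2 W.weightedMeasure := by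
  have hK := measurableSet_middlePart W.d s₀
  have hc : IsCompact (middlePart W.d s₀) := isCompact_Icc.prod isCompact_Icc
  obtain ⟨c, hc', h⟩ := W.weightedMeasure_le
  have hfin : W.weightedMeasure (middlePart W.d s₀) < ⊤ := by
    refine (h _).trans_lt ?_
    rw [Measure.smul_apply, smul_eq_mul]
    exact ENNReal.mul_lt_top hc'.lt_top
      ((Measure.restrict_apply_le _ _).trans_lt hc.measure_lt_top)
  obtain ⟨M, hM⟩ := hc.exists_bound_of_continuousOn hk.continuousOn
  refine (memLp_indicator_iff_restrict (f := k) (p := 2) (μ := W.weightedMeasure) hK).2 ?_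
  have : IsFiniteMeasure (W.weightedMeasure.restrict (middlePart W.d s₀)) :=
    ⟨by rwa [Measure.restrict_apply_univ]⟩
  refine MemLp.of_bound hk.aestronglyMeasurable M ?_
  filter_upwards [ae_restrict_mem hK] with p hp
  exact hM p hp

/-- A continuous kernel, cut off to the middle part of the strip, defines a compact operator. -/
theorem exists_isCompactOperator_kernel {V : Type*} [NormedAddCommGroup V] [NormedSpace ℂ V]
    {k : ℝ × ℝ → V →L[ℂ] ℂ} (hk : Continuous k) (s₀ : ℝ) :
    ∃ T : V →L[ℂ] W.HilbertSpace, IsCompactOperator T ∧ ∀ v, T v =ᵐ[W.weightedMeasure]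
      (middlePart W.d s₀).indicator fun p => k p v := by
  have hmem := memLp_indicator_middlePart (W := W) hk s₀
  refine ⟨kernelOperator V W.weightedMeasure hmem.toLp, isCompactOperator_kernelOperator _,
    fun v => ?_⟩
  filter_upwards [coeFn_kernelOperator hmem.toLp v, hmem.coeFn_toLp] with p h1 h2
  rw [h1, h2]
  by_cases hp : p ∈ middlePart W.d s₀
  · rw [indicator_of_mem hp, indicator_of_mem hp]
  · rw [indicator_of_notMem hp, indicator_of_notMem hp]
    rfl

theorem indicator_sub_average_ae (s₀ : ℝ) {ε : ℝ} (hε : 0 < ε) (v : W.formSpace)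
    {F : W.HilbertSpace} (hF : F =ᵐ[W.weightedMeasure] (middlePart W.d s₀).indicator
      (horizontalAverage ε (fun _ => 1 / ε) (verticalPrimitive v.1.snd.snd))) :
    ∀ᵐ p ∂W.weightedMeasure,
      (indicatorOperator (measurableSet_middlePart W.d s₀) (W.formEmbedding v) - F :
        W.HilbertSpace) p = (middlePart W.d s₀).indicator
            (fun p => -horizontalAverage ε (fun t => 1 - t / ε) v.1.snd.fst p) p := by
  have hK := measurableSet_middlePart W.d s₀
  have hac := withDensity_absolutelyContinuous (volume.restrict (straightStrip W.d))
    fun p => ENNReal.ofReal (W.density p)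
  have e1 := hac.ae_le ((W.mem_formSpace.1 v.2).1.ae_eq_horizontalAverage hε (memLp_coe _))
  have e2 := hac.ae_le (horizontalAverage_congr (a := ε) (w := fun _ => 1 / ε)
    (formEmbedding_ae_eq v))
  filter_upwards [e1, e2, Lp.coeFn_sub (indicatorOperator hK (W.formEmbedding v)) F,
    coeFn_indicatorOperator hK (W.formEmbedding v), hF] with p h1 h2 h4 h5 h6
  rw [h4, Pi.sub_apply, h5, h6]
  by_cases hp : p ∈ middlePart W.d s₀
  · rw [indicator_of_mem hp, indicator_of_mem hp, indicator_of_mem hp, ← h2]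
    exact h1
  · rw [indicator_of_notMem hp, indicator_of_notMem hp, indicator_of_notMem hp, sub_zero]

/-- Functions in the form domain are close to their averages over the middle part of the strip. -/
theorem exists_norm_sub_average_le (W : CurvedStrip) (s₀ : ℝ) : ∃ C : ℝ, 0 ≤ C ∧ ∀ ε : ℝ, 0 < ε →
    ∀ (v : W.formSpace) (F : W.HilbertSpace), F =ᵐ[W.weightedMeasure] (middlePart W.d s₀).indicator
      (horizontalAverage ε (fun _ => 1 / ε) (verticalPrimitive v.1.snd.snd)) →
    ‖indicatorOperator (measurableSet_middlePart W.d s₀) (W.formEmbedding v) - F‖ ≤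
      C * ε * ‖v‖ := by
  obtain ⟨a, b, h⟩ := W.exists_isBoundedWeight_density
  obtain ⟨a', b', h'⟩ := W.exists_isBoundedWeight_inv_density
  have ha' := h'.pos
  refine ⟨Real.sqrt (max b 0 * a'⁻¹), Real.sqrt_nonneg _, fun ε hε v F hF => ?_⟩
  have hsq : ‖indicatorOperator (measurableSet_middlePart W.d s₀) (W.formEmbedding v) - F‖ ^ 2 ≤
      (max b 0 * (ε ^ 2 * a'⁻¹)) * ‖v.1.snd.fst‖ ^ 2 := by
    refine norm_sq_le_of_lintegral_le (by positivity) ?_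
    -- With the weight `1 - t / ε` bounded by `1`, averaging over length `ε` has norm at most `ε`;
    -- this is the source of the factor `ε` in the bound.
    have hw : ∀ t ∈ Ioc 0 ε, |1 - t / ε| ≤ 1 := fun t ht => by
      have h1 : t / ε ≤ 1 := (div_le_one hε).2 ht.2
      have h2 : 0 ≤ t / ε := div_nonneg ht.1.le hε.le
      rw [abs_le]; constructor <;> linarith
    have hav := lintegral_horizontalAverage_sq_le hε hw (memLp_coe_inverse v.1.snd.fst).1
    rw [mul_one] at hav
    calc ∫⁻ p, ‖(indicatorOperator (measurableSet_middlePart W.d s₀) (W.formEmbedding v) - F :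
            W.HilbertSpace) p‖ₑ ^ 2 ∂W.weightedMeasure
        ≤ ∫⁻ p, ‖horizontalAverage ε (fun t => 1 - t / ε) v.1.snd.fst p‖ₑ ^ 2
            ∂W.weightedMeasure := by
          refine lintegral_mono_ae ?_
          filter_upwards [indicator_sub_average_ae s₀ hε v hF] with p hp
          rw [hp]
          gcongr
          refine (enorm_indicator_le_enorm_self _ _).trans_eq ?_
          rw [enorm_neg]
      _ ≤ ENNReal.ofReal b * ∫⁻ p in straightStrip W.d,
            ‖horizontalAverage ε (fun t => 1 - t / ε) v.1.snd.fst p‖ₑ ^ 2 := h.lintegral_le _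
      _ ≤ ENNReal.ofReal (max b 0) * (ENNReal.ofReal ε ^ 2 * (ENNReal.ofReal a'⁻¹ *
            ∫⁻ p, ‖v.1.snd.fst p‖ₑ ^ 2 ∂W.inverseMeasure)) := by
          gcongr
          · exact le_max_left _ _
          · refine hav.trans ?_
            gcongr
            exact h'.lintegral_le_inv_mul _
      _ = _ := by
          rw [ENNReal.ofReal_mul (le_max_right _ _), ENNReal.ofReal_mul (by positivity),
            ENNReal.ofReal_pow hε.le]
          ring
  have hle : ‖v.1.snd.fst‖ ^ 2 ≤ ‖v‖ ^ 2 := by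
    rw [norm_sq_formSpace]
    nlinarith [sq_nonneg ‖W.formEmbedding v‖, sq_nonneg ‖v.1.snd.snd‖]
  have hfin := norm_le_of_sq_le (norm_nonneg v)
    (hsq.trans (mul_le_mul_of_nonneg_left hle (by positivity)))
  refine hfin.trans_eq ?_
  rw [show max b 0 * (ε ^ 2 * a'⁻¹) = (max b 0 * a'⁻¹) * ε ^ 2 by ring,
    Real.sqrt_mul' _ (sq_nonneg ε), Real.sqrt_sq hε.le]

theorem _root_.isCompactOperator_of_forall_norm_sub_le {V H : Type*} [NormedAddCommGroup V]
    [NormedSpace ℂ V] [NormedAddCommGroup H] [NormedSpace ℂ H] [CompleteSpace H] {S : V →L[ℂ] H}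
    {C : ℝ} (hC : 0 ≤ C) (h : ∀ ε : ℝ, 0 < ε → ∃ T : V →L[ℂ] H, IsCompactOperator T ∧
      ∀ v, ‖S v - T v‖ ≤ C * ε * ‖v‖) : IsCompactOperator S := by
  have hcl : IsClosed {T : V →L[ℂ] H | IsCompactOperator T} :=
    isClosed_setOfPred_isCompactOperator
  refine hcl.closure_subset (Metric.mem_closure_iff.2 fun δ hδ => ?_)
  -- The denominator `C + 1` also covers `C = 0` and makes the error strictly smaller than `δ`.
  obtain ⟨T, hT, hn⟩ := h (δ / (C + 1)) (by positivity)
  refine ⟨T, hT, ?_⟩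
  rw [dist_eq_norm]
  refine (ContinuousLinearMap.opNorm_le_bound (S - T) (by positivity) hn).trans_lt ?_
  rw [mul_div_assoc', div_lt_iff₀ (by positivity)]
  nlinarith

/-- A Rellich theorem. Averaging along the strip over a length `ε` changes the embedding by `O(ε)`
in operator norm, through the longitudinal derivative. The averaged embedding has a continuous
kernel on a compact set, through the transversal derivative, and is compact. -/
theorem isCompactOperator_interior_formEmbedding (s₀ : ℝ) : IsCompactOperator
    (indicatorOperator (measurableSet_middlePart W.d s₀) ∘L W.formEmbedding) := by
  obtain ⟨C, hC, h⟩ := W.exists_norm_sub_average_le s₀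
  refine isCompactOperator_of_forall_norm_sub_le (V := W.formSpace) (H := W.HilbertSpace) hC
    fun ε hε => ?_
  obtain ⟨k, hk, hkv⟩ := W.exists_averageKernel hε
  obtain ⟨T, hT, hTv⟩ := exists_isCompactOperator_kernel (W := W) hk s₀
  refine ⟨T, hT, fun v => h ε hε v (T v) ?_⟩
  have hac := withDensity_absolutelyContinuous (volume.restrict (straightStrip W.d))
    fun p => ENNReal.ofReal (W.density p)
  filter_upwards [hTv v, hac.ae_le (ae_mem_straightStrip W.d)] with p h1 h2
  rw [h1]
  by_cases hp : p ∈ middlePart W.d s₀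
  · rw [indicator_of_mem hp, indicator_of_mem hp, hkv v p h2]
  · rw [indicator_of_notMem hp, indicator_of_notMem hp]

end CurvedStrip

/-! ### Products of functions of one variable -/

theorem HasCompactSupport.sq {a : ℝ → ℝ} (ha : HasCompactSupport a) :
    HasCompactSupport fun s => a s ^ 2 :=
  ha.comp_left (g := fun x : ℝ => x ^ 2) (by simp)

section Tensor

variable {d : ℝ} {a c : ℝ → ℝ}

theorem integrable_continuous_Ioo (hc : Continuous c) :
    Integrable c (volume.restrict (Ioo 0 d)) :=
  (hc.integrableOn_Icc (a := 0) (b := d)).mono_set Ioo_subset_Icc_self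

theorem integrable_tensor (ha : Continuous a) (hac : HasCompactSupport a) (hc : Continuous c) :
    Integrable (fun p : ℝ × ℝ => a p.1 * c p.2) (volume.restrict (straightStrip d)) := by
  rw [restrict_straightStrip]
  exact (ha.integrable_of_hasCompactSupport hac).mul_prod (integrable_continuous_Ioo hc)

theorem integral_tensor (a c : ℝ → ℝ) :
    ∫ p in straightStrip d, a p.1 * c p.2 = (∫ s, a s) * ∫ u in Ioo 0 d, c u := by
  rw [restrict_straightStrip]
  exact integral_prod_mul a c

theorem memLp_tensor (ha : Continuous a) (hac : HasCompactSupport a) (hc : Continuous c) :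
    MemLp (fun p : ℝ × ℝ => ((a p.1 * c p.2 : ℝ) : ℂ)) 2 (volume.restrict (straightStrip d)) := by
  refine MemLp.ofReal ((memLp_two_iff_integrable_sq ?_).2 ?_)
  · exact ((ha.comp continuous_fst).mul (hc.comp continuous_snd)).aestronglyMeasurable
  · exact (integrable_tensor (a := fun s => a s ^ 2) (c := fun u => c u ^ 2) (ha.pow 2) hac.sq
      (hc.pow 2)).congr (ae_of_all _ fun p => (mul_pow _ _ _).symm)

theorem contDiff_tensor (ha : ContDiff ℝ ∞ a) (hc : ContDiff ℝ ∞ c) :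
    ContDiff ℝ ∞ fun p : ℝ × ℝ => a p.1 * c p.2 :=
  (ha.comp contDiff_fst).mul (hc.comp contDiff_snd)

theorem fderiv_tensor (ha : ContDiff ℝ ∞ a) (hc : ContDiff ℝ ∞ c) (p v : ℝ × ℝ) :
    fderiv ℝ (fun p : ℝ × ℝ => a p.1 * c p.2) p v =
      v.1 * (deriv a p.1 * c p.2) + v.2 * (a p.1 * deriv c p.2) := by
  have h1 : HasFDerivAt (fun p : ℝ × ℝ => a p.1) _ p :=
    ((ha.differentiable (by simp)) p.1).hasDerivAt.comp_hasFDerivAt p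
      (hasFDerivAt_fst (𝕜 := ℝ) (p := p))
  have h2 : HasFDerivAt (fun p : ℝ × ℝ => c p.2) _ p :=
    ((hc.differentiable (by simp)) p.2).hasDerivAt.comp_hasFDerivAt p
      (hasFDerivAt_snd (𝕜 := ℝ) (p := p))
  have h3 : fderiv ℝ (fun p : ℝ × ℝ => a p.1 * c p.2) p = _ := (h1.mul h2).fderiv
  rw [h3]
  simp
  ring

theorem hasL2WeakDeriv_tensor (ha : ContDiff ℝ ∞ a) (hac : HasCompactSupport a)
    (hc : ContDiff ℝ ∞ c) : HasL2WeakDeriv (straightStrip d) (1, 0)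
      (fun p => ((a p.1 * c p.2 : ℝ) : ℂ)) (fun p => ((deriv a p.1 * c p.2 : ℝ) : ℂ)) := by
  refine ⟨memLp_tensor (ha.continuous_deriv (by simp)) hac.deriv hc.continuous, fun φ hφ => ?_⟩
  -- The roles are exchanged: the function with compact support in the strip is the test function
  -- `φ`, while the product need not vanish at the sides.
  have := setIntegral_fderiv_smul_of_tsupport_subset hφ (contDiff_tensor ha hc) (1, 0)
  simp only [fderiv_tensor ha hc, one_mul, zero_mul, add_zero, Complex.real_smul] at this ⊢
  rw [eq_comm, neg_eq_iff_eq_neg]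
  simpa only [mul_comm] using this

/-- Integration by parts on each vertical line. The boundary term at `u = d` vanishes because of
`φ`, the one at `u = 0` because of `c`. -/
theorem hasDirichletDeriv_tensor (ha : ContDiff ℝ ∞ a) (hc : ContDiff ℝ ∞ c) (hc0 : c 0 = 0)
    (hd : 0 < d) : HasDirichletDeriv d
      (fun p => ((a p.1 * c p.2 : ℝ) : ℂ)) (fun p => ((a p.1 * deriv c p.2 : ℝ) : ℂ)) := by
  intro φ hφ
  have cF : Continuous fun p : ℝ × ℝ => a p.1 * c p.2 := (contDiff_tensor ha hc).continuous
  have cF' : Continuous fun p : ℝ × ℝ => a p.1 * deriv c p.2 :=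
    (ha.continuous.comp continuous_fst).mul
      ((hc.continuous_deriv (by simp)).comp continuous_snd)
  have i1 : Integrable (fun p : ℝ × ℝ => fderiv ℝ φ p (0, 1) * (a p.1 * c p.2))
      (volume.restrict (straightStrip d)) :=
    (((hφ.continuous_fderiv_apply (0, 1)).mul cF).integrable_of_hasCompactSupport
      (hφ.hasCompactSupport_fderiv_apply _).mul_right).restrict
  have i2 : Integrable (fun p : ℝ × ℝ => φ p * (a p.1 * deriv c p.2))
      (volume.restrict (straightStrip d)) :=
    ((hφ.1.continuous.mul cF').integrable_of_hasCompactSupport hφ.2.1.mul_right).restrict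
  have key : ∫ p in straightStrip d, (fderiv ℝ φ p (0, 1) * (a p.1 * c p.2) +
      φ p * (a p.1 * deriv c p.2)) = 0 := by
    have i3 := i1.add i2
    rw [restrict_straightStrip] at i3 ⊢
    refine (integral_prod _ i3).trans (integral_eq_zero_of_ae (Filter.Eventually.of_forall ?_))
    intro s
    have hD : ∀ u, HasDerivAt (fun u => φ (s, u) * (a s * c u))
        (fderiv ℝ φ (s, u) (0, 1) * (a s * c u) + φ (s, u) * (a s * deriv c u)) u := fun u => by
      have h1 : HasDerivAt (fun u => φ (s, u)) (fderiv ℝ φ (s, u) (0, 1)) u :=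
        ((hφ.1.differentiable (by simp)) (s, u)).hasFDerivAt.comp_hasDerivAt u
          ((hasDerivAt_const u s).prodMk (hasDerivAt_id u))
      exact h1.mul (((hc.differentiable (by simp)) u).hasDerivAt.const_mul (a s))
    have hcont : Continuous fun u =>
        fderiv ℝ φ (s, u) (0, 1) * (a s * c u) + φ (s, u) * (a s * deriv c u) :=
      (((hφ.continuous_fderiv_apply (0, 1)).mul cF).add (hφ.1.continuous.mul cF')).comp
        (Continuous.prodMk_right s)
    have hz : φ (s, d) = 0 := image_eq_zero_of_notMem_tsupport fun h => lt_irrefl d (hφ.2.2 h)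
    have := intervalIntegral.integral_eq_sub_of_hasDerivAt (fun u _ => hD u)
      (hcont.intervalIntegrable 0 d)
    rw [hz, hc0, mul_zero, mul_zero, zero_mul, sub_zero,
      intervalIntegral.integral_of_le hd.le, integral_Ioc_eq_integral_Ioo] at this
    exact this
  rw [integral_add i1 i2] at key
  simp only [Complex.real_smul, ← Complex.ofReal_mul]
  rw [integral_complex_ofReal, integral_complex_ofReal, ← Complex.ofReal_neg,
    eq_neg_of_add_eq_zero_left key]

end Tensor

theorem IsBoundedWeight.norm_sq_eq {α : Type*} [MeasurableSpace α] {lam : Measure α} {w : α → ℝ}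
    {a b : ℝ} (h : IsBoundedWeight lam w a b)
    {f : Lp ℂ 2 (lam.withDensity fun x => ENNReal.ofReal (w x))} {F : α → ℝ}
    (hf : f =ᵐ[lam] fun x => (F x : ℂ)) : ‖f‖ ^ 2 = ∫ x, w x * F x ^ 2 ∂lam := by
  have h1 : ((‖f‖ ^ 2 : ℝ) : ℂ) = ((∫ x, w x * F x ^ 2 ∂lam : ℝ) : ℂ) := by
    have h2 : ((‖f‖ ^ 2 : ℝ) : ℂ) = inner ℂ f f := by
      rw [inner_self_eq_norm_sq_to_K]
      push_cast
      rfl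
    rw [h2, h.inner_eq, ← integral_complex_ofReal]
    refine integral_congr_ae ?_
    filter_upwards [hf] with x hx
    rw [hx, Complex.conj_ofReal]
    push_cast
    ring
  exact_mod_cast h1

/-! ### A test function that feels the curvature -/

/-- Cutoff functions that vary slowly. -/
theorem exists_cutoff : ∃ B : ℝ, 0 ≤ B ∧ ∀ l : ℝ, 0 < l → ∃ b : ℝ → ℝ, ContDiff ℝ ∞ b ∧
    HasCompactSupport b ∧ (∀ s, |s| ≤ l → b s = 1) ∧ ∫ s, deriv b s ^ 2 = l⁻¹ * B := by
  let b : ContDiffBump (0 : ℝ) := ⟨1, 2, one_pos, one_lt_two⟩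
  have hb : ContDiff ℝ ∞ b := b.contDiff
  -- For the dilate `b(s / l)` of a fixed bump function the derivative gains `l⁻¹` and the length of
  -- the transition region gains `l`, so the energy scales like `l⁻¹`.
  refine ⟨∫ s, deriv b s ^ 2, integral_nonneg fun s => sq_nonneg _, fun l hl =>
    ⟨fun s => b (s / l), hb.comp (contDiff_id.div_const l), ?_, fun s hs => ?_, ?_⟩⟩
  · exact b.hasCompactSupport.comp_homeomorph (Homeomorph.mulRight₀ l⁻¹ (by positivity))
  · refine b.one_of_mem_closedBall ?_
    rw [mem_closedBall_zero_iff, Real.norm_eq_abs, abs_div, abs_of_pos hl]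
    exact (div_le_one hl).2 hs
  · have hd : ∀ s, deriv (fun s => b (s / l)) s = deriv b (s / l) / l := fun s => by
      have := ((hb.differentiable (by simp)) (s / l)).hasDerivAt.comp s
        ((hasDerivAt_id s).div_const l)
      exact this.deriv.trans (mul_one_div _ _)
    simp_rw [hd, div_pow]
    rw [integral_div, Measure.integral_comp_div (fun s => deriv b s ^ 2) l, abs_of_pos hl,
      smul_eq_mul]
    field_simp

theorem integrable_deriv_sq {η : ℝ → ℝ} (hη : ContDiff ℝ ∞ η) (hηc : HasCompactSupport η) :
    Integrable fun s => deriv η s ^ 2 := by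
  have h : Continuous fun s => deriv η s ^ 2 := (hη.continuous_deriv (by simp)).pow 2
  exact h.integrable_of_hasCompactSupport hηc.deriv.sq

theorem integral_deriv_add_sq_le {b η : ℝ → ℝ} (hb : ContDiff ℝ ∞ b) (hbc : HasCompactSupport b)
    (hη : ContDiff ℝ ∞ η) (hηc : HasCompactSupport η) (δ : ℝ) :
    ∫ s, deriv (fun s => b s + δ * η s) s ^ 2 ≤
      2 * (∫ s, deriv b s ^ 2) + 2 * δ ^ 2 * ∫ s, deriv η s ^ 2 := by
  have ib := (integrable_deriv_sq hb hbc).const_mul 2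
  have iη := (integrable_deriv_sq hη hηc).const_mul (2 * δ ^ 2)
  have hd : ∀ s, deriv (fun s => b s + δ * η s) s = deriv b s + δ * deriv η s := fun s =>
    (((hb.differentiable (by simp)) s).hasDerivAt.add
      (((hη.differentiable (by simp)) s).hasDerivAt.const_mul δ)).deriv
  rw [← integral_const_mul, ← integral_const_mul, ← integral_add ib iη]
  refine integral_mono_of_nonneg (Filter.Eventually.of_forall fun s => sq_nonneg _)
    (ib.add iη) (Filter.Eventually.of_forall fun s => ?_)
  simp only [hd]
  nlinarith [sq_nonneg (deriv b s - δ * deriv η s)]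

/-- Since `b = 1` wherever `γ ≠ 0`, the term of order zero in `δ` is `∫ γ`, which vanishes; the
expansion begins with the linear term. -/
theorem integral_mul_add_sq {γ b η : ℝ → ℝ} (hγ : Continuous γ) (hγc : HasCompactSupport γ)
    (hη : Continuous η) (hbend : ∫ s, γ s = 0) (hb : ∀ s, γ s ≠ 0 → b s = 1) (δ : ℝ) :
    ∫ s, γ s * (b s + δ * η s) ^ 2 =
      2 * δ * (∫ s, γ s * η s) + δ ^ 2 * ∫ s, γ s * η s ^ 2 := by
  have h0 : Integrable γ := hγ.integrable_of_hasCompactSupport hγc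
  have h1 : Integrable fun s => γ s * η s :=
    (hγ.mul hη).integrable_of_hasCompactSupport hγc.mul_right
  have h2 : Integrable fun s => γ s * η s ^ 2 :=
    (hγ.mul (hη.pow 2)).integrable_of_hasCompactSupport hγc.mul_right
  have h3 : ∀ s, γ s * (b s + δ * η s) ^ 2 =
      γ s + (2 * δ * (γ s * η s) + δ ^ 2 * (γ s * η s ^ 2)) := fun s => by
    by_cases h : γ s = 0
    · rw [h]; ring
    · rw [hb s h]; ring
  simp_rw [h3]
  have h4 : Integrable fun s => 2 * δ * (γ s * η s) + δ ^ 2 * (γ s * η s ^ 2) :=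
    (h1.const_mul _).add (h2.const_mul _)
  rw [integral_add h0 h4, integral_add (h1.const_mul _) (h2.const_mul _), integral_const_mul,
    integral_const_mul, hbend, zero_add]

/-- With `δ = -tm` the linear term is `-2tm²`. The choice `t = (K + 1)⁻¹` keeps the quadratic terms
below `tm²`, and a large `l` brings the cost of the cutoff strictly below the remaining `tm²`. -/
theorem exists_small_parameters {C B m M E : ℝ} (hC : 0 ≤ C) (hB : 0 ≤ B) (hm : m ≠ 0) (s₀ : ℝ) :
    ∃ δ l : ℝ, 0 < l ∧ s₀ ≤ l ∧
      C * (2 * (l⁻¹ * B) + 2 * δ ^ 2 * E) + (2 * δ * m + δ ^ 2 * M) < 0 := by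
  set K := |2 * C * E + M| with hK
  set t := (K + 1)⁻¹ with ht
  have ht0 : 0 < t := by positivity
  have hm2 : 0 < m ^ 2 := by positivity
  have hl0 : 0 ≤ 2 * C * B / (t * m ^ 2) := by positivity
  set l := |s₀| + 2 * C * B / (t * m ^ 2) + 1 with hl_def
  have hl : 0 < l := by positivity
  refine ⟨-(t * m), l, hl, by linarith [le_abs_self s₀], ?_⟩
  have e3 : 2 * C * B * l⁻¹ < t * m ^ 2 := by
    have : 2 * C * B / (t * m ^ 2) < l := by linarith [abs_nonneg s₀]
    rw [div_lt_iff₀ (by positivity)] at this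
    rw [← div_eq_mul_inv, div_lt_iff₀ hl]
    linarith
  have e4 : (t * m) ^ 2 * (2 * C * E + M) ≤ t * m ^ 2 := by
    have h1 : t * K ≤ 1 := by
      rw [ht, inv_mul_le_iff₀ (by positivity)]; linarith
    calc (t * m) ^ 2 * (2 * C * E + M) ≤ (t * m) ^ 2 * K := by gcongr; exact le_abs_self _
      _ = (t * m ^ 2) * (t * K) := by ring
      _ ≤ (t * m ^ 2) * 1 := by gcongr
      _ = _ := mul_one _
  linarith

/-- A wide plateau makes the energy nearly zero, because `γ` has mean zero. It is not stationary
there: the first variation in the direction `η` is a multiple of `∫ γ η`, which is nonzero for some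
`η`, so a small perturbation of the right sign makes the energy negative. -/
theorem exists_contDiff_energy_neg {γ : ℝ → ℝ} (hγ : Continuous γ) {s₀ : ℝ}
    (hsupp : ∀ s : ℝ, s₀ ≤ |s| → γ s = 0) (hbend : ∫ s, γ s = 0) (hne : γ ≠ 0)
    {C : ℝ} (hC : 0 ≤ C) : ∃ ψ : ℝ → ℝ, ContDiff ℝ ∞ ψ ∧ HasCompactSupport ψ ∧
      C * (∫ s, deriv ψ s ^ 2) + ∫ s, γ s * ψ s ^ 2 < 0 := by
  have hγc : HasCompactSupport γ := HasCompactSupport.intro (isCompact_Icc (a := -s₀) (b := s₀))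
    fun s hs => hsupp s (le_of_lt (by rw [mem_Icc, ← abs_le] at hs; exact not_le.1 hs))
  obtain ⟨η, hη, hηc, hm⟩ : ∃ η : ℝ → ℝ, ContDiff ℝ ∞ η ∧ HasCompactSupport η ∧
      ∫ s, γ s * η s ≠ 0 := by
    by_contra! hall
    have hγi : LocallyIntegrable γ := hγ.locallyIntegrable
    have := ae_eq_zero_of_integral_contDiff_smul_eq_zero hγi fun g h1 h2 => by
      simpa only [smul_eq_mul, mul_comm] using hall g h1 h2
    exact hne ((hγ.ae_eq_iff_eq volume continuous_const).1 this)
  obtain ⟨B, hB, hcut⟩ := exists_cutoff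
  obtain ⟨δ, l, hl, hsl, hlt⟩ := exists_small_parameters (M := ∫ s, γ s * η s ^ 2)
    (E := ∫ s, deriv η s ^ 2) hC hB hm s₀
  obtain ⟨b, hb, hbc, hb1, hb2⟩ := hcut l hl
  refine ⟨fun s => b s + δ * η s, hb.add (contDiff_const.mul hη), hbc.add hηc.mul_left, ?_⟩
  rw [integral_mul_add_sq hγ hγc hη.continuous hbend fun s hs => hb1 s (le_trans (le_of_lt
    (not_le.1 fun h => hs (hsupp s h))) hsl)]
  have := mul_le_mul_of_nonneg_left (integral_deriv_add_sq_le hb hbc hη hηc δ) hC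
  rw [hb2] at this
  linarith

namespace CurvedStrip

variable {W : CurvedStrip}

/-! ### The bottom of the spectrum lies below the transversal threshold -/

theorem setIntegral_cos_two_mul :
    ∫ u in Ioo 0 W.d, Real.cos (2 * W.transversalFrequency * u) = 0 := by
  have hκ : 0 < W.transversalFrequency := transversalFrequency_pos
  rw [← integral_Ioc_eq_integral_Ioo, ← intervalIntegral.integral_of_le W.d_pos.le,
    intervalIntegral.integral_comp_mul_left _ (by positivity), integral_cos, mul_zero, mul_assoc,
    transversalFrequency_mul, mul_div_cancel₀ _ two_ne_zero]
  simp

theorem setIntegral_mul_cos_two_mul :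
    ∫ u in Ioo 0 W.d, u * Real.cos (2 * W.transversalFrequency * u) =
      -(1 / (2 * W.transversalFrequency ^ 2)) := by
  set κ := W.transversalFrequency
  have hκ : 0 < κ := transversalFrequency_pos
  -- The antiderivative obtained by parts.
  have hD : ∀ u : ℝ, HasDerivAt (fun u => u * (Real.sin (2 * κ * u) / (2 * κ)) +
      Real.cos (2 * κ * u) / (4 * κ ^ 2)) (u * Real.cos (2 * κ * u)) u := fun u => by
    have hl : HasDerivAt (fun u => 2 * κ * u) (2 * κ) u := by
      simpa using (hasDerivAt_id u).const_mul (2 * κ)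
    have h := ((hasDerivAt_id u).mul (hl.sin.div_const (2 * κ))).add (hl.cos.div_const (4 * κ ^ 2))
    refine h.congr_deriv ?_
    simp only [id]
    field_simp
    ring
  rw [← integral_Ioc_eq_integral_Ioo, ← intervalIntegral.integral_of_le W.d_pos.le,
    intervalIntegral.integral_eq_sub_of_hasDerivAt (fun u _ => hD u)
      (Continuous.intervalIntegrable (by fun_prop) _ _),
    mul_assoc, transversalFrequency_mul, mul_div_cancel₀ _ two_ne_zero]
  simp
  field_simp
  norm_num

theorem integral_density_tensor_sq {ψ c : ℝ → ℝ} (hψ : Continuous ψ) (hψc : HasCompactSupport ψ)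
    (hc : Continuous c) : ∫ p in straightStrip W.d, W.density p * (ψ p.1 * c p.2) ^ 2 =
      (∫ s, ψ s ^ 2) * (∫ u in Ioo 0 W.d, c u ^ 2) -
        (∫ s, W.γ s * ψ s ^ 2) * ∫ u in Ioo 0 W.d, u * c u ^ 2 := by
  have hγ : Continuous fun s => W.γ s * ψ s ^ 2 := W.continuous_γ.mul (hψ.pow 2)
  have hγc : HasCompactSupport fun s => W.γ s * ψ s ^ 2 := hψc.sq.mul_left
  have i1 := integrable_tensor (d := W.d) (a := fun s => ψ s ^ 2) (c := fun u => c u ^ 2)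
    (hψ.pow 2) hψc.sq (hc.pow 2)
  have i2 := integrable_tensor (d := W.d) (c := fun u => u * c u ^ 2) hγ hγc
    (continuous_id.mul (hc.pow 2))
  rw [← integral_tensor (fun s => ψ s ^ 2), ← integral_tensor (fun s => W.γ s * ψ s ^ 2),
    ← integral_sub i1 i2]
  refine integral_congr_ae (ae_of_all _ fun p => ?_)
  simp only [density]
  ring

theorem transversal_cos_sq (u : ℝ) :
    (W.transversalFrequency * Real.cos (W.transversalFrequency * u)) ^ 2 =
      W.transversalFrequency ^ 2 * Real.sin (W.transversalFrequency * u) ^ 2 +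
        W.transversalFrequency ^ 2 * Real.cos (2 * W.transversalFrequency * u) := by
  rw [mul_assoc 2, Real.cos_two_mul, Real.sin_sq]
  ring

theorem setIntegral_transversal_cos_sq :
    ∫ u in Ioo 0 W.d, (W.transversalFrequency * Real.cos (W.transversalFrequency * u)) ^ 2 =
      W.transversalFrequency ^ 2 *
        ∫ u in Ioo 0 W.d, Real.sin (W.transversalFrequency * u) ^ 2 := by
  simp_rw [transversal_cos_sq]
  rw [integral_add (integrable_continuous_Ioo (by fun_prop))
    (integrable_continuous_Ioo (by fun_prop)), integral_const_mul, integral_const_mul,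
    setIntegral_cos_two_mul, mul_zero, add_zero]

/-- `cos(2κu)` has mean zero on `(0, d)` but first moment `-1 / (2κ²)`. This asymmetry between the
Dirichlet and the Neumann side is what makes the curvature enter the energy at first order. -/
theorem setIntegral_mul_transversal_cos_sq :
    ∫ u in Ioo 0 W.d, u * (W.transversalFrequency * Real.cos (W.transversalFrequency * u)) ^ 2 =
      W.transversalFrequency ^ 2 *
        (∫ u in Ioo 0 W.d, u * Real.sin (W.transversalFrequency * u) ^ 2) - 1 / 2 := by
  have hκ : 0 < W.transversalFrequency := transversalFrequency_pos
  simp_rw [transversal_cos_sq, mul_add, mul_left_comm _ (W.transversalFrequency ^ 2)]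
  rw [integral_add (integrable_continuous_Ioo (by fun_prop))
    (integrable_continuous_Ioo (by fun_prop)), integral_const_mul, integral_const_mul,
    setIntegral_mul_cos_two_mul, sub_eq_add_neg]
  congr 1
  field_simp

/-- The energy of `ψ(s) sin(κu)` in the transversal direction exceeds the threshold energy by the
mean of the curvature. -/
theorem integral_transversal_energy {ψ : ℝ → ℝ} (hψ : Continuous ψ) (hψc : HasCompactSupport ψ) :
    (∫ p in straightStrip W.d, W.density p *
        (ψ p.1 * (W.transversalFrequency * Real.cos (W.transversalFrequency * p.2))) ^ 2) -
      W.transversalFrequency ^ 2 * ∫ p in straightStrip W.d, W.density p *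
        (ψ p.1 * Real.sin (W.transversalFrequency * p.2)) ^ 2 =
      1 / 2 * ∫ s, W.γ s * ψ s ^ 2 := by
  rw [integral_density_tensor_sq (W := W) hψ hψc
      (c := fun u => W.transversalFrequency * Real.cos (W.transversalFrequency * u)) (by fun_prop),
    integral_density_tensor_sq (W := W) hψ hψc
      (c := fun u => Real.sin (W.transversalFrequency * u)) (by fun_prop),
    setIntegral_transversal_cos_sq, setIntegral_mul_transversal_cos_sq]
  ring

theorem integral_longitudinal_energy_le {c : ℝ} (hc : 0 < c)
    (hle : ∀ p ∈ straightStrip W.d, c ≤ W.density p) {ψ : ℝ → ℝ} (hψ : Continuous ψ)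
    (hψc : HasCompactSupport ψ) (k : ℝ) :
    ∫ p in straightStrip W.d, 1 / W.density p * (ψ p.1 * Real.sin (k * p.2)) ^ 2 ≤
      W.d / c * ∫ s, ψ s ^ 2 := by
  have i := (integrable_tensor (d := W.d) (a := fun s => ψ s ^ 2) (c := fun _ => 1) (hψ.pow 2)
    hψc.sq continuous_const).const_mul (1 / c)
  have e : W.d / c * ∫ s, ψ s ^ 2 = ∫ p in straightStrip W.d, 1 / c * (ψ p.1 ^ 2 * 1) := by
    rw [integral_const_mul, integral_tensor (fun s => ψ s ^ 2) (fun _ => 1)]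
    simp [W.d_pos.le]
    ring
  rw [e]
  refine integral_mono_of_nonneg ?_ i ?_
  · filter_upwards [ae_mem_straightStrip W.d] with p hp
    have := W.density_pos hp
    positivity
  · filter_upwards [ae_mem_straightStrip W.d] with p hp
    have h1 := one_div_le_one_div_of_le hc (hle p hp)
    rw [mul_pow]
    gcongr
    exact Real.sin_sq_le_one _

/-- There is a function in the form domain whose energy lies below the transversal threshold. -/
theorem exists_energy_lt {s₀ : ℝ} (hsupp : ∀ s : ℝ, s₀ ≤ |s| → W.γ s = 0)
    (hbend : ∫ s, W.γ s = 0) (hne : W.γ ≠ 0) : ∃ v : W.formSpace,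
      ‖v.1.snd.fst‖ ^ 2 + ‖v.1.snd.snd‖ ^ 2 <
        W.transversalFrequency ^ 2 * ‖W.formEmbedding v‖ ^ 2 := by
  obtain ⟨a, b, hw⟩ := W.exists_isBoundedWeight_density
  obtain ⟨a', b', hw'⟩ := W.exists_isBoundedWeight_inv_density
  obtain ⟨c, C, hc, hle⟩ := W.exists_density_bounds
  set κ := W.transversalFrequency with hκ
  have hd := W.d_pos
  -- The excess over the threshold energy is at most `(d / c) ∫ ψ'² + ½ ∫ γ ψ²`; doubling it gives
  -- the constant `2d / c`.
  obtain ⟨ψ, hψ, hψc, hlt⟩ := exists_contDiff_energy_neg W.continuous_γ hsupp hbend hne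
    (C := 2 * (W.d / c)) (by positivity)
  have hs : ContDiff ℝ ∞ fun u => Real.sin (κ * u) :=
    Real.contDiff_sin.comp (contDiff_const.mul contDiff_id)
  have hs' : deriv (fun u => Real.sin (κ * u)) = fun u => κ * Real.cos (κ * u) := funext fun u => by
    have hl : HasDerivAt (fun u => κ * u) κ u := by simpa using (hasDerivAt_id u).const_mul κ
    rw [hl.sin.deriv, mul_comm]
  have hD := hasDirichletDeriv_tensor hψ hs (by simp) hd
  rw [hs'] at hD
  obtain ⟨v, h0, h1, h2⟩ := exists_formSpace (W := W) (memLp_tensor hψ.continuous hψc hs.continuous)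
    (hasL2WeakDeriv_tensor hψ hψc hs) (memLp_tensor hψ.continuous hψc
      (c := fun u => κ * Real.cos (κ * u)) (by fun_prop)) hD
  refine ⟨v, ?_⟩
  have n0 : ‖W.formEmbedding v‖ ^ 2 = _ := hw.norm_sq_eq h0
  have n1 : ‖v.1.snd.fst‖ ^ 2 = _ := hw'.norm_sq_eq h1
  have n2 : ‖v.1.snd.snd‖ ^ 2 = _ := hw.norm_sq_eq h2
  rw [n0, n1, n2]
  have k1 := integral_transversal_energy (W := W) hψ.continuous hψc
  have k2 := integral_longitudinal_energy_le hc (fun p hp => (hle p hp).1)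
    (hψ.continuous_deriv (by simp)) hψc.deriv κ
  rw [← hκ] at k1
  linarith

/-- A Rayleigh quotient below `κ²` reads `‖v‖² < (κ² + 1) ‖J v‖²` once the term `‖J v‖²` of the form
norm is included. -/
theorem inv_lt_norm_formEmbedding_sq {v : W.formSpace} (hv : ‖v.1.snd.fst‖ ^ 2 + ‖v.1.snd.snd‖ ^ 2 <
    W.transversalFrequency ^ 2 * ‖W.formEmbedding v‖ ^ 2) :
    (W.transversalFrequency ^ 2 + 1)⁻¹ < ‖W.formEmbedding‖ ^ 2 := by
  set κ := W.transversalFrequency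
  have h1 := norm_sq_formSpace v
  have h2 : ‖W.formEmbedding v‖ ≤ ‖W.formEmbedding‖ * ‖v‖ := W.formEmbedding.le_opNorm v
  have h3 := pow_le_pow_left₀ (norm_nonneg _) h2 2
  rw [mul_pow] at h3
  have hpos : 0 < ‖W.formEmbedding v‖ ^ 2 := by
    by_contra! h
    have : ‖W.formEmbedding v‖ ^ 2 = 0 := le_antisymm h (sq_nonneg _)
    rw [this] at hv
    linarith [sq_nonneg ‖v.1.snd.fst‖, sq_nonneg ‖v.1.snd.snd‖]
  rw [inv_lt_iff_one_lt_mul₀ (by positivity)]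
  by_contra! h
  have hv2 : ‖v‖ ^ 2 < (κ ^ 2 + 1) * ‖W.formEmbedding v‖ ^ 2 := by linarith
  have h4 : (κ ^ 2 + 1) * ‖W.formEmbedding v‖ ^ 2 ≤
      ((κ ^ 2 + 1) * ‖W.formEmbedding‖ ^ 2) * ‖v‖ ^ 2 := by
    rw [mul_assoc]
    gcongr
  have h5 := mul_le_mul_of_nonneg_right h (sq_nonneg ‖v‖)
  nlinarith

theorem norm_exterior_lt {s₀ : ℝ} (hsupp : ∀ s : ℝ, s₀ ≤ |s| → W.γ s = 0)
    (h : (W.transversalFrequency ^ 2 + 1)⁻¹ < ‖W.formEmbedding‖ ^ 2) :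
    ‖indicatorOperator (measurableSet_middlePart W.d s₀).compl ∘L W.formEmbedding‖ <
      ‖W.formEmbedding‖ := by
  refine lt_of_le_of_lt (ContinuousLinearMap.opNorm_le_bound _ (Real.sqrt_nonneg _) fun v => ?_)
    ((Real.sqrt_lt_sqrt (by positivity) h).trans_eq (Real.sqrt_sq (norm_nonneg W.formEmbedding)))
  exact norm_le_of_sq_le (norm_nonneg v) (norm_exterior_formEmbedding_le hsupp v)

theorem formEmbedding_eq_add (s₀ : ℝ) : W.formEmbedding =
    indicatorOperator (measurableSet_middlePart W.d s₀) ∘L W.formEmbedding +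
      indicatorOperator (measurableSet_middlePart W.d s₀).compl ∘L W.formEmbedding := by
  refine ContinuousLinearMap.ext fun v => ?_
  exact (indicatorOperator_add_compl (measurableSet_middlePart W.d s₀) (W.formEmbedding v)).symm

theorem isDiscreteEigenvalue_bottom {s₀ : ℝ} (hsupp : ∀ s : ℝ, s₀ ≤ |s| → W.γ s = 0)
    (h : (W.transversalFrequency ^ 2 + 1)⁻¹ < ‖W.formEmbedding‖ ^ 2) :
    0 < (‖W.formEmbedding‖ ^ 2)⁻¹ - 1 ∧
      IsLeast {x : ℝ | (x : ℂ) ∈ opSpectrum W.hamiltonian} ((‖W.formEmbedding‖ ^ 2)⁻¹ - 1) ∧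
      IsDiscreteEigenvalue W.hamiltonian (((‖W.formEmbedding‖ ^ 2)⁻¹ - 1 : ℝ) : ℂ) := by
  have h1 := isCompactOperator_interior_formEmbedding (W := W) s₀
  have h2 := norm_exterior_lt hsupp h
  have h3 := norm_formEmbedding_lt_one (W := W)
  have h4 := formEmbedding_eq_add (W := W) s₀
  generalize indicatorOperator (measurableSet_middlePart W.d s₀) ∘L W.formEmbedding = K at h1 h4
  generalize indicatorOperator (measurableSet_middlePart W.d s₀).compl ∘L W.formEmbedding = B
    at h2 h4
  have := exists_isDiscreteEigenvalue_of_form_embedding (V := W.formSpace) (H := W.HilbertSpace)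
    (A := W.hamiltonian) (J := W.formEmbedding) (K := K) (B := B)
  exact this mem_hamiltonian_graph_iff h4 h1 h2 h3

end CurvedStrip

/-! ### The main theorem. -/

theorem mainTheorem3 (W : CurvedStrip) (s₀ : ℝ) (hs₀ : 0 < s₀)
    (hsupp : ∀ s : ℝ, s₀ ≤ |s| → W.γ s = 0)
    (hbend : ∫ s in (-s₀)..s₀, W.γ s = 0)
    (hne : 0 < eLpNorm W.γ 2 volume) :
    (∃ E : ℝ, IsGLB {x : ℝ | (x : ℂ) ∈ opSpectrum W.hamiltonian} E ∧
      E < Real.pi ^ 2 / (4 * W.d ^ 2)) ∧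
    ∃ μ : ℝ, 0 < μ ∧ μ < Real.pi ^ 2 / (4 * W.d ^ 2) ∧
      IsDiscreteEigenvalue W.hamiltonian (μ : ℂ) := by
  have hγ : W.γ ≠ 0 := fun h => by
    rw [h, eLpNorm_zero] at hne
    exact lt_irrefl _ hne
  have hint : ∫ s, W.γ s = 0 := by
    rw [← hbend, intervalIntegral.integral_of_le (by linarith)]
    refine (setIntegral_eq_integral_of_forall_compl_eq_zero fun s hs => hsupp s ?_).symm
    by_contra! h
    rw [abs_lt] at h
    exact hs ⟨h.1, h.2.le⟩
  obtain ⟨v, hv⟩ := CurvedStrip.exists_energy_lt hsupp hint hγ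
  have hJ := CurvedStrip.inv_lt_norm_formEmbedding_sq hv
  obtain ⟨h1, h2, h3⟩ := CurvedStrip.isDiscreteEigenvalue_bottom hsupp hJ
  -- Inverting `1 / (κ² + 1) < ‖J‖²` gives `‖J‖⁻² - 1 < κ²`, and `κ²` is the threshold.
  have hlt : (‖W.formEmbedding‖ ^ 2)⁻¹ - 1 < Real.pi ^ 2 / (4 * W.d ^ 2) := by
    have h4 := inv_strictAnti₀ (by positivity) hJ
    rw [inv_inv, CurvedStrip.transversalFrequency] at h4
    rw [show Real.pi ^ 2 / (4 * W.d ^ 2) = (Real.pi / (2 * W.d)) ^ 2 by ring]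
    linarith
  exact ⟨⟨_, h2.isGLB, hlt⟩, _, h1, hlt, h3⟩
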